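/- **Notation.** A C*-seminorm on a complex *-algebra $A$ is a seminorm $p$ with $p(ab)\le p(a)p(b)$ and $p(a^*a)=p(a)^2$. A *maximal C*-norm* is a C*-seminorm that is a norm and dominates every C*-seminorm. The enveloping C*-algebra $C^*(A)$ of a Banach *-algebra $A$ is its (Hausdorff) completion with respect to the supremum of all its C*-seminorms. For a topological space $Y$ and a continuous family $(\sigma_y)_{y\in Y}$ of skew-symmetric bilinear forms on $\mathbb R^n$, the space $C_0(Y,L^1(\mathbb R^n))$ is a Banach *-algebra with $$(f\times g)(y,\alpha)=\int f(y,\alpha')\,g(y,\alpha-\alpha')\,e^{\frac i2\sigma_y(\alpha,\alpha')}\,d\alpha',\qquad f^*(y,\alpha)=\overline{f(y,-\alpha)},\qquad \|f\|=\sup_y\|f(y,\cdot)\|_1 .$$ Let $\Sigma_0$ be the set of nonzero antisymmetric real $4\times4$ matrices $\sigma=\begin{bmatrix}0&e^T\\-e&*m\end{bmatrix}$, $e,m\in\mathbb R^3$, $(*m)_{ij}=\sum_k\varepsilon_{ijk}m_k$, such that $\|e\|=\|m\|$ and $e\cdot m=0$, with $\sigma(\alpha,\beta)=\alpha^T\sigma\beta$;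 let $J=\begin{bmatrix}0&-1\\1&0\end{bmatrix}$ and $\sigma^{\mathrm{std}}=J\oplus 0_2$ on $\mathbb R^4=\mathbb R^2\oplus\mathbb R^2\ni\alpha_q\oplus\alpha_c$. Consider the Banach *-algebras * $\mathcal E_0=C_0(\Sigma_0,L^1(\mathbb R^4))$, twisted at $\sigma\in\Sigma_0$ by $\sigma$ itself (the algebra of the scale-covariant quantum space-time, whose C*-algebra is $C^*(\mathcal E_0)$); * $\mathcal E_{\mathrm{std}}=C_0(\Sigma_0,L^1(\mathbb R^4))$, twisted by the constant form $\sigma^{\mathrm{std}}$; * $\mathcal E_{\mathrm{std}}^{(2)}=C_0(\Sigma_0\times\mathbb R^2,L^1(\mathbb R^2))$, twisted by the constant form $J$. **Theorem.** Let $\mathcal K$ be the C*-algebra of compact operators on an infinite-dimensional separable complex Hilbert space. 1. $\mathcal E_{\mathrm{std}}^{(2)}$ has a unique maximal C*-norm. 2. $C^*(\mathcal E_{\mathrm{std}}^{(2)})$ is *-isomorphic to $C_0(\Sigma_0\times\mathbb R^2,\mathcal K)$. 3. The partial Fourier transform $$\mathscr F_2[f](\sigma,x_c,\alpha_q)=\int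 f(\sigma,\alpha_q\oplus\alpha_c)\,e^{i\langle x_c,\alpha_c\rangle}\,d^2\alpha_c$$ defines an injective *-homomorphism $\mathscr F_2:\mathcal E_{\mathrm{std}}\to\mathcal E_{\mathrm{std}}^{(2)}$, and it induces a *-isomorphism $\psi:C^*(\mathcal E_{\mathrm{std}})\to C^*(\mathcal E_{\mathrm{std}}^{(2)})$, that is, $\psi$ maps the class of $f$ to the class of $\mathscr F_2[f]$ for all $f\in\mathcal E_{\mathrm{std}}$. 4. The *-algebras $\mathcal E_0$ and $\mathcal E_{\mathrm{std}}$ are isomorphic, and the C*-algebra $C^*(\mathcal E_0)$ of the scale-covariant quantum space-time is *-isomorphic to $C_0(\Sigma_0\times\mathbb R^2,\mathcal K)$. -/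

import Mathlib

open MeasureTheory Filter Topology
open scoped ZeroAtInfty

noncomputable section

/-! ## C*-seminorms and the enveloping C*-algebra of a Banach *-algebra -/

/-- A C*-seminorm on a complex *-algebra: a submultiplicative seminorm with
`p (a⋆ a) = p a ^ 2`. -/
structure CStarSeminorm (A : Type*) [NonUnitalRing A] [StarRing A] [Module ℂ A] extends
    Seminorm ℂ A where
  mul_le' : ∀ a b : A, toSeminorm (a * b) ≤ toSeminorm a * toSeminorm b
  star_mul_self' : ∀ a : A, toSeminorm (star a * a) = toSeminorm a ^ 2

namespace CStarSeminorm

section Basic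

variable {A : Type*} [NonUnitalRing A] [StarRing A] [Module ℂ A]

instance : CoeFun (CStarSeminorm A) (fun _ => A → ℝ) := ⟨fun p => p.toSeminorm⟩

/-- `p` is a maximal C*-norm: it is a norm, and it dominates every C*-seminorm. -/
def IsMaximalNorm (p : CStarSeminorm A) : Prop :=
  (∀ a : A, p a = 0 → a = 0) ∧ ∀ q : CStarSeminorm A, ∀ a : A, q a ≤ p a

theorem star_le (p : CStarSeminorm A) (a : A) : p (star a) ≤ p a := by
  have h1 := p.star_mul_self' (star a)
  rw [star_star] at h1
  have h2 := p.mul_le' a (star a)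
  rw [h1] at h2
  by_contra! h
  have h0 : 0 ≤ p a := apply_nonneg p.toSeminorm a
  nlinarith

theorem star_eq (p : CStarSeminorm A) (a : A) : p (star a) = p a := by
  refine le_antisymm (p.star_le a) ?_
  simpa using p.star_le (star a)

/-- The algebra `A`, seminormed by `p`. -/
@[nolint unusedArguments]
def Pre (_p : CStarSeminorm A) : Type _ := A

variable (p : CStarSeminorm A)

instance : NonUnitalRing p.Pre := inferInstanceAs (NonUnitalRing A)
instance : StarRing p.Pre := inferInstanceAs (StarRing A)
instance : Module ℂ p.Pre := inferInstanceAs (Module ℂ A)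

instance [IsScalarTower ℂ A A] : IsScalarTower ℂ p.Pre p.Pre :=
  inferInstanceAs (IsScalarTower ℂ A A)
instance [SMulCommClass ℂ A A] : SMulCommClass ℂ p.Pre p.Pre :=
  inferInstanceAs (SMulCommClass ℂ A A)
instance [StarModule ℂ A] : StarModule ℂ p.Pre := inferInstanceAs (StarModule ℂ A)

instance : SeminormedAddCommGroup p.Pre :=
  { (AddGroupSeminorm.toSeminormedAddCommGroup (p.toSeminorm.toAddGroupSeminorm) :
      SeminormedAddCommGroup A) with
    toAddCommGroup := inferInstanceAs (AddCommGroup A) }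

theorem norm_pre (a : p.Pre) : ‖a‖ = p (show A from a) := rfl

instance : NonUnitalSeminormedRing p.Pre :=
  { (inferInstance : SeminormedAddCommGroup p.Pre), (inferInstance : NonUnitalRing p.Pre) with
    norm_mul_le := p.mul_le' }

instance : NormedSpace ℂ p.Pre where
  norm_smul_le c a := (map_smul_eq_mul p.toSeminorm c a).le

instance : NormedStarGroup p.Pre where
  norm_star_le a := p.star_le a

/-- The C*-algebra obtained by completing `A` with respect to the C*-seminorm `p` (elements at
`p`-distance `0` are identified by the completion). -/
def Completion : Type _ := UniformSpace.Completion p.Pre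

namespace Completion

instance : NormedAddCommGroup p.Completion :=
  inferInstanceAs (NormedAddCommGroup (UniformSpace.Completion p.Pre))
instance : NormedSpace ℂ p.Completion :=
  inferInstanceAs (NormedSpace ℂ (UniformSpace.Completion p.Pre))
instance : CompleteSpace p.Completion :=
  inferInstanceAs (CompleteSpace (UniformSpace.Completion p.Pre))

/-- The canonical map from `A` to its completion. -/
def of (a : A) : p.Completion := ((show p.Pre from a : p.Pre) : UniformSpace.Completion p.Pre)

theorem norm_of (a : A) : ‖of p a‖ = p a :=
  UniformSpace.Completion.norm_coe (E := p.Pre) a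

theorem denseRange_of : DenseRange (of p) :=
  UniformSpace.Completion.denseRange_coe (α := p.Pre)

theorem of_add (a b : A) : of p (a + b) = of p a + of p b :=
  UniformSpace.Completion.coe_add (α := p.Pre) a b

theorem of_smul (c : ℂ) (a : A) : of p (c • a) = c • of p a :=
  UniformSpace.Completion.coe_smul (X := p.Pre) c a

theorem of_zero : of p 0 = 0 := rfl

/-- The product of the completion: the continuous extension of the product of `A`. -/
instance : Mul p.Completion :=
  ⟨Function.curry <| ((UniformSpace.Completion.isDenseInducing_coe (α := p.Pre)).prodMap
    (UniformSpace.Completion.isDenseInducing_coe (α := p.Pre))).extend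
    (fun x => ((x.1 * x.2 : p.Pre) : UniformSpace.Completion p.Pre))⟩

/-- The involution of the completion: the continuous extension of the involution of `A`. -/
instance : Star p.Completion :=
  ⟨UniformSpace.Completion.map (star : p.Pre → p.Pre)⟩

theorem of_mul (a b : A) : of p (a * b) = of p a * of p b :=
  (((UniformSpace.Completion.isDenseInducing_coe (α := p.Pre)).prodMap
    (UniformSpace.Completion.isDenseInducing_coe (α := p.Pre))).extend_eq
      ((UniformSpace.Completion.continuous_coe p.Pre).comp
        (continuous_mul (M := p.Pre))) ((a, b) : p.Pre × p.Pre)).symm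

theorem of_star (a : A) : of p (star a) = star (of p a) :=
  (UniformSpace.Completion.map_coe (α := p.Pre) (β := p.Pre)
    (f := star) (star_isometry (E := p.Pre)).uniformContinuous a).symm


theorem continuous_mul' : Continuous fun x : p.Completion × p.Completion => x.1 * x.2 := by
  let m := (AddMonoidHom.mul : p.Pre →+ p.Pre →+ p.Pre).compr₂ UniformSpace.Completion.toCompl
  have : Continuous fun x : p.Pre × p.Pre => m x.1 x.2 :=
    (UniformSpace.Completion.continuous_coe p.Pre).comp continuous_mul
  have di : IsDenseInducing (UniformSpace.Completion.toCompl : p.Pre → _) :=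
    UniformSpace.Completion.isDenseInducing_coe
  exact (di.extend_Z_bilin di this :)

instance : ContinuousMul p.Completion := ⟨continuous_mul' p⟩

instance : ContinuousStar p.Completion :=
  ⟨UniformSpace.Completion.continuous_map (f := (star : p.Pre → p.Pre))⟩

theorem ind {P : p.Completion → Prop} (hc : IsClosed {x | P x}) (h : ∀ a, P (of p a))
    (x : p.Completion) : P x :=
  UniformSpace.Completion.induction_on (α := p.Pre) x hc h

theorem ind₂ {P : p.Completion → p.Completion → Prop}
    (hc : IsClosed {x : p.Completion × p.Completion | P x.1 x.2})
    (h : ∀ a b, P (of p a) (of p b)) (x y : p.Completion) : P x y :=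
  UniformSpace.Completion.induction_on₂ (α := p.Pre) (β := p.Pre) x y hc h

theorem ind₃ {P : p.Completion → p.Completion → p.Completion → Prop}
    (hc : IsClosed {x : p.Completion × p.Completion × p.Completion | P x.1 x.2.1 x.2.2})
    (h : ∀ a b c, P (of p a) (of p b) (of p c)) (x y z : p.Completion) : P x y z :=
  UniformSpace.Completion.induction_on₃ (α := p.Pre) (β := p.Pre) (γ := p.Pre) x y z hc h

instance : ContinuousConstSMul ℂ p.Completion :=
  inferInstanceAs (ContinuousConstSMul ℂ (UniformSpace.Completion p.Pre))

theorem star_smul' [StarModule ℂ A] (c : ℂ) (x : p.Completion) :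
    star (c • x) = star c • star x := by
  refine ind p (P := fun x => star (c • x) = star c • star x)
    (isClosed_eq (continuous_star.comp (continuous_const_smul c))
    ((continuous_const_smul (star c)).comp continuous_star)) (fun a => ?_) x
  simp only [← of_star, ← of_smul, star_smul]

theorem smul_mul' [IsScalarTower ℂ A A] (c : ℂ) (x y : p.Completion) :
    (c • x) * y = c • (x * y) := by
  refine ind₂ p (P := fun x y => (c • x) * y = c • (x * y)) (isClosed_eq
    ((continuous_mul' p).comp (((continuous_const_smul c).comp continuous_fst).prodMk
      continuous_snd))
    ((continuous_const_smul c).comp (continuous_mul' p))) (fun a b => ?_) x y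
  simp only [← of_mul, ← of_smul, smul_mul_assoc]

theorem mul_smul' [SMulCommClass ℂ A A] (c : ℂ) (x y : p.Completion) :
    x * (c • y) = c • (x * y) := by
  refine ind₂ p (P := fun x y => x * (c • y) = c • (x * y)) (isClosed_eq
    ((continuous_mul' p).comp (continuous_fst.prodMk
      ((continuous_const_smul c).comp continuous_snd)))
    ((continuous_const_smul c).comp (continuous_mul' p))) (fun a b => ?_) x y
  simp only [← of_mul, ← of_smul, mul_smul_comm]

instance : NonUnitalNormedRing p.Completion :=
  { (inferInstance : NormedAddCommGroup p.Completion), (inferInstance : Mul p.Completion) with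
    zero_mul := ind p (isClosed_eq (by fun_prop) (by fun_prop)) fun a => by
      rw [← of_zero, ← of_mul, zero_mul]
    mul_zero := ind p (isClosed_eq (by fun_prop) (by fun_prop)) fun a => by
      rw [← of_zero, ← of_mul, mul_zero]
    mul_assoc := ind₃ p (isClosed_eq (by fun_prop) (by fun_prop)) fun a b c => by
      simp only [← of_mul, mul_assoc]
    left_distrib := ind₃ p (isClosed_eq (by fun_prop) (by fun_prop)) fun a b c => by
      simp only [← of_mul, ← of_add, mul_add]
    right_distrib := ind₃ p (isClosed_eq (by fun_prop) (by fun_prop)) fun a b c => by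
      simp only [← of_mul, ← of_add, add_mul]
    norm_mul_le := ind₂ p (isClosed_le (by fun_prop) (by fun_prop)) fun a b => by
      simp only [← of_mul, norm_of]
      exact p.mul_le' a b }

instance : StarRing p.Completion where
  star_involutive := ind p (isClosed_eq (by fun_prop) (by fun_prop)) fun a => by
    simp only [← of_star, star_star]
  star_mul := ind₂ p (isClosed_eq (by fun_prop) (by fun_prop)) fun a b => by
    simp only [← of_star, ← of_mul, star_mul]
  star_add := ind₂ p (isClosed_eq (by fun_prop) (by fun_prop)) fun a b => by
    simp only [← of_star, ← of_add, star_add]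

instance : CStarRing p.Completion where
  norm_mul_self_le := ind p (isClosed_le (by fun_prop) (by fun_prop)) fun a => by
    simp only [← of_star, ← of_mul, norm_of]
    rw [p.star_mul_self', sq]

instance [StarModule ℂ A] : StarModule ℂ p.Completion := ⟨star_smul' p⟩

instance [IsScalarTower ℂ A A] : IsScalarTower ℂ p.Completion p.Completion := ⟨smul_mul' p⟩

instance [SMulCommClass ℂ A A] : SMulCommClass ℂ p.Completion p.Completion :=
  ⟨fun c x y => (mul_smul' p c x y).symm⟩

instance [StarModule ℂ A] [IsScalarTower ℂ A A] [SMulCommClass ℂ A A] :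
    NonUnitalCStarAlgebra p.Completion where

/-- The canonical *-homomorphism from `A` to its completion. -/
def ofHom : A →⋆ₙₐ[ℂ] p.Completion where
  toFun := of p
  map_smul' := of_smul p
  map_zero' := of_zero p
  map_add' := of_add p
  map_mul' := of_mul p
  map_star' := of_star p

end Completion
end Basic

section Banach

variable {A : Type*} [NonUnitalNormedRing A] [StarRing A] [NormedStarGroup A] [CompleteSpace A]
  [NormedSpace ℂ A] [IsScalarTower ℂ A A] [SMulCommClass ℂ A A] [StarModule ℂ A]

open Unitization in
/-- On a Banach *-algebra every C*-seminorm is dominated by the norm. -/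
theorem le_norm (p : CStarSeminorm A) (a : A) : p a ≤ ‖a‖ := by
  have key : ∀ s : A, IsSelfAdjoint s → p s ≤ ‖s‖ := by
    intro s hs
    let φ : A →⋆ₙₐ[ℂ] Unitization ℂ p.Completion :=
      (inrNonUnitalStarAlgHom ℂ p.Completion).comp (Completion.ofHom p)
    let ψ : Unitization ℂ A →⋆ₐ[ℂ] Unitization ℂ p.Completion := starLift φ
    let e : WithLp 1 (Unitization ℂ A) ≃ₐ[ℂ] Unitization ℂ A := WithLp.unitizationAlgEquiv ℂ
    let χ : WithLp 1 (Unitization ℂ A) →ₐ[ℂ] Unitization ℂ p.Completion :=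
      (ψ : Unitization ℂ A →ₐ[ℂ] Unitization ℂ p.Completion).comp e.toAlgHom
    let x : WithLp 1 (Unitization ℂ A) := WithLp.toLp 1 (s : Unitization ℂ A)
    have hx : ‖x‖ = ‖s‖ := WithLp.unitization_norm_inr s
    have hχ : χ x = φ s := by
      change ψ (s : Unitization ℂ A) = φ s
      exact congrArg (fun g : A →⋆ₙₐ[ℂ] Unitization ℂ p.Completion => g s) (starLift.symm_apply_apply φ)
    have hsa : IsSelfAdjoint (φ s) := hs.map φ
    have h1 : spectralRadius ℂ (φ s) ≤ spectralRadius ℂ x := by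
      rw [← hχ]
      exact iSup_le_iSup_of_subset (AlgHom.spectrum_apply_subset χ x)
    have h2 : spectralRadius ℂ x ≤ ‖x‖₊ := by
      have : NormOneClass (WithLp 1 (Unitization ℂ A)) :=
        ⟨by
          rw [WithLp.unitization_norm_def]
          change ‖(1 : Unitization ℂ A).fst‖ + ‖(1 : Unitization ℂ A).snd‖ = 1
          simp⟩
      exact spectrum.spectralRadius_le_nnnorm x
    have h3 : ‖φ s‖₊ ≤ ‖x‖₊ := by
      rw [hsa.spectralRadius_eq_nnnorm] at h1
      exact_mod_cast h1.trans h2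
    have h4 : ‖φ s‖ = p s := by
      change ‖((Completion.of p s : p.Completion) : Unitization ℂ p.Completion)‖ = _
      rw [norm_inr, Completion.norm_of]
    rw [← h4, ← hx]
    exact h3
  have h0 : 0 ≤ p a := apply_nonneg p.toSeminorm a
  have h1 : p a ^ 2 ≤ ‖a‖ ^ 2 := by
    rw [← p.star_mul_self' a]
    calc p (star a * a) ≤ ‖star a * a‖ := key _ (IsSelfAdjoint.star_mul_self a)
      _ ≤ ‖star a‖ * ‖a‖ := norm_mul_le _ _
      _ = ‖a‖ ^ 2 := by rw [norm_star, sq]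
  exact (sq_le_sq₀ h0 (norm_nonneg a)).1 h1

theorem bddAbove_apply (a : A) : BddAbove (Set.range fun p : CStarSeminorm A => p a) :=
  ⟨‖a‖, by rintro _ ⟨p, rfl⟩; exact p.le_norm a⟩

instance : Zero (CStarSeminorm A) :=
  ⟨{ (0 : Seminorm ℂ A) with
      mul_le' := fun a b => by
        change (0 : ℝ) ≤ 0 * 0
        simp
      star_mul_self' := fun a => by
        change (0 : ℝ) = 0 ^ 2
        simp }⟩

theorem iSup_star_mul_self (a : A) :
    (⨆ p : CStarSeminorm A, p (star a * a)) = (⨆ p : CStarSeminorm A, p a) ^ 2 := by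
  apply le_antisymm
  · refine ciSup_le fun p => ?_
    rw [p.star_mul_self']
    exact pow_le_pow_left₀ (apply_nonneg p.toSeminorm a) (le_ciSup (bddAbove_apply a) p) 2
  · have h0 : ∀ b : A, 0 ≤ ⨆ p : CStarSeminorm A, p b := fun b =>
      Real.iSup_nonneg (fun p : CStarSeminorm A => apply_nonneg p.toSeminorm b)
    have h : (⨆ p : CStarSeminorm A, p a) ≤ √(⨆ p : CStarSeminorm A, p (star a * a)) := by
      refine ciSup_le fun p => Real.le_sqrt_of_sq_le ?_
      have h1 := p.star_mul_self' a
      have h2 := le_ciSup (bddAbove_apply (star a * a)) p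
      exact h1.symm.le.trans h2
    have h3 := pow_le_pow_left₀ (h0 a) h 2
    rwa [Real.sq_sqrt (h0 _)] at h3

variable (A) in
/-- The maximal C*-seminorm of a Banach *-algebra: the supremum of all C*-seminorms. -/
def maxCStarSeminorm : CStarSeminorm A where
  toFun a := ⨆ p : CStarSeminorm A, p a
  map_zero' := by simp
  add_le' a b := ciSup_le fun p => (map_add_le_add p.toSeminorm a b).trans
    (add_le_add (le_ciSup (bddAbove_apply a) p) (le_ciSup (bddAbove_apply b) p))
  neg' a := by simp
  smul' c a := by
    simp only [map_smul_eq_mul]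
    exact (Real.mul_iSup_of_nonneg (norm_nonneg c) _).symm
  mul_le' a b := ciSup_le fun p => (p.mul_le' a b).trans
    (mul_le_mul (le_ciSup (bddAbove_apply a) p) (le_ciSup (bddAbove_apply b) p)
      (apply_nonneg p.toSeminorm b)
      ((apply_nonneg p.toSeminorm a).trans (le_ciSup (bddAbove_apply a) p)))
  star_mul_self' a := iSup_star_mul_self a

theorem maxCStarSeminorm_apply (a : A) :
    maxCStarSeminorm A a = ⨆ p : CStarSeminorm A, p a := rfl

theorem le_maxCStarSeminorm (p : CStarSeminorm A) (a : A) : p a ≤ maxCStarSeminorm A a :=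
  le_ciSup (bddAbove_apply a) p

end Banach
end CStarSeminorm

section Enveloping

variable (A : Type*) [NonUnitalNormedRing A] [StarRing A] [NormedStarGroup A] [CompleteSpace A]
  [NormedSpace ℂ A] [IsScalarTower ℂ A A] [SMulCommClass ℂ A A] [StarModule ℂ A]

/-- The enveloping C*-algebra of a Banach *-algebra: its completion with respect to its maximal
C*-seminorm. -/
abbrev EnvelopingCStarAlgebra : Type _ := (CStarSeminorm.maxCStarSeminorm A).Completion

/-- The canonical *-homomorphism from a Banach *-algebra to its enveloping C*-algebra. -/
abbrev EnvelopingCStarAlgebra.of : A →⋆ₙₐ[ℂ] EnvelopingCStarAlgebra A :=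
  CStarSeminorm.Completion.ofHom (CStarSeminorm.maxCStarSeminorm A)

end Enveloping

/-! ## Twisted convolution on `L¹(ℝⁿ)` -/

/-- A skew-symmetric bilinear form on `ℝⁿ`, given by its matrix. -/
abbrev SkewForm (n : ℕ) : Type := {σ : Matrix (Fin n) (Fin n) ℝ // σ.transpose = -σ}

/-- `L¹(ℝⁿ)` with complex values, with respect to Lebesgue measure. -/
abbrev L1C (n : ℕ) : Type := Lp ℂ 1 (volume : Measure (EuclideanSpace ℝ (Fin n)))

namespace SkewForm

variable {n : ℕ}

/-- `σ(α, β) = ∑ αᵘ σ_{uv} βᵛ`. -/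
def pairing (σ : SkewForm n) (α β : EuclideanSpace ℝ (Fin n)) : ℝ :=
  ∑ i, ∑ j, α i * σ.1 i j * β j

/-- The phase `exp (i/2 σ(α, β))`. -/
def phase (σ : SkewForm n) (α β : EuclideanSpace ℝ (Fin n)) : ℂ :=
  Complex.exp (Complex.I / 2 * (σ.pairing α β : ℂ))

theorem pairing_add_left (σ : SkewForm n) (α α' β : EuclideanSpace ℝ (Fin n)) :
    σ.pairing (α + α') β = σ.pairing α β + σ.pairing α' β := by
  simp only [pairing, PiLp.add_apply, add_mul, Finset.sum_add_distrib]

theorem pairing_add_right (σ : SkewForm n) (α β β' : EuclideanSpace ℝ (Fin n)) :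
    σ.pairing α (β + β') = σ.pairing α β + σ.pairing α β' := by
  simp only [pairing, PiLp.add_apply, mul_add, Finset.sum_add_distrib]

theorem pairing_neg_left (σ : SkewForm n) (α β : EuclideanSpace ℝ (Fin n)) :
    σ.pairing (-α) β = -σ.pairing α β := by
  simp [pairing]

theorem pairing_neg_right (σ : SkewForm n) (α β : EuclideanSpace ℝ (Fin n)) :
    σ.pairing α (-β) = -σ.pairing α β := by
  simp [pairing]

theorem pairing_swap (σ : SkewForm n) (α β : EuclideanSpace ℝ (Fin n)) :
    σ.pairing β α = -σ.pairing α β := by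
  have h : ∀ i j, σ.1 j i = -σ.1 i j := fun i j => congrFun (congrFun σ.2 i) j
  unfold pairing
  rw [Finset.sum_comm, ← Finset.sum_neg_distrib]
  refine Finset.sum_congr rfl fun i _ => ?_
  rw [← Finset.sum_neg_distrib]
  refine Finset.sum_congr rfl fun j _ => ?_
  rw [h i j]
  ring

theorem pairing_self (σ : SkewForm n) (α : EuclideanSpace ℝ (Fin n)) : σ.pairing α α = 0 := by
  have := σ.pairing_swap α α
  linarith

theorem norm_phase (σ : SkewForm n) (α β : EuclideanSpace ℝ (Fin n)) : ‖σ.phase α β‖ = 1 := by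
  rw [phase, show Complex.I / 2 * (σ.pairing α β : ℂ)
    = ((σ.pairing α β / 2 : ℝ) : ℂ) * Complex.I by push_cast; ring]
  exact Complex.norm_exp_ofReal_mul_I _

theorem phase_mul_phase_assoc (σ : SkewForm n) (α β γ : EuclideanSpace ℝ (Fin n)) :
    σ.phase α γ * σ.phase (α - γ) (β - γ) = σ.phase β γ * σ.phase α β := by
  simp only [phase, ← Complex.exp_add, ← mul_add, ← Complex.ofReal_add, sub_eq_add_neg,
    pairing_add_left, pairing_add_right, pairing_neg_left, pairing_neg_right, pairing_self,
    σ.pairing_swap β γ]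
  congr 3
  ring

theorem continuous_pairing : Continuous fun x : SkewForm n × EuclideanSpace ℝ (Fin n) ×
    EuclideanSpace ℝ (Fin n) => x.1.pairing x.2.1 x.2.2 := by
  have h1 : ∀ i j, Continuous fun x : SkewForm n × EuclideanSpace ℝ (Fin n) ×
      EuclideanSpace ℝ (Fin n) => x.1.1 i j := fun i j =>
    (continuous_subtype_val.matrix_elem i j).comp continuous_fst
  have h2 : ∀ i, Continuous fun x : SkewForm n × EuclideanSpace ℝ (Fin n) ×
      EuclideanSpace ℝ (Fin n) => x.2.1 i := fun i =>
    (EuclideanSpace.proj (𝕜 := ℝ) i).continuous.comp (continuous_fst.comp continuous_snd)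
  have h3 : ∀ i, Continuous fun x : SkewForm n × EuclideanSpace ℝ (Fin n) ×
      EuclideanSpace ℝ (Fin n) => x.2.2 i := fun i =>
    (EuclideanSpace.proj (𝕜 := ℝ) i).continuous.comp (continuous_snd.comp continuous_snd)
  exact continuous_finsetSum _ fun i _ => continuous_finsetSum _ fun j _ =>
    ((h2 i).mul (h1 i j)).mul (h3 j)

theorem continuous_phase : Continuous fun x : SkewForm n × EuclideanSpace ℝ (Fin n) ×
    EuclideanSpace ℝ (Fin n) => x.1.phase x.2.1 x.2.2 :=
  Complex.continuous_exp.comp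
    (continuous_const.mul (Complex.continuous_ofReal.comp continuous_pairing))

theorem continuous_phase_comp {X : Type*} [TopologicalSpace X] {s : X → SkewForm n}
    {a b : X → EuclideanSpace ℝ (Fin n)} (hs : Continuous s) (ha : Continuous a)
    (hb : Continuous b) : Continuous fun x => (s x).phase (a x) (b x) := by
  have h : Continuous fun x => (s x, a x, b x) := hs.prodMk (ha.prodMk hb)
  have h' := continuous_phase.comp h
  exact h'

theorem continuous_phase_prod (σ : SkewForm n) : Continuous fun x : EuclideanSpace ℝ (Fin n) ×
    EuclideanSpace ℝ (Fin n) => σ.phase x.1 x.2 :=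
  continuous_phase_comp (s := fun _ => σ) continuous_const continuous_fst continuous_snd

variable (σ : SkewForm n)

/-- The integrand `f(α') g(α - α') exp (i/2 σ(α, α'))` of the twisted convolution, as a function
of `(α, α')`. -/
def integrand (f g : EuclideanSpace ℝ (Fin n) → ℂ)
    (x : EuclideanSpace ℝ (Fin n) × EuclideanSpace ℝ (Fin n)) : ℂ :=
  f x.2 * g (x.1 - x.2) * σ.phase x.1 x.2

/-- The twisted convolution `(f × g)(α) = ∫ f(α') g(α - α') exp (i/2 σ(α, α')) dα'`. -/
def conv (f g : EuclideanSpace ℝ (Fin n) → ℂ) (α : EuclideanSpace ℝ (Fin n)) : ℂ :=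
  ∫ α', f α' * g (α - α') * σ.phase α α'

theorem integrable_mul_sub {f g : EuclideanSpace ℝ (Fin n) → ℂ} (hf : Integrable f)
    (hg : Integrable g) :
    Integrable (fun x : EuclideanSpace ℝ (Fin n) × EuclideanSpace ℝ (Fin n) =>
      f x.2 * g (x.1 - x.2)) (volume.prod volume) :=
  hf.convolution_integrand (ContinuousLinearMap.mul ℝ ℂ) hg

theorem integrable_integrand {f g : EuclideanSpace ℝ (Fin n) → ℂ} (hf : Integrable f)
    (hg : Integrable g) : Integrable (σ.integrand f g) (volume.prod volume) := by
  refine (integrable_mul_sub hf hg).mul_bdd (c := 1)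
    (σ.continuous_phase_prod).aestronglyMeasurable ?_
  exact Eventually.of_forall fun x => (σ.norm_phase _ _).le

theorem integrable_conv {f g : EuclideanSpace ℝ (Fin n) → ℂ} (hf : Integrable f)
    (hg : Integrable g) : Integrable (σ.conv f g) :=
  (σ.integrable_integrand hf hg).integral_prod_left

theorem ae_integrable {f g : EuclideanSpace ℝ (Fin n) → ℂ} (hf : Integrable f)
    (hg : Integrable g) :
    ∀ᵐ α, Integrable fun α' => f α' * g (α - α') * σ.phase α α' :=
  (σ.integrable_integrand hf hg).prod_right_ae

theorem conv_congr {f f' g g' : EuclideanSpace ℝ (Fin n) → ℂ} (hf : f =ᵐ[volume] f')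
    (hg : g =ᵐ[volume] g') : σ.conv f g = σ.conv f' g' := by
  funext α
  refine integral_congr_ae ?_
  have h : ∀ᵐ α', g (α - α') = g' (α - α') :=
    (quasiMeasurePreserving_sub_left volume α).ae hg
  filter_upwards [hf, h] with α' h1 h2
  rw [h1, h2]

theorem integral_norm_mul_sub {f g : EuclideanSpace ℝ (Fin n) → ℂ} (hf : Integrable f)
    (hg : Integrable g) :
    ∫ x, ‖f x.2 * g (x.1 - x.2)‖ ∂((volume : Measure (EuclideanSpace ℝ (Fin n))).prod volume)
      = (∫ α, ‖f α‖) * ∫ α, ‖g α‖ := by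
  rw [integral_prod_symm _ (integrable_mul_sub hf hg).norm]
  simp only [norm_mul]
  rw [← integral_mul_const]
  refine integral_congr_ae (Eventually.of_forall fun β => ?_)
  simp only
  rw [integral_const_mul, integral_sub_right_eq_self (fun α => ‖g α‖) β]

theorem integral_norm_conv_le {f g : EuclideanSpace ℝ (Fin n) → ℂ} (hf : Integrable f)
    (hg : Integrable g) : ∫ α, ‖σ.conv f g α‖ ≤ (∫ α, ‖f α‖) * ∫ α, ‖g α‖ := by
  rw [← integral_norm_mul_sub hf hg, integral_prod _ (integrable_mul_sub hf hg).norm]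
  refine integral_mono (σ.integrable_conv hf hg).norm
    (integrable_mul_sub hf hg).norm.integral_prod_left fun α => ?_
  refine (norm_integral_le_integral_norm _).trans (le_of_eq ?_)
  simp only [norm_mul, σ.norm_phase, mul_one]

/-- The twisted convolution product of `L¹(ℝⁿ)`. -/
def mulL1 (f g : L1C n) : L1C n :=
  (σ.integrable_conv (L1.integrable_coeFn f) (L1.integrable_coeFn g)).toL1 _

theorem coeFn_mulL1 (f g : L1C n) : σ.mulL1 f g =ᵐ[volume] σ.conv f g :=
  Integrable.coeFn_toL1 _

theorem norm_mulL1_le (f g : L1C n) : ‖σ.mulL1 f g‖ ≤ ‖f‖ * ‖g‖ := by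
  simp only [L1.norm_eq_integral_norm]
  rw [show ∫ a, ‖σ.mulL1 f g a‖ = ∫ a, ‖σ.conv f g a‖ from
    integral_congr_ae ((σ.coeFn_mulL1 f g).fun_comp norm)]
  exact σ.integral_norm_conv_le (L1.integrable_coeFn f) (L1.integrable_coeFn g)

theorem mulL1_add (f g h : L1C n) : σ.mulL1 f (g + h) = σ.mulL1 f g + σ.mulL1 f h := by
  apply Lp.ext
  filter_upwards [σ.coeFn_mulL1 f (g + h), σ.coeFn_mulL1 f g, σ.coeFn_mulL1 f h,
    Lp.coeFn_add (σ.mulL1 f g) (σ.mulL1 f h),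
    σ.ae_integrable (L1.integrable_coeFn f) (L1.integrable_coeFn g),
    σ.ae_integrable (L1.integrable_coeFn f) (L1.integrable_coeFn h)] with α h1 h2 h3 h4 h5 h6
  rw [h1, h4, Pi.add_apply, h2, h3, σ.conv_congr (EventuallyEq.refl _ f) (Lp.coeFn_add g h)]
  unfold conv
  rw [← integral_add h5 h6]
  refine integral_congr_ae (Eventually.of_forall fun β => ?_)
  simp only [Pi.add_apply]
  ring

theorem add_mulL1 (f g h : L1C n) : σ.mulL1 (f + g) h = σ.mulL1 f h + σ.mulL1 g h := by
  apply Lp.ext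
  filter_upwards [σ.coeFn_mulL1 (f + g) h, σ.coeFn_mulL1 f h, σ.coeFn_mulL1 g h,
    Lp.coeFn_add (σ.mulL1 f h) (σ.mulL1 g h),
    σ.ae_integrable (L1.integrable_coeFn f) (L1.integrable_coeFn h),
    σ.ae_integrable (L1.integrable_coeFn g) (L1.integrable_coeFn h)] with α h1 h2 h3 h4 h5 h6
  rw [h1, h4, Pi.add_apply, h2, h3, σ.conv_congr (Lp.coeFn_add f g) (EventuallyEq.refl _ h)]
  unfold conv
  rw [← integral_add h5 h6]
  refine integral_congr_ae (Eventually.of_forall fun β => ?_)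
  simp only [Pi.add_apply]
  ring

theorem smul_mulL1 (c : ℂ) (f g : L1C n) : σ.mulL1 (c • f) g = c • σ.mulL1 f g := by
  apply Lp.ext
  filter_upwards [σ.coeFn_mulL1 (c • f) g, σ.coeFn_mulL1 f g,
    Lp.coeFn_smul c (σ.mulL1 f g)] with α h1 h2 h3
  rw [h1, h3, Pi.smul_apply, h2, σ.conv_congr (Lp.coeFn_smul c f) (EventuallyEq.refl _ g)]
  unfold conv
  rw [← integral_smul]
  refine integral_congr_ae (Eventually.of_forall fun β => ?_)
  simp only [Pi.smul_apply, smul_eq_mul]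
  ring

theorem mulL1_smul (c : ℂ) (f g : L1C n) : σ.mulL1 f (c • g) = c • σ.mulL1 f g := by
  apply Lp.ext
  filter_upwards [σ.coeFn_mulL1 f (c • g), σ.coeFn_mulL1 f g,
    Lp.coeFn_smul c (σ.mulL1 f g)] with α h1 h2 h3
  rw [h1, h3, Pi.smul_apply, h2, σ.conv_congr (EventuallyEq.refl _ f) (Lp.coeFn_smul c g)]
  unfold conv
  rw [← integral_smul]
  refine integral_congr_ae (Eventually.of_forall fun β => ?_)
  simp only [Pi.smul_apply, smul_eq_mul]
  ring

theorem mulL1_assoc (f g h : L1C n) : σ.mulL1 (σ.mulL1 f g) h = σ.mulL1 f (σ.mulL1 g h) := by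
  have hf := L1.integrable_coeFn f
  have hg := L1.integrable_coeFn g
  have hh := L1.integrable_coeFn h
  have hn : Integrable fun β => ∫ γ, ‖f γ * g (β - γ)‖ :=
    (integrable_mul_sub hf hg).norm.integral_prod_left
  have hn' : Integrable fun α => (‖h α‖ : ℂ) := hh.norm.ofReal
  have hex : ∀ᵐ α, Integrable fun β => ((∫ γ, ‖f γ * g (β - γ)‖ : ℝ) : ℂ) * (‖h (α - β)‖ : ℂ) :=
    (integrable_mul_sub hn.ofReal hn').prod_right_ae
  apply Lp.ext
  filter_upwards [σ.coeFn_mulL1 (σ.mulL1 f g) h, σ.coeFn_mulL1 f (σ.mulL1 g h), hex]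
    with α h1 h2 h3
  rw [h1, h2, σ.conv_congr (σ.coeFn_mulL1 f g) (EventuallyEq.refl _ h),
    σ.conv_congr (EventuallyEq.refl _ f) (σ.coeFn_mulL1 g h)]
  have hmeas : StronglyMeasurable fun x : EuclideanSpace ℝ (Fin n) × EuclideanSpace ℝ (Fin n) =>
      f x.2 * g (x.1 - x.2) * h (α - x.1) * (σ.phase x.1 x.2 * σ.phase α x.1) := by
    have m1 := Lp.stronglyMeasurable f
    have m2 := Lp.stronglyMeasurable g
    have m3 := Lp.stronglyMeasurable h
    have m4 : Continuous fun x : EuclideanSpace ℝ (Fin n) × EuclideanSpace ℝ (Fin n) =>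
        σ.phase x.1 x.2 * σ.phase α x.1 :=
      σ.continuous_phase_prod.mul (continuous_phase_comp (s := fun _ => σ) (a := fun _ => α)
        continuous_const continuous_const continuous_fst)
    have s1 : Measurable fun x : EuclideanSpace ℝ (Fin n) × EuclideanSpace ℝ (Fin n) =>
        x.1 - x.2 := measurable_fst.sub measurable_snd
    have s2 : Measurable fun x : EuclideanSpace ℝ (Fin n) × EuclideanSpace ℝ (Fin n) =>
        α - x.1 := measurable_const.sub measurable_fst
    have s0 : Measurable fun x : EuclideanSpace ℝ (Fin n) × EuclideanSpace ℝ (Fin n) =>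
        x.2 := measurable_snd
    have n1 := m1.comp_measurable s0
    have n2 := m2.comp_measurable s1
    have n3 := m3.comp_measurable s2
    exact ((n1.mul n2).mul n3).mul m4.stronglyMeasurable
  have hint : Integrable (fun x : EuclideanSpace ℝ (Fin n) × EuclideanSpace ℝ (Fin n) =>
      f x.2 * g (x.1 - x.2) * h (α - x.1) * (σ.phase x.1 x.2 * σ.phase α x.1))
      (volume.prod volume) := by
    rw [integrable_prod_iff hmeas.aestronglyMeasurable]
    constructor
    · filter_upwards [(integrable_mul_sub hf hg).prod_right_ae] with β hβ
      have hb : Continuous fun γ => σ.phase β γ * σ.phase α β :=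
        (continuous_phase_comp (s := fun _ => σ) (a := fun _ => β) (b := fun γ => γ)
          continuous_const continuous_const continuous_id).mul continuous_const
      refine (hβ.mul_const (h (α - β))).mul_bdd (c := 1) hb.aestronglyMeasurable ?_
      exact Eventually.of_forall fun γ => by simp [σ.norm_phase]
    · refine (h3.norm).congr (Eventually.of_forall fun β => ?_)
      simp only [norm_mul, σ.norm_phase, mul_one, Complex.norm_real, norm_norm]
      rw [integral_mul_const, Real.norm_of_nonneg]
      exact integral_nonneg fun γ => by positivity
  calc σ.conv (σ.conv f g) h α
      = ∫ β, ∫ γ, f γ * g (β - γ) * h (α - β) * (σ.phase β γ * σ.phase α β) := by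
        unfold conv
        refine integral_congr_ae (Eventually.of_forall fun β => ?_)
        simp only
        rw [← integral_mul_const, ← integral_mul_const]
        refine integral_congr_ae (Eventually.of_forall fun γ => ?_)
        simp only
        ring
    _ = ∫ γ, ∫ β, f γ * g (β - γ) * h (α - β) * (σ.phase β γ * σ.phase α β) :=
        integral_integral_swap hint
    _ = σ.conv f (σ.conv g h) α := by
        unfold conv
        refine integral_congr_ae (Eventually.of_forall fun γ => ?_)
        simp only
        rw [← integral_sub_right_eq_self (fun δ => g δ * h (α - γ - δ) * σ.phase (α - γ) δ) γ,
          ← integral_const_mul, ← integral_mul_const]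
        refine integral_congr_ae (Eventually.of_forall fun β => ?_)
        simp only [← σ.phase_mul_phase_assoc]
        rw [show α - γ - (β - γ) = α - β by abel]
        ring

end SkewForm

/-- The involution `f⋆(α) = conj f(-α)` of `L¹(ℝⁿ)`. -/
def starL1 {n : ℕ} (f : L1C n) : L1C n :=
  ((Complex.conjCLE.toContinuousLinearMap.integrable_comp
    (L1.integrable_coeFn f).comp_neg) :
      Integrable fun α : EuclideanSpace ℝ (Fin n) => (starRingEnd ℂ) (f (-α))).toL1 _

theorem coeFn_starL1 {n : ℕ} (f : L1C n) :
    starL1 f =ᵐ[volume] fun α => (starRingEnd ℂ) (f (-α)) :=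
  Integrable.coeFn_toL1 _

theorem ae_neg {n : ℕ} {P : EuclideanSpace ℝ (Fin n) → Prop} (h : ∀ᵐ α, P α) :
    ∀ᵐ α : EuclideanSpace ℝ (Fin n), P (-α) :=
  (Measure.measurePreserving_neg volume).quasiMeasurePreserving.ae h

theorem starL1_starL1 {n : ℕ} (f : L1C n) : starL1 (starL1 f) = f := by
  apply Lp.ext
  filter_upwards [coeFn_starL1 (starL1 f), ae_neg (coeFn_starL1 f)] with α h1 h2
  rw [h1, h2]
  simp

theorem starL1_add {n : ℕ} (f g : L1C n) : starL1 (f + g) = starL1 f + starL1 g := by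
  apply Lp.ext
  filter_upwards [coeFn_starL1 (f + g), coeFn_starL1 f, coeFn_starL1 g,
    Lp.coeFn_add (starL1 f) (starL1 g), ae_neg (Lp.coeFn_add f g)] with α h1 h2 h3 h4 h5
  rw [h1, h4, Pi.add_apply, h2, h3, h5, Pi.add_apply, map_add]

theorem starL1_smul {n : ℕ} (c : ℂ) (f : L1C n) : starL1 (c • f) = star c • starL1 f := by
  apply Lp.ext
  filter_upwards [coeFn_starL1 (c • f), coeFn_starL1 f,
    Lp.coeFn_smul (star c) (starL1 f), ae_neg (Lp.coeFn_smul c f)] with α h1 h2 h4 h5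
  rw [h1, h4, Pi.smul_apply, h2, h5, Pi.smul_apply, smul_eq_mul, smul_eq_mul, map_mul]
  rfl

theorem norm_starL1 {n : ℕ} (f : L1C n) : ‖starL1 f‖ = ‖f‖ := by
  simp only [L1.norm_eq_integral_norm]
  rw [show ∫ a, ‖starL1 f a‖ = ∫ a, ‖(starRingEnd ℂ) (f (-a))‖ from
    integral_congr_ae ((coeFn_starL1 f).fun_comp norm)]
  simp only [RCLike.norm_conj]
  exact integral_neg_eq_self (fun α => ‖f α‖) volume

theorem starL1_mulL1 {n : ℕ} (σ : SkewForm n) (f g : L1C n) :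
    starL1 (σ.mulL1 f g) = σ.mulL1 (starL1 g) (starL1 f) := by
  apply Lp.ext
  filter_upwards [coeFn_starL1 (σ.mulL1 f g), ae_neg (σ.coeFn_mulL1 f g),
    σ.coeFn_mulL1 (starL1 g) (starL1 f)] with α h1 h2 h3
  rw [h1, h2, h3, σ.conv_congr (coeFn_starL1 g) (coeFn_starL1 f)]
  unfold SkewForm.conv
  rw [← integral_conj, ← integral_sub_right_eq_self _ α]
  refine integral_congr_ae (Eventually.of_forall fun β => ?_)
  have hp : (starRingEnd ℂ) (σ.phase (-α) (β - α)) = σ.phase α β := by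
    simp only [SkewForm.phase, ← Complex.exp_conj, map_mul, map_div₀, Complex.conj_I,
      Complex.conj_ofReal, sub_eq_add_neg, SkewForm.pairing_add_right, SkewForm.pairing_neg_left,
      SkewForm.pairing_self, map_ofNat]
    congr 1
    push_cast
    ring
  simp only [map_mul, hp]
  rw [show -α - (β - α) = -β by abel, show -(α - β) = β - α by abel]
  ring

theorem continuous_starL1 {n : ℕ} : Continuous (starL1 (n := n)) := by
  rw [continuous_iff_continuousAt]
  intro g
  have h : ∀ f : L1C n, starL1 f = starL1 (f - g) + starL1 g := fun f => by
    rw [← starL1_add, sub_add_cancel]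
  have h1 : Tendsto (fun f : L1C n => starL1 (f - g)) (𝓝 g) (𝓝 0) := by
    refine squeeze_zero_norm (fun f => (norm_starL1 _).le) ?_
    exact tendsto_iff_norm_sub_tendsto_zero.1 tendsto_id
  have h2 := h1.add_const (starL1 g)
  rw [zero_add] at h2
  exact h2.congr fun f => (h f).symm

namespace SkewForm

variable {n : ℕ}

theorem zero_mulL1 (σ : SkewForm n) (g : L1C n) : σ.mulL1 0 g = 0 := by
  have h := σ.add_mulL1 0 0 g
  rw [add_zero] at h
  exact left_eq_add.mp h

theorem mulL1_zero (σ : SkewForm n) (f : L1C n) : σ.mulL1 f 0 = 0 := by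
  have h := σ.mulL1_add f 0 0
  rw [add_zero] at h
  exact left_eq_add.mp h

theorem norm_mulL1_sub_le (σ τ : SkewForm n) (f g : L1C n) :
    ‖σ.mulL1 f g - τ.mulL1 f g‖ ≤
      ∫ x : EuclideanSpace ℝ (Fin n) × EuclideanSpace ℝ (Fin n),
        ‖f x.2 * g (x.1 - x.2) * (σ.phase x.1 x.2 - τ.phase x.1 x.2)‖
          ∂(volume.prod volume) := by
  have hf := L1.integrable_coeFn f
  have hg := L1.integrable_coeFn g
  have hint : Integrable (fun x : EuclideanSpace ℝ (Fin n) × EuclideanSpace ℝ (Fin n) =>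
      f x.2 * g (x.1 - x.2) * (σ.phase x.1 x.2 - τ.phase x.1 x.2)) (volume.prod volume) := by
    refine ((σ.integrable_integrand hf hg).sub (τ.integrable_integrand hf hg)).congr
      (Eventually.of_forall fun x => ?_)
    simp only [integrand, Pi.sub_apply]
    ring
  have hae : (fun α => ‖(σ.mulL1 f g - τ.mulL1 f g : L1C n) α‖) =ᵐ[volume]
      fun α => ‖∫ β, f β * g (α - β) * (σ.phase α β - τ.phase α β)‖ := by
    filter_upwards [Lp.coeFn_sub (σ.mulL1 f g) (τ.mulL1 f g), σ.coeFn_mulL1 f g,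
      τ.coeFn_mulL1 f g, σ.ae_integrable hf hg, τ.ae_integrable hf hg] with α h1 h2 h3 h4 h5
    rw [h1, Pi.sub_apply, h2, h3]
    unfold conv
    rw [← integral_sub h4 h5]
    simp only [mul_sub]
  rw [L1.norm_eq_integral_norm, integral_congr_ae hae, integral_prod _ hint.norm]
  exact integral_mono hint.integral_prod_left.norm hint.norm.integral_prod_left fun α =>
    norm_integral_le_integral_norm _

theorem continuous_mulL1_left (f g : L1C n) : Continuous fun σ : SkewForm n => σ.mulL1 f g := by
  rw [continuous_iff_continuousAt]
  intro τ
  have hf := L1.integrable_coeFn f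
  have hg := L1.integrable_coeFn g
  have hfg := integrable_mul_sub hf hg
  have hN : Continuous fun σ : SkewForm n =>
      ∫ x : EuclideanSpace ℝ (Fin n) × EuclideanSpace ℝ (Fin n),
        ‖f x.2 * g (x.1 - x.2) * (σ.phase x.1 x.2 - τ.phase x.1 x.2)‖
          ∂(volume.prod volume) := by
    have hfc : FirstCountableTopology (SkewForm n) := by
      have : FirstCountableTopology (Matrix (Fin n) (Fin n) ℝ) :=
        inferInstanceAs (FirstCountableTopology (Fin n → Fin n → ℝ))
      exact Topology.IsEmbedding.subtypeVal.firstCountableTopology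
    refine continuous_of_dominated (bound := fun x => ‖f x.2 * g (x.1 - x.2)‖ * 2)
      (fun σ => ?_) (fun σ => Eventually.of_forall fun x => ?_) (hfg.norm.mul_const 2)
      (Eventually.of_forall fun x => ?_)
    · exact (hfg.aestronglyMeasurable.mul
        (σ.continuous_phase_prod.sub τ.continuous_phase_prod).aestronglyMeasurable).norm
    · rw [norm_norm, norm_mul]
      refine mul_le_mul_of_nonneg_left ((norm_sub_le _ _).trans ?_) (norm_nonneg _)
      rw [norm_phase, norm_phase]
      norm_num
    · have h1 : Continuous fun σ : SkewForm n => σ.phase x.1 x.2 :=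
        continuous_phase_comp (s := fun σ => σ) (a := fun _ => x.1) (b := fun _ => x.2)
          continuous_id continuous_const continuous_const
      exact (continuous_const.mul (h1.sub continuous_const)).norm
  have h0 := hN.tendsto τ
  simp only [sub_self, mul_zero, norm_zero, integral_zero] at h0
  exact tendsto_iff_norm_sub_tendsto_zero.2
    (squeeze_zero (fun σ => norm_nonneg _) (fun σ => σ.norm_mulL1_sub_le τ f g) h0)

theorem continuous_mulL1 {Y : Type*} [TopologicalSpace Y] {s : Y → SkewForm n} {f g : Y → L1C n}
    (hs : Continuous s) (hf : Continuous f) (hg : Continuous g) :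
    Continuous fun y => (s y).mulL1 (f y) (g y) := by
  rw [continuous_iff_continuousAt]
  intro y₀
  have key : ∀ y, (s y).mulL1 (f y) (g y) = (s y).mulL1 (f y - f y₀) (g y) +
      (s y).mulL1 (f y₀) (g y - g y₀) + (s y).mulL1 (f y₀) (g y₀) := by
    intro y
    rw [add_assoc, ← mulL1_add, sub_add_cancel, ← add_mulL1, sub_add_cancel]
  have h1 : Tendsto (fun y => (s y).mulL1 (f y - f y₀) (g y)) (𝓝 y₀) (𝓝 0) := by
    refine squeeze_zero_norm (fun y => (s y).norm_mulL1_le _ _) ?_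
    have : Continuous fun y => ‖f y - f y₀‖ * ‖g y‖ := by fun_prop
    simpa using this.tendsto y₀
  have h2 : Tendsto (fun y => (s y).mulL1 (f y₀) (g y - g y₀)) (𝓝 y₀) (𝓝 0) := by
    refine squeeze_zero_norm (fun y => (s y).norm_mulL1_le _ _) ?_
    have : Continuous fun y => ‖f y₀‖ * ‖g y - g y₀‖ := by fun_prop
    simpa using this.tendsto y₀
  have h3 := ((continuous_mulL1_left (f y₀) (g y₀)).comp hs).tendsto y₀
  have h4 := (h1.add h2).add h3
  simp only [zero_add] at h4
  exact h4.congr fun y => (key y).symm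

end SkewForm

/-- The Banach *-algebra `C₀(Y, L¹(ℝⁿ))` twisted by a continuous family `σ` of skew forms on `ℝⁿ`:
`(f × g)(y, α) = ∫ f(y, α') g(y, α - α') exp (i/2 σ_y(α, α')) dα'`,
`f⋆(y, α) = conj f(y, -α)`, `‖f‖ = sup_y ‖f(y, ·)‖₁`. -/
def TwistedAlgebra {Y : Type*} [TopologicalSpace Y] {n : ℕ} (_σ : C(Y, SkewForm n)) : Type _ :=
  C₀(Y, L1C n)

namespace TwistedAlgebra

variable {Y : Type*} [TopologicalSpace Y] {n : ℕ} {σ : C(Y, SkewForm n)}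

instance : NormedAddCommGroup (TwistedAlgebra σ) := inferInstanceAs (NormedAddCommGroup C₀(Y, L1C n))
instance : NormedSpace ℂ (TwistedAlgebra σ) := inferInstanceAs (NormedSpace ℂ C₀(Y, L1C n))
instance : CompleteSpace (TwistedAlgebra σ) := inferInstanceAs (CompleteSpace C₀(Y, L1C n))
instance : FunLike (TwistedAlgebra σ) Y (L1C n) := inferInstanceAs (FunLike C₀(Y, L1C n) Y (L1C n))

@[ext]
theorem ext {f g : TwistedAlgebra σ} (h : ∀ y, f y = g y) : f = g := DFunLike.ext f g h

theorem add_apply (f g : TwistedAlgebra σ) (y : Y) : (f + g) y = f y + g y := rfl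
theorem zero_apply (y : Y) : (0 : TwistedAlgebra σ) y = 0 := rfl
theorem smul_apply (c : ℂ) (f : TwistedAlgebra σ) (y : Y) : (c • f) y = c • f y := rfl

theorem continuous (f : TwistedAlgebra σ) : Continuous f :=
  ContinuousMapClass.map_continuous (F := C₀(Y, L1C n)) f

theorem tendsto (f : TwistedAlgebra σ) : Tendsto f (cocompact Y) (𝓝 0) :=
  ZeroAtInftyContinuousMapClass.zero_at_infty (F := C₀(Y, L1C n)) f

theorem norm_apply_le (f : TwistedAlgebra σ) (y : Y) : ‖f y‖ ≤ ‖f‖ :=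
  BoundedContinuousFunction.norm_coe_le_norm (ZeroAtInftyContinuousMap.toBCF (f : C₀(Y, L1C n))) y

theorem norm_le {f : TwistedAlgebra σ} {C : ℝ} (hC : 0 ≤ C) (h : ∀ y, ‖f y‖ ≤ C) : ‖f‖ ≤ C :=
  (BoundedContinuousFunction.norm_le (f := ZeroAtInftyContinuousMap.toBCF (f : C₀(Y, L1C n))) hC).2 h

instance : Mul (TwistedAlgebra σ) where
  mul f g := show C₀(Y, L1C n) from
    { toFun := fun y => (σ y).mulL1 (f y) (g y)
      continuous_toFun := SkewForm.continuous_mulL1 σ.continuous f.continuous g.continuous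
      zero_at_infty' := by
        refine squeeze_zero_norm (fun y => (σ y).norm_mulL1_le _ _) ?_
        simpa using f.tendsto.norm.mul g.tendsto.norm }

instance : Star (TwistedAlgebra σ) where
  star f := show C₀(Y, L1C n) from
    { toFun := fun y => starL1 (f y)
      continuous_toFun := continuous_starL1.comp f.continuous
      zero_at_infty' := by
        refine squeeze_zero_norm (fun y => (norm_starL1 _).le) ?_
        simpa using f.tendsto.norm }

theorem mul_apply (f g : TwistedAlgebra σ) (y : Y) : (f * g) y = (σ y).mulL1 (f y) (g y) := rfl
theorem star_apply (f : TwistedAlgebra σ) (y : Y) : (star f) y = starL1 (f y) := rfl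

instance : NonUnitalNormedRing (TwistedAlgebra σ) :=
  { (inferInstance : NormedAddCommGroup (TwistedAlgebra σ)),
    (inferInstance : Mul (TwistedAlgebra σ)) with
    zero_mul := fun f => ext fun y => (σ y).zero_mulL1 (f y)
    mul_zero := fun f => ext fun y => (σ y).mulL1_zero (f y)
    mul_assoc := fun f g h => ext fun y => (σ y).mulL1_assoc (f y) (g y) (h y)
    left_distrib := fun f g h => ext fun y => (σ y).mulL1_add (f y) (g y) (h y)
    right_distrib := fun f g h => ext fun y => (σ y).add_mulL1 (f y) (g y) (h y)
    norm_mul_le := fun f g => norm_le (by positivity) fun y =>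
      ((σ y).norm_mulL1_le _ _).trans
        (mul_le_mul (f.norm_apply_le y) (g.norm_apply_le y) (norm_nonneg _) (norm_nonneg _)) }

instance : StarRing (TwistedAlgebra σ) where
  star_involutive f := ext fun y => starL1_starL1 (f y)
  star_mul f g := ext fun y => starL1_mulL1 (σ y) (f y) (g y)
  star_add f g := ext fun y => starL1_add (f y) (g y)

instance : NormedStarGroup (TwistedAlgebra σ) where
  norm_star_le f := norm_le (norm_nonneg _) fun y => (norm_starL1 (f y)).le.trans (f.norm_apply_le y)

instance : StarModule ℂ (TwistedAlgebra σ) where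
  star_smul c f := ext fun y => starL1_smul c (f y)

instance : IsScalarTower ℂ (TwistedAlgebra σ) (TwistedAlgebra σ) where
  smul_assoc c f g := ext fun y => (σ y).smul_mulL1 c (f y) (g y)

instance : SMulCommClass ℂ (TwistedAlgebra σ) (TwistedAlgebra σ) where
  smul_comm c f g := ext fun y => ((σ y).mulL1_smul c (f y) (g y)).symm

end TwistedAlgebra

/-! ## Compact operators -/

section Compact

variable (H : Type*) [NormedAddCommGroup H] [InnerProductSpace ℂ H] [CompleteSpace H]

variable {H} in
theorem isCompactOperator_of_sq_le {A S : H →L[ℂ] H} (hS : IsCompactOperator S)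
    (hAS : ∀ x, ‖A x‖ ^ 2 ≤ ‖S x‖ * ‖x‖) : IsCompactOperator A := by
  have hSt : TotallyBounded (S '' Metric.closedBall 0 1) :=
    (hS.isCompact_closure_image_closedBall 1).totallyBounded.subset subset_closure
  have key : TotallyBounded (A '' Metric.closedBall 0 1) := by
    rw [Metric.totallyBounded_iff]
    intro ε hε
    obtain ⟨t, hts, htf, ht⟩ := totallyBounded_iff_subset.1 hSt _
      (Metric.dist_mem_uniformity (show 0 < ε ^ 2 / 2 by positivity))
    have hts' : ∀ y ∈ t, ∃ x ∈ Metric.closedBall (0 : H) 1, S x = y := fun y hy => hts hy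
    choose! c hc hc' using hts'
    refine ⟨(fun y => A (c y)) '' t, htf.image _, ?_⟩
    rintro _ ⟨x, hx, rfl⟩
    obtain ⟨y, hy, hxy⟩ := Set.mem_iUnion₂.1 (ht (Set.mem_image_of_mem _ hx))
    refine Set.mem_iUnion₂.2 ⟨A (c y), Set.mem_image_of_mem _ hy, ?_⟩
    have h1 : ‖S (x - c y)‖ < ε ^ 2 / 2 := by
      rw [map_sub, hc' y hy, ← dist_eq_norm]
      exact hxy
    have h2 : ‖x - c y‖ ≤ 2 := by
      have a := mem_closedBall_zero_iff.1 hx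
      have b := mem_closedBall_zero_iff.1 (hc y hy)
      linarith [norm_sub_le x (c y)]
    have h3 := hAS (x - c y)
    have h4 : ‖A (x - c y)‖ ^ 2 < ε ^ 2 := by
      have h5 := norm_nonneg (S (x - c y))
      nlinarith
    rw [Metric.mem_ball, dist_eq_norm, ← map_sub]
    exact lt_of_pow_lt_pow_left₀ 2 hε.le h4
  exact (isCompactOperator_iff_isCompact_closure_image_closedBall
    (A : H →ₗ[ℂ] H) zero_lt_one).2 (key.closure.isCompact_of_isClosed isClosed_closure)

variable {H} in
/-- The adjoint of a compact operator is compact. -/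
theorem isCompactOperator_star {T : H →L[ℂ] H} (hT : IsCompactOperator T) :
    IsCompactOperator (star T : H →L[ℂ] H) := by
  refine isCompactOperator_of_sq_le (S := T * star T) (hT.comp_clm (star T)) fun x => ?_
  calc ‖(star T) x‖ ^ 2 = RCLike.re (inner ℂ ((star T) x) ((star T) x)) :=
        (inner_self_eq_norm_sq (𝕜 := ℂ) _).symm
    _ = RCLike.re (inner ℂ x (T ((star T) x))) := by
        rw [ContinuousLinearMap.star_eq_adjoint, ContinuousLinearMap.adjoint_inner_left]
    _ ≤ ‖x‖ * ‖T ((star T) x)‖ := (RCLike.re_le_norm _).trans (norm_inner_le_norm _ _)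
    _ = ‖(T * star T) x‖ * ‖x‖ := mul_comm _ _

/-- The C*-algebra of compact operators on a complex Hilbert space. -/
def compactOperators : NonUnitalStarSubalgebra ℂ (H →L[ℂ] H) where
  carrier := {T | IsCompactOperator T}
  add_mem' ha hb := ha.add hb
  zero_mem' := isCompactOperator_zero
  mul_mem' {_ b} ha _ := IsCompactOperator.comp_clm ha b
  smul_mem' c _ hT := hT.smul c
  star_mem' hT := isCompactOperator_star hT

theorem isClosed_compactOperators : IsClosed (compactOperators H : Set (H →L[ℂ] H)) :=
  isClosed_setOfPred_isCompactOperator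

instance : NonUnitalCStarAlgebra (compactOperators H) :=
  NonUnitalStarSubalgebra.nonUnitalCStarAlgebra _ (h_closed := isClosed_compactOperators H)

instance {X : Type*} [TopologicalSpace X] : NonUnitalCStarAlgebra C₀(X, compactOperators H) where

end Compact

/-! ## The scale-covariant model -/

/-- The antisymmetric tensor on `ℝ⁴` with electric part `e` and magnetic part `m`. -/
def emTensor (e m : Fin 3 → ℝ) : Matrix (Fin 4) (Fin 4) ℝ :=
  !![     0,    e 0,    e 1,    e 2;
      -(e 0),     0,    m 2, -(m 1);
      -(e 1), -(m 2),     0,    m 0;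
      -(e 2),   m 1, -(m 0),      0]

/-- The joint spectrum `Σ₀` of the scale-covariant model: the nonzero antisymmetric tensors on
`ℝ⁴` whose electric and magnetic parts are orthogonal and have equal norms. -/
abbrev JointSpectrum : Type :=
  {σ : SkewForm 4 // σ.1 ≠ 0 ∧ ∃ e m : Fin 3 → ℝ,
    σ.1 = emTensor e m ∧ m ⬝ᵥ m - e ⬝ᵥ e = 0 ∧ e ⬝ᵥ m = 0}

/-- The standard symplectic form `J` on the plane. -/
def formJ : SkewForm 2 := ⟨!![0, -1; 1, 0], by ext i j; fin_cases i <;> fin_cases j <;> simp⟩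

/-- The standard degenerate form `J ⊕ 0₂` on `ℝ⁴`. -/
def formStd : SkewForm 4 :=
  ⟨!![0, -1, 0, 0; 1, 0, 0, 0; 0, 0, 0, 0; 0, 0, 0, 0], by
    ext i j; fin_cases i <;> fin_cases j <;> simp⟩

/-- `ℝ²` with its Euclidean structure. -/
abbrev Plane : Type := EuclideanSpace ℝ (Fin 2)

/-- The algebra of the scale-covariant model: `C₀(Σ₀, L¹(ℝ⁴))`, the fibre over `σ` being twisted by
`σ` itself. -/
abbrev E0 : Type := TwistedAlgebra (⟨Subtype.val, continuous_subtype_val⟩ : C(JointSpectrum, SkewForm 4))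

/-- `C₀(Σ₀, L¹(ℝ⁴))`, twisted by the constant form `J ⊕ 0₂`. -/
abbrev EStd : Type := TwistedAlgebra (ContinuousMap.const JointSpectrum formStd)

/-- `C₀(Σ₀ × ℝ², L¹(ℝ²))`, twisted by the constant form `J`. -/
abbrev EStd2 : Type := TwistedAlgebra (ContinuousMap.const (JointSpectrum × Plane) formJ)

/-- The vector `α_q ⊕ α_c` of `ℝ⁴ = ℝ² ⊕ ℝ²`. -/
def directSum (αq αc : Plane) : EuclideanSpace ℝ (Fin 4) := !₂[αq 0, αq 1, αc 0, αc 1]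

end

noncomputable section

section

open scoped FourierTransform SchwartzMap RealInnerProductSpace ContDiff

/-! ## The Fourier transform on `L¹(ℝⁿ)` -/

/-! The twisted algebra of the plane has a minimal projection, the Gaussian g = `gaussJ`: it
satisfies g × g = g = g⋆ and g × a × g = φ(a) g, where φ = `gaussFunctional` integrates a against
exp(-‖β‖²/4). Moreover φ(x⋆ × y) is 2π times the L² inner product of x × g and y × g, so φ is
positive. Its GNS representation sends x × g × y⋆ to the rank-one operator |v(x)⟩⟨v(y)|. Since the
elements x × g × x⋆ already span a dense subspace of L¹(ℝ²), the representation is by compact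
operators and has dense range among them; it is also faithful. Any infinite-dimensional separable H
can serve as the GNS space. Applied fibrewise, this gives a *-homomorphism `compactRep` with dense
range into C₀(X, 𝒦).

What remains is to bound every C*-seminorm by the norm of that representation. On C₀(Y, L¹(ℝ⁴)),
twisted by J ⊕ 0, the corner cut out by g in the first two variables is the commutative algebra
C₀(Y, L¹(ℝ²)) with plain convolution. There a C*-seminorm is attained at a character, a character
splits as a character of C₀(Y) followed by one of L¹(ℝ²), and both are controlled by the Fourier
transform (`norm_character_family_le`). The resulting bound sup |û(y)(x)| is exactly the norm of g ⊗
u in C₀(Y × ℝ², 𝒦), because g acts as a projection of norm one.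

From the corner the estimate spreads to the whole algebra by `CStarSeminorm.le_of_leftIdeal`. If S
is a left ideal with S S⋆ total, the norm of left multiplication on the closure of S is a
C*-seminorm with trivial kernel on a C*-completion, hence it is the norm; so an estimate on the
elements s⋆ s of the corner determines everything. For the left ideal generated by g, these elements
do lie in the corner.

The partial Fourier transform intertwines the convolutions, is injective because the full Fourier
transform factors through it, and has dense range; so the estimate passes by continuity to C₀(Y ×
ℝ², L¹(ℝ²)). Both enveloping algebras are thereby identified with C₀(Y × ℝ², 𝒦), compatibly with the
partial Fourier transform. Finally, every σ in Σ₀ is the pull-back of J ⊕ 0 under a matrix of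
determinant one that depends continuously on σ on all of Σ₀ (`JointSpectrum.frame`), and composition
with these matrices identifies `EStd` with `E0`. -/

theorem L1C.continuous_of_dominated {Y : Type*} [TopologicalSpace Y] [FirstCountableTopology Y]
    {n : ℕ} {u : Y → L1C n} {F : Y → EuclideanSpace ℝ (Fin n) → ℂ}
    (hu : ∀ y, u y =ᵐ[volume] F y) {B : EuclideanSpace ℝ (Fin n) → ℝ} (hB : Integrable B)
    (hF : ∀ y α, ‖F y α‖ ≤ B α) (hc : ∀ α, Continuous fun y => F y α) : Continuous u := by
  rw [continuous_iff_continuousAt]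
  intro y₀
  refine tendsto_iff_norm_sub_tendsto_zero.2 ?_
  have h1 : ∀ y, ‖u y - u y₀‖ = ∫ α, ‖F y α - F y₀ α‖ := fun y => by
    rw [L1.norm_eq_integral_norm]
    refine integral_congr_ae ?_
    filter_upwards [Lp.coeFn_sub (u y) (u y₀), hu y, hu y₀] with α a1 a2 a3
    rw [a1, Pi.sub_apply, a2, a3]
  simp only [h1]
  have h2 : Continuous fun y => ∫ α, ‖F y α - F y₀ α‖ := by
    have hm : ∀ y, AEStronglyMeasurable (F y) volume := fun y =>
      (Lp.aestronglyMeasurable (u y)).congr (hu y)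
    refine MeasureTheory.continuous_of_dominated (bound := fun α => B α + B α)
      (fun y => ((hm y).sub (hm y₀)).norm) (fun y => Eventually.of_forall fun α => ?_)
      (hB.add hB) (Eventually.of_forall fun α => ((hc α).sub continuous_const).norm)
    rw [norm_norm]
    exact (norm_sub_le _ _).trans (add_le_add (hF y α) (hF y₀ α))
  simpa using h2.tendsto y₀

/-- The Fourier transform `∫ f(α) exp (i⟨x, α⟩) dα`. -/
def fourierHat {n : ℕ} (f : EuclideanSpace ℝ (Fin n) → ℂ) (x : EuclideanSpace ℝ (Fin n)) : ℂ :=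
  ∫ α, f α * Complex.exp (Complex.I * (⟪x, α⟫ : ℂ))

section Hat

variable {n : ℕ}

theorem norm_exp_I_inner (x α : EuclideanSpace ℝ (Fin n)) :
    ‖Complex.exp (Complex.I * (⟪x, α⟫ : ℂ))‖ = 1 := by
  rw [mul_comm]
  exact Complex.norm_exp_ofReal_mul_I _

theorem continuous_exp_I_inner {Y : Type*} [TopologicalSpace Y] {a b : Y → EuclideanSpace ℝ (Fin n)}
    (ha : Continuous a) (hb : Continuous b) :
    Continuous fun y => Complex.exp (Complex.I * (⟪a y, b y⟫ : ℂ)) :=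
  Complex.continuous_exp.comp
    (continuous_const.mul (Complex.continuous_ofReal.comp (ha.inner hb)))

theorem MeasureTheory.Integrable.mul_exp_I_inner {f : EuclideanSpace ℝ (Fin n) → ℂ}
    (hf : Integrable f) (x : EuclideanSpace ℝ (Fin n)) :
    Integrable fun α => f α * Complex.exp (Complex.I * (⟪x, α⟫ : ℂ)) :=
  hf.mul_bdd (c := 1) (continuous_exp_I_inner continuous_const continuous_id).aestronglyMeasurable
    (Eventually.of_forall fun α => (norm_exp_I_inner x α).le)

theorem fourierHat_congr {f g : EuclideanSpace ℝ (Fin n) → ℂ} (h : f =ᵐ[volume] g) :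
    fourierHat f = fourierHat g := by
  funext x
  refine integral_congr_ae ?_
  filter_upwards [h] with α hα
  rw [hα]

theorem fourierHat_eq_fourier (f : EuclideanSpace ℝ (Fin n) → ℂ) (x : EuclideanSpace ℝ (Fin n)) :
    fourierHat f x = 𝓕 f (-((2 * Real.pi)⁻¹ • x)) := by
  rw [Real.fourier_eq', fourierHat]
  refine integral_congr_ae (Eventually.of_forall fun α => ?_)
  simp only [smul_eq_mul, inner_neg_right, inner_smul_right]
  rw [mul_comm, real_inner_comm]
  congr 2
  have := Real.pi_ne_zero
  push_cast
  field_simp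

theorem fourier_eq_fourierHat (f : EuclideanSpace ℝ (Fin n) → ℂ) (x : EuclideanSpace ℝ (Fin n)) :
    𝓕 f x = fourierHat f (-((2 * Real.pi) • x)) := by
  rw [fourierHat_eq_fourier, smul_neg, neg_neg, smul_smul,
    inv_mul_cancel₀ (by positivity), one_smul]

/-- A smooth compactly supported test function is a Schwartz function, hence the Fourier transform
of one. Moving the transform from the test function to f by ∫ f ĥ = ∫ f̂ h makes every such test
integral vanish. -/
theorem ae_eq_zero_of_fourierHat_eq_zero {f : EuclideanSpace ℝ (Fin n) → ℂ} (hf : Integrable f)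
    (h : ∀ x, fourierHat f x = 0) : f =ᵐ[volume] 0 := by
  refine ae_eq_zero_of_integral_contDiff_smul_eq_zero hf.locallyIntegrable fun g hg hgs => ?_
  have hs : HasCompactSupport (fun x => (g x : ℂ)) := hgs.comp_left (g := fun t : ℝ => (t : ℂ)) rfl
  have hd : ContDiff ℝ ∞ (fun x => (g x : ℂ)) := Complex.ofRealCLM.contDiff.comp hg
  let G : 𝓢(EuclideanSpace ℝ (Fin n), ℂ) := hs.toSchwartzMap hd
  have hG : ∀ x, (G x : ℂ) = (g x : ℂ) := fun x => rfl
  have h1 : 𝓕 (𝓕⁻ G) = G := FourierTransform.fourier_fourierInv_eq G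
  have h2 := VectorFourier.integral_fourierIntegral_smul_eq_flip (μ := volume) (ν := volume)
    (L := innerₗ (EuclideanSpace ℝ (Fin n))) (f := f) (g := (𝓕⁻ G : 𝓢(_, ℂ)))
    Real.continuous_fourierChar continuous_inner hf (SchwartzMap.integrable _)
  have h3 : ∀ ξ, VectorFourier.fourierIntegral 𝐞 volume (innerₗ (EuclideanSpace ℝ (Fin n))) f ξ
      = 0 := fun ξ => by
    have := fourier_eq_fourierHat f ξ
    rw [h] at this
    exact this
  simp only [h3, zero_smul, integral_zero, flip_innerₗ] at h2
  rw [h2]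
  refine integral_congr_ae (Eventually.of_forall fun x => ?_)
  have h4 : VectorFourier.fourierIntegral 𝐞 volume (innerₗ (EuclideanSpace ℝ (Fin n)))
      (𝓕⁻ G : 𝓢(_, ℂ)) x = (g x : ℂ) := by
    rw [← hG]
    exact congrArg (fun u : 𝓢(EuclideanSpace ℝ (Fin n), ℂ) => u x) h1
  simp only [h4, Complex.real_smul, smul_eq_mul]
  ring

theorem L1C.eq_zero_of_fourierHat {f : L1C n} (h : ∀ x, fourierHat f x = 0) : f = 0 :=
  (Lp.eq_zero_iff_ae_eq_zero).2 (ae_eq_zero_of_fourierHat_eq_zero (L1.integrable_coeFn f) h)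

theorem fourierHat_add {f g : EuclideanSpace ℝ (Fin n) → ℂ} (hf : Integrable f) (hg : Integrable g)
    (x : EuclideanSpace ℝ (Fin n)) :
    fourierHat (f + g) x = fourierHat f x + fourierHat g x := by
  unfold fourierHat
  rw [← integral_add (hf.mul_exp_I_inner x) (hg.mul_exp_I_inner x)]
  simp only [Pi.add_apply, add_mul]

theorem fourierHat_smul (c : ℂ) (f : EuclideanSpace ℝ (Fin n) → ℂ)
    (x : EuclideanSpace ℝ (Fin n)) : fourierHat (c • f) x = c * fourierHat f x := by
  unfold fourierHat
  rw [← integral_const_mul]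
  simp only [Pi.smul_apply, smul_eq_mul, mul_assoc]

theorem norm_fourierHat_le (f : EuclideanSpace ℝ (Fin n) → ℂ) (x : EuclideanSpace ℝ (Fin n)) :
    ‖fourierHat f x‖ ≤ ∫ α, ‖f α‖ := by
  refine (norm_integral_le_integral_norm _).trans (le_of_eq ?_)
  simp only [norm_mul, norm_exp_I_inner, mul_one]

/-- The Fourier transform at `x` as a continuous functional on `L¹`. -/
def hatCLM (x : EuclideanSpace ℝ (Fin n)) : L1C n →L[ℂ] ℂ :=
  LinearMap.mkContinuous
    { toFun := fun f => fourierHat f x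
      map_add' := fun f g => by
        rw [fourierHat_congr (Lp.coeFn_add f g),
          fourierHat_add (L1.integrable_coeFn f) (L1.integrable_coeFn g)]
      map_smul' := fun c f => by
        rw [fourierHat_congr (Lp.coeFn_smul c f), fourierHat_smul]; rfl } 1 fun f => by
    rw [one_mul, L1.norm_eq_integral_norm]
    exact norm_fourierHat_le f x

theorem hatCLM_apply (x : EuclideanSpace ℝ (Fin n)) (f : L1C n) : hatCLM x f = fourierHat f x := rfl

theorem norm_hatCLM_apply_le (x : EuclideanSpace ℝ (Fin n)) (f : L1C n) : ‖hatCLM x f‖ ≤ ‖f‖ := by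
  rw [L1.norm_eq_integral_norm]
  exact norm_fourierHat_le f x

theorem L1C.ext_hat {f g : L1C n} (h : ∀ x, hatCLM x f = hatCLM x g) : f = g := by
  refine sub_eq_zero.1 (L1C.eq_zero_of_fourierHat fun x => ?_)
  rw [← hatCLM_apply, map_sub, h, sub_self]

theorem continuous_hatCLM (f : L1C n) : Continuous fun x => hatCLM x f := by
  refine MeasureTheory.continuous_of_dominated (bound := fun α => ‖f α‖)
    (fun x => ((L1.integrable_coeFn f).mul_exp_I_inner x).aestronglyMeasurable)
    (fun x => Eventually.of_forall fun α => ?_) (L1.integrable_coeFn f).norm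
    (Eventually.of_forall fun α =>
      continuous_const.mul (continuous_exp_I_inner continuous_id continuous_const))
  rw [norm_mul, norm_exp_I_inner, mul_one]

/-- Riemann–Lebesgue; the change of sign and of 2π normalisation is a homeomorphism, so it preserves
the filter at infinity. -/
theorem tendsto_hatCLM (f : L1C n) : Tendsto (fun x => hatCLM x f) (cocompact _) (𝓝 0) := by
  have h := tendsto_integral_exp_inner_smul_cocompact (V := EuclideanSpace ℝ (Fin n)) (f := f)
  have hm : Tendsto (fun x : EuclideanSpace ℝ (Fin n) => -((2 * Real.pi)⁻¹ • x))
      (cocompact _) (cocompact _) := by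
    exact ((Homeomorph.smulOfNeZero ((2 * Real.pi)⁻¹) (by positivity)).trans
      (Homeomorph.neg (EuclideanSpace ℝ (Fin n)))).isClosedEmbedding.tendsto_cocompact
  refine (h.comp hm).congr fun x => ?_
  rw [hatCLM_apply, fourierHat_eq_fourier]
  rfl

end Hat

end

section

open scoped FourierTransform SchwartzMap RealInnerProductSpace ContDiff

/-! ### Totality of modulated Gaussians in L¹(ℝⁿ) -/

section Modulated

variable {n : ℕ}

theorem integrable_exp_neg_mul_norm_sq {b : ℝ} (hb : 0 < b) :
    Integrable fun α : EuclideanSpace ℝ (Fin n) => Real.exp (-b * ‖α‖ ^ 2) := by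
  have h := (GaussianFourier.integrable_cexp_neg_mul_sq_norm_add
    (V := EuclideanSpace ℝ (Fin n)) (b := b) (by simpa using hb) 0 0).re
  refine h.congr (Eventually.of_forall fun α => ?_)
  simp only [inner_zero_left, Complex.ofReal_zero, mul_zero, add_zero]
  rw [show (-(b : ℂ) * (‖α‖ : ℂ) ^ 2) = ((-b * ‖α‖ ^ 2 : ℝ) : ℂ) by push_cast; ring]
  exact Complex.exp_ofReal_re _

/-- The modulated Gaussian `exp (i⟨x, α⟩) exp (-b ‖α‖²)`. -/
def modGaussian (n : ℕ) (b : ℝ) (x α : EuclideanSpace ℝ (Fin n)) : ℂ :=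
  Complex.exp (Complex.I * (⟪x, α⟫ : ℂ)) * (Real.exp (-b * ‖α‖ ^ 2) : ℂ)

theorem norm_modGaussian (b : ℝ) (x α : EuclideanSpace ℝ (Fin n)) :
    ‖modGaussian n b x α‖ = Real.exp (-b * ‖α‖ ^ 2) := by
  rw [modGaussian, norm_mul, norm_exp_I_inner, one_mul, Complex.norm_real,
    Real.norm_of_nonneg (Real.exp_pos _).le]

theorem integrable_modGaussian {b : ℝ} (hb : 0 < b) (x : EuclideanSpace ℝ (Fin n)) :
    Integrable (modGaussian n b x) := by
  refine ((integrable_exp_neg_mul_norm_sq hb).ofReal (𝕜 := ℂ)).mul_exp_I_inner x |>.congr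
    (Eventually.of_forall fun α => ?_)
  rw [modGaussian, mul_comm]
  rfl

/-- The modulated Gaussian as an element of `L¹`. -/
def modGaussianL1 {b : ℝ} (hb : 0 < b) (x : EuclideanSpace ℝ (Fin n)) : L1C n :=
  (integrable_modGaussian hb x).toL1 _

theorem coeFn_modGaussianL1 {b : ℝ} (hb : 0 < b) (x : EuclideanSpace ℝ (Fin n)) :
    modGaussianL1 hb x =ᵐ[volume] modGaussian n b x := Integrable.coeFn_toL1 _

theorem continuous_modGaussianL1 {b : ℝ} (hb : 0 < b) :
    Continuous (modGaussianL1 (n := n) hb) :=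
  L1C.continuous_of_dominated (coeFn_modGaussianL1 hb) (integrable_exp_neg_mul_norm_sq hb)
    (fun _ _ => (norm_modGaussian _ _ _).le) fun _ =>
      (continuous_exp_I_inner continuous_id continuous_const).mul continuous_const

theorem norm_modGaussianL1 {b : ℝ} (hb : 0 < b) (x : EuclideanSpace ℝ (Fin n)) :
    ‖modGaussianL1 hb x‖ = ∫ α : EuclideanSpace ℝ (Fin n), Real.exp (-b * ‖α‖ ^ 2) := by
  rw [L1.norm_eq_integral_norm]
  refine integral_congr_ae ?_
  filter_upwards [coeFn_modGaussianL1 hb x] with α hα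
  rw [hα, norm_modGaussian]

/-- The closed subspace is itself a Banach space, so the Bochner integral can be formed inside it
and carried over by the inclusion. -/
theorem integral_mem_of_isClosed {V : Type*} [NormedAddCommGroup V] [NormedSpace ℂ V]
    [CompleteSpace V] {W : Submodule ℂ V} (hW : IsClosed (W : Set V))
    {Ω : Type*} [MeasurableSpace Ω] {μ : Measure Ω} {u : Ω → V} (hu : ∀ t, u t ∈ W)
    (hi : Integrable u μ) : ∫ t, u t ∂μ ∈ W := by
  have : CompleteSpace W := hW.completeSpace_coe
  have hi' : Integrable (fun t => (⟨u t, hu t⟩ : W)) μ := by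
    refine ⟨?_, hi.2⟩
    exact (Topology.IsEmbedding.subtypeVal.aestronglyMeasurable_comp_iff).1 hi.1
  have h := W.subtypeL.integral_comp_comm hi'
  have h' : ∫ t, u t ∂μ = W.subtypeL (∫ t, (⟨u t, hu t⟩ : W) ∂μ) := h
  rw [h']
  exact Subtype.prop _

/-- The integral over a set as a continuous functional on `L¹`. -/
def L1C.setIntegralCLM (s : Set (EuclideanSpace ℝ (Fin n))) : L1C n →L[ℂ] ℂ :=
  (L1.integralCLM' ℂ).comp (LpToLpRestrictCLM _ ℂ ℂ volume 1 s)

theorem L1C.setIntegralCLM_apply (s : Set (EuclideanSpace ℝ (Fin n))) (v : L1C n) :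
    L1C.setIntegralCLM s v = ∫ α in s, v α := by
  have h0 : L1C.setIntegralCLM s v = L1.integral (LpToLpRestrictCLM _ ℂ ℂ volume 1 s v) :=
    (L1.integral_eq' ℂ _).symm
  rw [h0, L1.integral_eq_integral]
  exact integral_congr_ae (LpToLpRestrictCLM_coeFn ℂ s v)

/-- The integral of a curve in `L¹` can be computed pointwise. -/
theorem L1C.coeFn_integral {u : EuclideanSpace ℝ (Fin n) → L1C n}
    {F : EuclideanSpace ℝ (Fin n) → EuclideanSpace ℝ (Fin n) → ℂ}
    (hu : ∀ y, u y =ᵐ[volume] F y) (hi : Integrable u)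
    (hF : Integrable (Function.uncurry F) (volume.prod volume)) :
    (∫ y, u y : L1C n) =ᵐ[volume] fun α => ∫ y, F y α := by
  -- Two integrable functions agree a.e. once their integrals over sets agree. Integration over a
  -- set is a continuous functional, so it passes through the Bochner integral, and Fubini does the
  -- rest.
  refine Integrable.ae_eq_of_forall_setIntegral_eq _ _ (L1.integrable_coeFn _)
    hF.integral_prod_right fun s hs _ => ?_
  rw [← L1C.setIntegralCLM_apply, ← (L1C.setIntegralCLM s).integral_comp_comm hi]
  have h2 : ∀ y, L1C.setIntegralCLM s (u y) = ∫ α in s, F y α := by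
    intro y
    rw [L1C.setIntegralCLM_apply]
    exact setIntegral_congr_ae hs ((hu y).mono fun α hα _ => hα)
  simp only [h2]
  rw [integral_integral_swap]
  exact hF.mono_measure (Measure.prod_mono le_rfl Measure.restrict_le_self)

/-- A Gaussian times the inverse Fourier transform of k is the superposition of the modulated
Gaussians at frequencies 2πy with weights k(y). As an L¹-valued Bochner integral it stays in W. -/
theorem modGaussian_integral_mem {W : Submodule ℂ (L1C n)} (hW : IsClosed (W : Set (L1C n)))
    {b : ℝ} (hb : 0 < b) (h : ∀ x, modGaussianL1 hb x ∈ W) (k : 𝓢(EuclideanSpace ℝ (Fin n), ℂ))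
    {f : L1C n} (hf : f =ᵐ[volume] fun α => (Real.exp (-b * ‖α‖ ^ 2) : ℂ) *
      ∫ y, Complex.exp (Complex.I * (⟪(2 * Real.pi) • y, α⟫ : ℂ)) * k y) : f ∈ W := by
  have hi : Integrable fun y => k y • modGaussianL1 (n := n) hb ((2 * Real.pi) • y) := by
    refine (k.integrable (μ := volume)).smul_bdd
      (∫ α : EuclideanSpace ℝ (Fin n), Real.exp (-b * ‖α‖ ^ 2))
      ((continuous_modGaussianL1 hb).comp (continuous_const_smul _)).aestronglyMeasurable
      (Eventually.of_forall fun y => (norm_modGaussianL1 hb _).le)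
  have hmem : ∫ y, k y • modGaussianL1 (n := n) hb ((2 * Real.pi) • y) ∈ W :=
    integral_mem_of_isClosed hW (fun y => W.smul_mem _ (h _)) hi
  suffices hs : ∫ y, k y • modGaussianL1 (n := n) hb ((2 * Real.pi) • y) = f by
    rw [← hs]
    exact hmem
  refine Lp.ext (EventuallyEq.trans ?_ hf.symm)
  have h3 : Integrable (fun p : EuclideanSpace ℝ (Fin n) × EuclideanSpace ℝ (Fin n) =>
      k p.1 * (Real.exp (-b * ‖p.2‖ ^ 2) : ℂ)) (volume.prod volume) :=
    (k.integrable (μ := volume)).mul_prod ((integrable_exp_neg_mul_norm_sq hb).ofReal (𝕜 := ℂ))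
  have h5 : AEStronglyMeasurable (fun p : EuclideanSpace ℝ (Fin n) × EuclideanSpace ℝ (Fin n) =>
      Complex.exp (Complex.I * (⟪(2 * Real.pi) • p.1, p.2⟫ : ℂ))) (volume.prod volume) :=
    (continuous_exp_I_inner (continuous_fst.const_smul (2 * Real.pi))
      continuous_snd).aestronglyMeasurable
  have h4 : Integrable (Function.uncurry fun y α => k y * modGaussian n b ((2 * Real.pi) • y) α)
      (volume.prod volume) := by
    refine (h3.mul_bdd (c := 1) h5 (Eventually.of_forall fun p =>
      (norm_exp_I_inner _ _).le)).congr (Eventually.of_forall fun p => ?_)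
    simp only [Function.uncurry, modGaussian]
    ring
  have h6 : ∀ y, (k y • modGaussianL1 (n := n) hb ((2 * Real.pi) • y) : L1C n) =ᵐ[volume]
      fun α => k y * modGaussian n b ((2 * Real.pi) • y) α := fun y => by
    filter_upwards [Lp.coeFn_smul (k y) (modGaussianL1 (n := n) hb ((2 * Real.pi) • y)),
      coeFn_modGaussianL1 hb ((2 * Real.pi) • y)] with α h1 h2
    rw [h1, Pi.smul_apply, h2, smul_eq_mul]
  refine (L1C.coeFn_integral h6 hi h4).trans (Eventually.of_forall fun α => ?_)
  simp only
  rw [← integral_const_mul]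
  refine integral_congr_ae (Eventually.of_forall fun y => ?_)
  simp only [modGaussian]
  ring

/-- A closed subspace of `L¹(ℝⁿ)` that contains all modulations of a Gaussian is everything. -/
theorem eq_top_of_modGaussian_mem {W : Submodule ℂ (L1C n)} (hW : IsClosed (W : Set (L1C n)))
    {b : ℝ} (hb : 0 < b)
    (h : ∀ x, modGaussianL1 hb x ∈ W) : W = ⊤ := by
  rw [eq_top_iff]
  rintro f -
  refine hW.closure_subset_iff.2 le_rfl ?_
  refine (mem_closure_iff_nhds_basis Metric.nhds_basis_closedBall).2 fun ε hε => ?_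
  obtain ⟨φ, hφ₁, hφ₂, hφ₃⟩ := MemLp.exist_eLpNorm_sub_le ENNReal.one_ne_top le_rfl (Lp.memLp f) hε
  have hφi : Integrable φ := hφ₂.continuous.integrable_of_hasCompactSupport hφ₁
  refine ⟨hφi.toL1 φ, ?_, ?_⟩
  swap
  · rw [Metric.mem_closedBall', Lp.dist_def]
    refine ENNReal.toReal_le_of_le_ofReal hε.le ((le_of_eq (eLpNorm_congr_ae ?_)).trans hφ₃)
    filter_upwards [hφi.coeFn_toL1] with α hα
    rw [Pi.sub_apply, Pi.sub_apply, hα]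
  -- Dividing φ by the Gaussian is harmless because φ has compact support: the quotient Ψ is again a
  -- test function, and Fourier inversion writes it as a superposition of characters.
  let G : EuclideanSpace ℝ (Fin n) → ℂ := fun α => (Real.exp (b * ‖α‖ ^ 2) : ℂ)
  have hG : ContDiff ℝ ∞ G := Complex.ofRealCLM.contDiff.comp
    (Real.contDiff_exp.comp (contDiff_const.mul (contDiff_norm_sq ℝ)))
  let Ψ : 𝓢(EuclideanSpace ℝ (Fin n), ℂ) :=
    HasCompactSupport.toSchwartzMap (f := fun α => G α * φ α) hφ₁.mul_left (hG.mul hφ₂)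
  let k : 𝓢(EuclideanSpace ℝ (Fin n), ℂ) := 𝓕 Ψ
  have hΨ : ∀ α, φ α = (Real.exp (-b * ‖α‖ ^ 2) : ℂ) * Ψ α := fun α => by
    change φ α = (Real.exp (-b * ‖α‖ ^ 2) : ℂ) * ((Real.exp (b * ‖α‖ ^ 2) : ℂ) * φ α)
    rw [← mul_assoc, ← Complex.ofReal_mul, ← Real.exp_add]
    simp
  have hk : ∀ α, Ψ α = ∫ y, Complex.exp (Complex.I * (⟪(2 * Real.pi) • y, α⟫ : ℂ)) * k y := by
    intro α
    have h1 : 𝓕⁻ k = Ψ := FourierTransform.fourierInv_fourier_eq Ψ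
    rw [← h1, SchwartzMap.fourierInv_coe, Real.fourierInv_eq']
    refine integral_congr_ae (Eventually.of_forall fun y => ?_)
    simp only [smul_eq_mul, inner_smul_left]
    congr 2
    simp only [RCLike.conj_to_real]
    push_cast
    ring
  refine modGaussian_integral_mem hW hb h k ?_
  filter_upwards [hφi.coeFn_toL1] with α hα
  rw [hα, hΨ, hk]

end Modulated

end

section

open scoped FourierTransform SchwartzMap RealInnerProductSpace ContDiff

/-! ## The Gaussian projection of the twisted algebra of the plane -/

theorem norm_sq_plane (α : Plane) : ‖α‖ ^ 2 = α 0 ^ 2 + α 1 ^ 2 := by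
  rw [EuclideanSpace.norm_sq_eq, Fin.sum_univ_two, Real.norm_eq_abs, Real.norm_eq_abs, sq_abs,
    sq_abs]

theorem inner_plane (α β : Plane) : ⟪α, β⟫ = α 0 * β 0 + α 1 * β 1 := by
  rw [PiLp.inner_apply, Fin.sum_univ_two]
  simp only [RCLike.inner_apply, conj_trivial]
  ring

theorem formJ_pairing (α β : Plane) : formJ.pairing α β = α 1 * β 0 - α 0 * β 1 := by
  simp only [SkewForm.pairing, formJ, Fin.sum_univ_two, Matrix.of_apply, Matrix.cons_val',
    Matrix.cons_val_zero, Matrix.cons_val_one, Matrix.cons_val_fin_one]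
  ring

theorem formJ_phase (α β : Plane) :
    formJ.phase α β = Complex.exp (Complex.I / 2 * ((α 1 * β 0 - α 0 * β 1 : ℝ) : ℂ)) := by
  rw [SkewForm.phase, formJ_pairing]

/-- The quarter turn of the plane, `J(α, β) = ⟨β^⊥, α⟩`. -/
def quarterTurn (y : Plane) : Plane := !₂[-(y 1), y 0]

/-- The weight `exp (-‖α‖²/4)`. -/
def gaussWeight (α : Plane) : ℝ := Real.exp (-(1 / 4) * ‖α‖ ^ 2)

/-- The Gaussian `(2π)⁻¹ exp (-‖α‖²/4)`, a projection for the convolution twisted by `J`. -/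
def gaussJ (α : Plane) : ℂ := ((2 * Real.pi)⁻¹ * gaussWeight α : ℝ)

theorem continuous_gaussWeight : Continuous gaussWeight := by unfold gaussWeight; fun_prop

theorem continuous_gaussJ : Continuous gaussJ :=
  Complex.continuous_ofReal.comp (continuous_const.mul continuous_gaussWeight)

theorem gaussWeight_pos (α : Plane) : 0 < gaussWeight α := Real.exp_pos _

theorem gaussWeight_le_one (α : Plane) : gaussWeight α ≤ 1 := by
  rw [gaussWeight, Real.exp_le_one_iff]
  nlinarith [sq_nonneg ‖α‖]

theorem gaussWeight_neg (α : Plane) : gaussWeight (-α) = gaussWeight α := by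
  rw [gaussWeight, norm_neg, gaussWeight]

theorem gaussJ_neg (α : Plane) : gaussJ (-α) = gaussJ α := by
  rw [gaussJ, gaussWeight_neg, gaussJ]

theorem integrable_gaussWeight : Integrable gaussWeight :=
  integrable_exp_neg_mul_norm_sq (by norm_num)

theorem integrable_gaussJ : Integrable gaussJ :=
  (integrable_gaussWeight.const_mul _).ofReal

theorem norm_gaussJ_le (α : Plane) : ‖gaussJ α‖ ≤ 1 := by
  have h1 := gaussWeight_le_one α
  have h2 := gaussWeight_pos α
  have h3 : (2 * Real.pi)⁻¹ ≤ 1 := inv_le_one_of_one_le₀ (by linarith [Real.pi_gt_three])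
  have h4 : 0 < (2 * Real.pi)⁻¹ := by positivity
  rw [gaussJ, Complex.norm_real, Real.norm_of_nonneg (by positivity)]
  nlinarith

/-- This and the next lemma reduce Gaussian identities to polynomial identities between exponents,
which `ring` can settle. -/
theorem mul_exp_mul_exp_eq {a A B C D E F : ℂ} (h : A + B + C + D = E + F) :
    a * Complex.exp A * (a * Complex.exp B) * Complex.exp C * Complex.exp D =
      a ^ 2 * Complex.exp E * Complex.exp F := by
  rw [mul_assoc (a ^ 2), ← Complex.exp_add, ← h, Complex.exp_add, Complex.exp_add, Complex.exp_add]
  ring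

theorem mul_exp_mul_mul_exp_eq {a b c A B C D : ℂ} (h : a * b = c) (h' : A + B = C + D) :
    a * Complex.exp A * (b * Complex.exp B) = c * Complex.exp C * Complex.exp D := by
  rw [mul_assoc c, ← Complex.exp_add, ← h', Complex.exp_add, ← h]
  ring

theorem integral_gaussJ_mul_gaussJ (α β : Plane) :
    ∫ α', gaussJ α' * gaussJ (α - α' - β) * formJ.phase (α - α') β * formJ.phase α α' =
      gaussJ α * gaussWeight β := by
  -- Completing the square: centred at (α - β)/2, the two Gaussians give exp(-‖α - β‖²/8)
  -- exp(-‖s‖²/2), and the phases become a character of s with frequency proportional to the rotated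
  -- α + β. Its Gaussian integral contributes exp(-‖α + β‖²/8), and the parallelogram law separates
  -- α from β.
  rw [← integral_add_right_eq_self _ ((1 / 2 : ℝ) • (α - β))]
  have key : ∀ s : Plane, gaussJ (s + (1 / 2 : ℝ) • (α - β)) *
      gaussJ (α - (s + (1 / 2 : ℝ) • (α - β)) - β) *
      formJ.phase (α - (s + (1 / 2 : ℝ) • (α - β))) β * formJ.phase α (s + (1 / 2 : ℝ) • (α - β)) =
      (((2 * Real.pi)⁻¹ ^ 2 * Real.exp (-(1 / 8) * ‖α - β‖ ^ 2) : ℝ) : ℂ) *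
      Complex.exp (-(1 / 2 : ℂ) * ‖s‖ ^ 2 + (-(Complex.I / 2)) * (⟪quarterTurn (α + β), s⟫ : ℂ)) := by
    intro s
    simp only [gaussJ, gaussWeight, formJ_phase, norm_sq_plane, inner_plane, quarterTurn,
      Complex.ofReal_mul, Complex.ofReal_exp]
    have h : ((‖s‖ : ℂ)) ^ 2 = ((s 0 ^ 2 + s 1 ^ 2 : ℝ) : ℂ) := by
      rw [← norm_sq_plane]; push_cast; rfl
    rw [h]
    simp only [PiLp.add_apply, PiLp.sub_apply, PiLp.smul_apply, smul_eq_mul,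
      Matrix.cons_val_zero, Matrix.cons_val_one, Complex.ofReal_pow]
    refine mul_exp_mul_exp_eq ?_
    push_cast
    ring
  simp only [key]
  rw [integral_const_mul, GaussianFourier.integral_cexp_neg_mul_sq_norm_add (by norm_num)]
  have hf : (Module.finrank ℝ Plane : ℂ) / 2 = 1 := by simp
  have hw : ((‖quarterTurn (α + β)‖ : ℂ)) ^ 2 = ((‖α + β‖ ^ 2 : ℝ) : ℂ) := by
    rw [← Complex.ofReal_pow, norm_sq_plane, norm_sq_plane]
    simp only [quarterTurn, Matrix.cons_val_zero, Matrix.cons_val_one, PiLp.add_apply]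
    congr 1
    ring
  rw [hf, Complex.cpow_one, hw]
  simp only [gaussJ, gaussWeight, norm_sq_plane, PiLp.add_apply, PiLp.sub_apply,
    Complex.ofReal_mul, Complex.ofReal_exp]
  have hπ : (Real.pi : ℂ) ≠ 0 := by exact_mod_cast Real.pi_ne_zero
  refine mul_exp_mul_mul_exp_eq ?_ ?_
  · push_cast
    field_simp
  · push_cast
    ring_nf
    rw [Complex.I_sq]
    ring

/-- The case β = 0 of the preceding integral, where one phase disappears. -/
theorem conv_gaussJ_gaussJ : formJ.conv gaussJ gaussJ = gaussJ := by
  funext α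
  have h := integral_gaussJ_mul_gaussJ α 0
  simp only [sub_zero] at h
  rw [show gaussWeight 0 = 1 by simp [gaussWeight], Complex.ofReal_one, mul_one] at h
  rw [← h, SkewForm.conv]
  refine integral_congr_ae (Eventually.of_forall fun α' => ?_)
  have h0 : formJ.phase (α - α') 0 = 1 := by simp [formJ_phase]
  simp only [h0, mul_one]

/-- The functional `a ↦ ∫ a(β) exp (-‖β‖²/4) dβ` on `L¹(ℝ²)`. -/
def gaussFunctional : L1C 2 →L[ℂ] ℂ :=
  have hi : ∀ f : L1C 2, Integrable fun β => f β * (gaussWeight β : ℂ) := fun f =>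
    (L1.integrable_coeFn f).mul_bdd (c := 1)
      (Complex.continuous_ofReal.comp continuous_gaussWeight).aestronglyMeasurable
      (Eventually.of_forall fun β => by
        rw [Complex.norm_real, Real.norm_of_nonneg (gaussWeight_pos β).le]
        exact gaussWeight_le_one β)
  LinearMap.mkContinuous
    { toFun := fun f => ∫ β, f β * (gaussWeight β : ℂ)
      map_add' := fun f g => by
        rw [← integral_add (hi f) (hi g)]
        refine integral_congr_ae ?_
        filter_upwards [Lp.coeFn_add f g] with β hβ
        rw [hβ, Pi.add_apply, add_mul]
      map_smul' := fun c f => by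
        rw [RingHom.id_apply, ← integral_smul]
        refine integral_congr_ae ?_
        filter_upwards [Lp.coeFn_smul c f] with β hβ
        rw [hβ, Pi.smul_apply, smul_mul_assoc] } 1 fun f => by
    rw [one_mul, L1.norm_eq_integral_norm]
    refine (norm_integral_le_integral_norm _).trans
      (integral_mono (hi f).norm (L1.integrable_coeFn f).norm fun β => ?_)
    simp only [norm_mul, Complex.norm_real]
    rw [Real.norm_of_nonneg (gaussWeight_pos β).le]
    exact mul_le_of_le_one_right (norm_nonneg _) (gaussWeight_le_one β)

theorem gaussFunctional_apply (f : L1C 2) :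
    gaussFunctional f = ∫ β, f β * (gaussWeight β : ℂ) := rfl

/-- Minimality of the projection. After Fubini the inner integral is the formal product g × δ_β × g,
already evaluated as exp(-‖β‖²/4) g; integrating this against a produces the scalar. -/
theorem conv_gaussJ_conv_gaussJ (a : L1C 2) (α : Plane) :
    formJ.conv gaussJ (formJ.conv a gaussJ) α = gaussFunctional a * gaussJ α := by
  have ha := L1.integrable_coeFn a
  have hint : Integrable (Function.uncurry fun α' β : Plane =>
      gaussJ α' * (a β * gaussJ (α - α' - β) * formJ.phase (α - α') β) * formJ.phase α α')
      (volume.prod volume) := by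
    have h1 : Continuous fun p : Plane × Plane => gaussJ (α - p.1 - p.2) *
        (formJ.phase (α - p.1) p.2 * formJ.phase α p.1) :=
      (continuous_gaussJ.comp (by fun_prop)).mul
        ((SkewForm.continuous_phase_comp (s := fun _ => formJ) continuous_const
          (continuous_const.sub continuous_fst) continuous_snd).mul
        (SkewForm.continuous_phase_comp (s := fun _ => formJ) (a := fun _ => α) continuous_const
          continuous_const continuous_fst))
    refine ((integrable_gaussJ.mul_prod ha).mul_bdd (c := 1) h1.aestronglyMeasurable
      (Eventually.of_forall fun p => ?_)).congr (Eventually.of_forall fun p => ?_)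
    · simp only [norm_mul, SkewForm.norm_phase, mul_one]
      exact norm_gaussJ_le _
    · simp only [Function.uncurry]
      ring
  calc formJ.conv gaussJ (formJ.conv a gaussJ) α
      = ∫ α', ∫ β, gaussJ α' * (a β * gaussJ (α - α' - β) * formJ.phase (α - α') β) *
          formJ.phase α α' := by
        refine integral_congr_ae (Eventually.of_forall fun α' => ?_)
        simp only [SkewForm.conv]
        rw [← integral_const_mul, ← integral_mul_const]
    _ = ∫ β, ∫ α', gaussJ α' * (a β * gaussJ (α - α' - β) * formJ.phase (α - α') β) *
          formJ.phase α α' := integral_integral_swap hint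
    _ = gaussFunctional a * gaussJ α := by
        rw [gaussFunctional_apply, ← integral_mul_const]
        refine integral_congr_ae (Eventually.of_forall fun β => ?_)
        simp only
        rw [mul_assoc, mul_comm (gaussWeight β : ℂ), ← integral_gaussJ_mul_gaussJ,
          ← integral_const_mul]
        refine integral_congr_ae (Eventually.of_forall fun α' => ?_)
        simp only
        ring

/-- The translated Gaussian `α ↦ g(α - y) exp (i/2 J(α, y))`. -/
def shiftGauss (y α : Plane) : ℂ := gaussJ (α - y) * formJ.phase α y

theorem integrable_shiftGauss (y : Plane) : Integrable (shiftGauss y) :=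
  (integrable_gaussJ.comp_sub_right y).mul_bdd (c := 1)
    (SkewForm.continuous_phase_comp (s := fun _ => formJ) (b := fun _ => y) continuous_const
      continuous_id continuous_const).aestronglyMeasurable
    (Eventually.of_forall fun _ => (formJ.norm_phase _ _).le)

/-- Formally `shiftGauss y` is δ_y × g, so this is g × g = g after associativity. The proof
substitutes s + y and uses the cocycle identity for the phases. -/
theorem conv_shiftGauss_gaussJ (y : Plane) :
    formJ.conv (shiftGauss y) gaussJ = shiftGauss y := by
  funext α
  rw [shiftGauss, ← congrFun conv_gaussJ_gaussJ (α - y), SkewForm.conv, SkewForm.conv,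
    ← integral_mul_const, ← integral_add_right_eq_self _ y]
  refine integral_congr_ae (Eventually.of_forall fun s => ?_)
  simp only [shiftGauss]
  have h : formJ.phase (s + y) y * formJ.phase α (s + y) =
      formJ.phase (α - y) s * formJ.phase α y := by
    simp only [formJ_phase, ← Complex.exp_add, PiLp.add_apply, PiLp.sub_apply]
    congr 1
    push_cast
    ring
  rw [add_sub_cancel_right, show α - (s + y) = α - y - s by abel]
  linear_combination (gaussJ s * gaussJ (α - y - s)) * h

/-- Formally (δ_y × g) × (δ_y × g)⋆ is the conjugate of g by the Weyl unitary δ_y, which multiplies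
g(α) by exp(iJ(α, y)). This is the origin of the modulated Gaussians, with the frequency turned by a
right angle. -/
theorem conv_shiftGauss_star (y α : Plane) :
    formJ.conv (shiftGauss y) (fun β => (starRingEnd ℂ) (shiftGauss y (-β))) α =
      (2 * Real.pi : ℂ)⁻¹ * modGaussian 2 (1 / 4) (quarterTurn y) α := by
  have h0 : ∀ α, (starRingEnd ℂ) (gaussJ α) = gaussJ α := fun α => Complex.conj_ofReal _
  have h1 : (2 * Real.pi : ℂ)⁻¹ * modGaussian 2 (1 / 4) (quarterTurn y) α =
      gaussJ α * (formJ.phase α y * formJ.phase α y) := by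
    rw [modGaussian, gaussJ, gaussWeight, formJ_phase, ← Complex.exp_add, inner_plane]
    simp only [quarterTurn, Matrix.cons_val_zero, Matrix.cons_val_one]
    push_cast
    rw [mul_comm (Complex.exp _), ← mul_assoc]
    congr 2
    ring
  rw [h1, ← congrFun conv_gaussJ_gaussJ α, SkewForm.conv, SkewForm.conv, ← integral_mul_const,
    ← integral_add_right_eq_self _ y]
  refine integral_congr_ae (Eventually.of_forall fun s => ?_)
  simp only [shiftGauss, map_mul, h0]
  have h : formJ.phase (s + y) y * (starRingEnd ℂ) (formJ.phase (-(α - (s + y))) y) *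
      formJ.phase α (s + y) = formJ.phase α s * (formJ.phase α y * formJ.phase α y) := by
    simp only [formJ_phase, ← Complex.exp_conj, ← Complex.exp_add, PiLp.add_apply,
      PiLp.sub_apply, PiLp.neg_apply, map_mul, map_div₀, Complex.conj_I, Complex.conj_ofReal,
      map_ofNat]
    congr 1
    push_cast
    ring
  rw [add_sub_cancel_right, show -(α - (s + y)) - y = -(α - s) by abel, gaussJ_neg]
  linear_combination (gaussJ s * gaussJ (α - s)) * h

/-- Used to upgrade identities in L¹, valid only a.e., to identities at a given point. -/
theorem SkewForm.continuous_conv {n : ℕ} (σ : SkewForm n) {f h : EuclideanSpace ℝ (Fin n) → ℂ}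
    (hf : Integrable f) (hc : Continuous h) {C : ℝ} (hC : ∀ α, ‖h α‖ ≤ C) :
    Continuous (σ.conv f h) := by
  have hC0 : 0 ≤ C := (norm_nonneg _).trans (hC 0)
  refine MeasureTheory.continuous_of_dominated (bound := fun β => ‖f β‖ * C) (fun α => ?_)
    (fun α => Eventually.of_forall fun β => ?_) (hf.norm.mul_const C)
    (Eventually.of_forall fun β => ?_)
  · exact (hf.aestronglyMeasurable.mul
      (hc.comp (continuous_const.sub continuous_id)).aestronglyMeasurable).mul
      (SkewForm.continuous_phase_comp (s := fun _ => σ) (a := fun _ => α) continuous_const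
        continuous_const continuous_id).aestronglyMeasurable
  · rw [norm_mul, σ.norm_phase, mul_one, norm_mul]
    exact mul_le_mul_of_nonneg_left (hC _) (norm_nonneg _)
  · exact (continuous_const.mul (hc.comp (continuous_id.sub continuous_const))).mul
      (SkewForm.continuous_phase_comp (s := fun _ => σ) (b := fun _ => β) continuous_const
        continuous_id continuous_const)

theorem SkewForm.norm_conv_le {n : ℕ} (σ : SkewForm n) {f h : EuclideanSpace ℝ (Fin n) → ℂ}
    (hf : Integrable f) {C : ℝ} (hC : ∀ α, ‖h α‖ ≤ C) (α : EuclideanSpace ℝ (Fin n)) :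
    ‖σ.conv f h α‖ ≤ (∫ β, ‖f β‖) * C := by
  rw [← integral_mul_const]
  refine norm_integral_le_of_norm_le (hf.norm.mul_const C) (Eventually.of_forall fun β => ?_)
  rw [norm_mul, σ.norm_phase, mul_one, norm_mul]
  exact mul_le_mul_of_nonneg_left (hC _) (norm_nonneg _)

/-- The Gaussian projection as an element of `L¹(ℝ²)`. -/
def gaussL1 : L1C 2 := integrable_gaussJ.toL1 _

theorem coeFn_gaussL1 : gaussL1 =ᵐ[volume] gaussJ := Integrable.coeFn_toL1 _

/-- The translated Gaussian as an element of `L¹(ℝ²)`. -/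
def shiftGaussL1 (y : Plane) : L1C 2 := (integrable_shiftGauss y).toL1 _

theorem coeFn_shiftGaussL1 (y : Plane) : shiftGaussL1 y =ᵐ[volume] shiftGauss y :=
  Integrable.coeFn_toL1 _

theorem star_gaussL1 : starL1 gaussL1 = gaussL1 := by
  refine Lp.ext ?_
  filter_upwards [coeFn_starL1 gaussL1, ae_neg coeFn_gaussL1, coeFn_gaussL1] with α h1 h2 h3
  rw [h1, h2, h3, gaussJ_neg]
  exact Complex.conj_ofReal _

theorem coeFn_mulL1_gaussL1 (a : L1C 2) :
    formJ.mulL1 a gaussL1 =ᵐ[volume] formJ.conv a gaussJ := by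
  rw [← formJ.conv_congr (EventuallyEq.refl _ a) coeFn_gaussL1]
  exact formJ.coeFn_mulL1 _ _

theorem gaussL1_mul_self : formJ.mulL1 gaussL1 gaussL1 = gaussL1 := by
  refine Lp.ext ((coeFn_mulL1_gaussL1 _).trans ?_)
  rw [formJ.conv_congr coeFn_gaussL1 (EventuallyEq.refl _ gaussJ), conv_gaussJ_gaussJ]
  exact coeFn_gaussL1.symm

theorem gaussL1_mul_mul (a : L1C 2) :
    formJ.mulL1 gaussL1 (formJ.mulL1 a gaussL1) = gaussFunctional a • gaussL1 := by
  refine Lp.ext ((formJ.coeFn_mulL1 _ _).trans ?_)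
  rw [formJ.conv_congr coeFn_gaussL1 (coeFn_mulL1_gaussL1 a)]
  filter_upwards [Lp.coeFn_smul (gaussFunctional a) gaussL1, coeFn_gaussL1] with α h1 h2
  rw [h1, Pi.smul_apply, h2, conv_gaussJ_conv_gaussJ, smul_eq_mul]

theorem gaussL1_ne_zero : gaussL1 ≠ 0 := by
  intro h
  have h1 : gaussJ =ᵐ[volume] fun _ => (0 : ℂ) := by
    filter_upwards [coeFn_gaussL1, (Lp.eq_zero_iff_ae_eq_zero).1 h] with α h1 h2
    rw [← h1, h2]; rfl
  have h2 := congrFun ((continuous_gaussJ.ae_eq_iff_eq volume continuous_const).1 h1) 0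
  have h3 : (0 : ℝ) < (2 * Real.pi)⁻¹ * gaussWeight 0 := by
    have := gaussWeight_pos 0
    positivity
  rw [gaussJ] at h2
  exact h3.ne' (by exact_mod_cast h2)

/-- Compare the coefficients of g in g × g × g = φ(g) g; no integral needs to be computed. -/
theorem gaussFunctional_gaussL1 : gaussFunctional gaussL1 = 1 := by
  have h := gaussL1_mul_mul gaussL1
  rw [gaussL1_mul_self, gaussL1_mul_self] at h
  have h' : (gaussFunctional gaussL1 - 1) • gaussL1 = 0 := by
    rw [sub_smul, ← h, one_smul, sub_self]
  exact sub_eq_zero.1 ((smul_eq_zero.1 h').resolve_right gaussL1_ne_zero)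

theorem shiftGaussL1_mul (y : Plane) :
    formJ.mulL1 (shiftGaussL1 y) gaussL1 = shiftGaussL1 y := by
  refine Lp.ext ((coeFn_mulL1_gaussL1 _).trans ?_)
  rw [formJ.conv_congr (coeFn_shiftGaussL1 y) (EventuallyEq.refl _ gaussJ),
    conv_shiftGauss_gaussJ]
  exact (coeFn_shiftGaussL1 y).symm

theorem shiftGaussL1_mul_star (y : Plane) :
    formJ.mulL1 (shiftGaussL1 y) (starL1 (shiftGaussL1 y)) =
      (2 * Real.pi : ℂ)⁻¹ • modGaussianL1 (b := 1 / 4) (by norm_num) (quarterTurn y) := by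
  refine Lp.ext ((formJ.coeFn_mulL1 _ _).trans ?_)
  have h : starL1 (shiftGaussL1 y) =ᵐ[volume] fun β => (starRingEnd ℂ) (shiftGauss y (-β)) := by
    filter_upwards [coeFn_starL1 (shiftGaussL1 y), ae_neg (coeFn_shiftGaussL1 y)] with α h1 h2
    rw [h1, h2]
  rw [formJ.conv_congr (coeFn_shiftGaussL1 y) h]
  filter_upwards [Lp.coeFn_smul (2 * Real.pi : ℂ)⁻¹
    (modGaussianL1 (n := 2) (b := 1 / 4) (by norm_num) (quarterTurn y)),
    coeFn_modGaussianL1 (n := 2) (b := 1 / 4) (by norm_num) (quarterTurn y)] with α h1 h2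
  rw [h1, Pi.smul_apply, h2, conv_shiftGauss_star, smul_eq_mul]

/-- The products `(x × g) × (x × g)⋆` span a dense subspace of `L¹(ℝ²)`. -/
theorem eq_top_of_mul_gaussL1_mul_star_mem {W : Submodule ℂ (L1C 2)}
    (hW : IsClosed (W : Set (L1C 2)))
    (h : ∀ x, formJ.mulL1 (formJ.mulL1 x gaussL1) (starL1 (formJ.mulL1 x gaussL1)) ∈ W) :
    W = ⊤ := by
  refine eq_top_of_modGaussian_mem hW (b := 1 / 4) (by norm_num) fun x => ?_
  -- The translation vector is the inverse quarter turn of the required frequency x.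
  have h1 := h (shiftGaussL1 (!₂[x 1, -(x 0)]))
  rw [shiftGaussL1_mul, shiftGaussL1_mul_star] at h1
  have h2 : quarterTurn (!₂[x 1, -(x 0)]) = x := by
    ext i
    fin_cases i <;> simp [quarterTurn]
  rw [h2] at h1
  have h3 := W.smul_mem (2 * Real.pi : ℂ) h1
  rwa [smul_smul, mul_inv_cancel₀ (by exact_mod_cast (by positivity : (2 * Real.pi : ℝ) ≠ 0)),
    one_smul] at h3

theorem norm_conv_gaussJ_le (a : L1C 2) (α : Plane) : ‖formJ.conv a gaussJ α‖ ≤ ‖a‖ := by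
  rw [L1.norm_eq_integral_norm]
  simpa using formJ.norm_conv_le (L1.integrable_coeFn a) norm_gaussJ_le α

theorem continuous_conv_gaussJ (a : L1C 2) : Continuous (formJ.conv a gaussJ) :=
  formJ.continuous_conv (L1.integrable_coeFn a) continuous_gaussJ norm_gaussJ_le

/-- Minimality gives (x × g)⋆ × (y × g) = φ(x⋆ × y) g. At the origin the left side is an L² inner
product and g(0) = (2π)⁻¹. Hence φ is positive and its GNS space sits inside L²(ℝ²). -/
theorem gaussFunctional_star_mul (x y : L1C 2) :
    gaussFunctional (formJ.mulL1 (starL1 x) y) = (2 * Real.pi : ℂ) *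
      ∫ t, (starRingEnd ℂ) (formJ.conv x gaussJ t) * formJ.conv y gaussJ t := by
  have h1 : formJ.mulL1 (starL1 (formJ.mulL1 x gaussL1)) (formJ.mulL1 y gaussL1) =
      gaussFunctional (formJ.mulL1 (starL1 x) y) • gaussL1 := by
    rw [← gaussL1_mul_mul, starL1_mulL1, star_gaussL1, SkewForm.mulL1_assoc,
      SkewForm.mulL1_assoc]
  have hs : starL1 (formJ.mulL1 x gaussL1) =ᵐ[volume]
      fun α => (starRingEnd ℂ) (formJ.conv x gaussJ (-α)) := by
    filter_upwards [coeFn_starL1 (formJ.mulL1 x gaussL1), ae_neg (coeFn_mulL1_gaussL1 x)]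
      with α a1 a2
    rw [a1, a2]
  have h2 : formJ.conv (starL1 (formJ.mulL1 x gaussL1)) (formJ.conv y gaussJ) =ᵐ[volume]
      fun α => gaussFunctional (formJ.mulL1 (starL1 x) y) * gaussJ α := by
    rw [← formJ.conv_congr (EventuallyEq.refl _ (starL1 (formJ.mulL1 x gaussL1)))
      (coeFn_mulL1_gaussL1 y)]
    refine (formJ.coeFn_mulL1 _ _).symm.trans ?_
    rw [h1]
    filter_upwards [Lp.coeFn_smul (gaussFunctional (formJ.mulL1 (starL1 x) y)) gaussL1,
      coeFn_gaussL1] with α a1 a2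
    rw [a1, Pi.smul_apply, a2, smul_eq_mul]
  -- Both sides are continuous, so the a.e. identity may be evaluated at 0.
  have h3 := congrFun (((formJ.continuous_conv (L1.integrable_coeFn _) (continuous_conv_gaussJ y)
    (norm_conv_gaussJ_le y)).ae_eq_iff_eq volume (continuous_const.mul continuous_gaussJ)).1 h2) 0
  rw [formJ.conv_congr hs (EventuallyEq.refl _ (formJ.conv y gaussJ))] at h3
  have h4 : gaussJ 0 = (2 * Real.pi : ℂ)⁻¹ := by simp [gaussJ, gaussWeight]
  have h5 : (2 * Real.pi : ℂ) ≠ 0 := by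
    exact_mod_cast (by positivity : (2 * Real.pi : ℝ) ≠ 0)
  have h6 : formJ.conv (fun α => (starRingEnd ℂ) (formJ.conv x gaussJ (-α)))
      (formJ.conv y gaussJ) 0 =
      ∫ t, (starRingEnd ℂ) (formJ.conv x gaussJ t) * formJ.conv y gaussJ t := by
    rw [SkewForm.conv, ← integral_neg_eq_self
      (fun t => (starRingEnd ℂ) (formJ.conv x gaussJ t) * formJ.conv y gaussJ t)]
    refine integral_congr_ae (Eventually.of_forall fun t => ?_)
    have h0 : formJ.phase 0 t = 1 := by simp [formJ_phase]
    simp only [h0, mul_one, zero_sub]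
  rw [h6, Pi.mul_apply, h4] at h3
  rw [h3, mul_comm _ (2 * Real.pi : ℂ)⁻¹, mul_inv_cancel_left₀ h5]

theorem norm_shiftGauss_le (y α : Plane) : ‖shiftGauss y α‖ ≤ 1 := by
  rw [shiftGauss, norm_mul, formJ.norm_phase, mul_one]
  exact norm_gaussJ_le _

theorem continuous_shiftGauss (y : Plane) : Continuous (shiftGauss y) :=
  (continuous_gaussJ.comp (continuous_id.sub continuous_const)).mul
    (SkewForm.continuous_phase_comp (s := fun _ => formJ) (b := fun _ => y) continuous_const
      continuous_id continuous_const)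

/-- The value at y of a × (δ_y × g) is the Fourier transform of the product a·g at the frequency x
whose quarter turn is y. Thus a·g vanishes, and g is nowhere zero. -/
theorem eq_zero_of_forall_mul_gaussL1_eq_zero {a : L1C 2}
    (h : ∀ x, formJ.mulL1 a (formJ.mulL1 x gaussL1) = 0) : a = 0 := by
  have ha := L1.integrable_coeFn a
  have h1 : ∀ x : Plane, fourierHat (fun α => a α * gaussJ α) x = 0 := by
    intro x
    let y := quarterTurn x
    have h2 : formJ.conv a (shiftGauss y) =ᵐ[volume] fun _ => (0 : ℂ) := by
      rw [← formJ.conv_congr (EventuallyEq.refl _ a) (coeFn_shiftGaussL1 y), ← shiftGaussL1_mul]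
      refine (formJ.coeFn_mulL1 _ _).symm.trans ?_
      rw [h]
      exact Lp.coeFn_zero _ _ _
    have h3 := congrFun (((formJ.continuous_conv ha (continuous_shiftGauss y)
      (norm_shiftGauss_le y)).ae_eq_iff_eq volume continuous_const).1 h2) y
    rw [← h3, fourierHat, SkewForm.conv]
    refine integral_congr_ae (Eventually.of_forall fun α => ?_)
    simp only [shiftGauss]
    rw [sub_sub_cancel_left, gaussJ_neg, ← mul_assoc, mul_assoc _ (formJ.phase _ _)]
    congr 1
    rw [formJ_phase, formJ_phase, ← Complex.exp_add, inner_plane]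
    simp only [y, quarterTurn, PiLp.sub_apply, Matrix.cons_val_zero, Matrix.cons_val_one]
    congr 1
    push_cast
    ring
  have h2 := ae_eq_zero_of_fourierHat_eq_zero (ha.mul_bdd (c := 1)
    continuous_gaussJ.aestronglyMeasurable (Eventually.of_forall norm_gaussJ_le)) h1
  refine (Lp.eq_zero_iff_ae_eq_zero).2 ?_
  filter_upwards [h2] with α hα
  refine (mul_eq_zero.1 hα).resolve_right fun h0 => ?_
  have h3 : (0 : ℝ) < (2 * Real.pi)⁻¹ * gaussWeight α := by
    have := gaussWeight_pos α
    positivity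
  rw [gaussJ] at h0
  exact h3.ne' (by exact_mod_cast h0)

end

section

open scoped InnerProductSpace

/-! ## Finite rank approximation of compact operators -/

section FiniteRank

variable {K : Type*} [NormedAddCommGroup K] [InnerProductSpace ℂ K] [CompleteSpace K]

/-- A closed space of operators that contains all operators of rank one contains all compact
operators. -/
theorem mem_of_isCompactOperator {W : Submodule ℂ (K →L[ℂ] K)}
    (hW : IsClosed (W : Set (K →L[ℂ] K)))
    (h : ∀ x y : K, InnerProductSpace.rankOne ℂ x y ∈ W) {T : K →L[ℂ] K}
    (hT : IsCompactOperator T) : T ∈ W := by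
  refine hW.closure_subset_iff.2 le_rfl ?_
  refine (mem_closure_iff_nhds_basis Metric.nhds_basis_closedBall).2 fun ε hε => ?_
  have hSt : TotallyBounded (T '' Metric.closedBall 0 1) :=
    (hT.isCompact_closure_image_closedBall 1).totallyBounded.subset subset_closure
  obtain ⟨t, -, htf, ht⟩ := Metric.finite_approx_of_totallyBounded hSt (ε / 2) (by positivity)
  -- Projecting onto the span of an ε/2-net of the image of the unit ball moves no point of that
  -- image by more than ε, and the projected operator is a finite sum of rank-one operators.
  let U : Submodule ℂ K := Submodule.span ℂ t
  have : FiniteDimensional ℂ U := FiniteDimensional.span_of_finite ℂ htf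
  refine ⟨U.starProjection ∘L T, ?_, ?_⟩
  · rw [(stdOrthonormalBasis ℂ U).starProjection_eq_sum_rankOne, ContinuousLinearMap.finsetSum_comp]
    refine W.sum_mem fun i _ => ?_
    rw [InnerProductSpace.rankOne_comp]
    exact h _ _
  · rw [Metric.mem_closedBall, dist_eq_norm]
    refine ContinuousLinearMap.opNorm_le_of_unit_norm hε.le fun x hx => ?_
    obtain ⟨y, hy, hxy⟩ := Set.mem_iUnion₂.1 (ht (Set.mem_image_of_mem T
      (mem_closedBall_zero_iff.2 hx.le)))
    rw [Metric.mem_ball, dist_eq_norm] at hxy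
    have hPy : U.starProjection y = y :=
      Submodule.starProjection_eq_self_iff.2 (Submodule.subset_span hy)
    have h1 : (U.starProjection ∘L T - T) x = U.starProjection (T x - y) - (T x - y) := by
      rw [map_sub, hPy]
      simp
    rw [h1]
    have h2 := U.norm_starProjection_apply_le (T x - y)
    have h3 := norm_sub_le (U.starProjection (T x - y)) (T x - y)
    linarith

end FiniteRank

/-! ## The irreducible representation of the twisted algebra of the plane -/

/-- A linear map from `L¹(ℝ²)` to a Hilbert space with dense range that implements the positive
functional `gaussFunctional`. -/
structure IsGaussGNS {K : Type*} [NormedAddCommGroup K] [InnerProductSpace ℂ K]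
    (v : L1C 2 →ₗ[ℂ] K) : Prop where
  dense : DenseRange v
  inner_eq : ∀ x y, inner ℂ (v x) (v y) = gaussFunctional (formJ.mulL1 (starL1 x) y)

theorem norm_gaussFunctional_le (a : L1C 2) : ‖gaussFunctional a‖ ≤ ‖a‖ := by
  rw [gaussFunctional_apply, L1.norm_eq_integral_norm]
  refine norm_integral_le_of_norm_le (L1.integrable_coeFn a).norm
    (Eventually.of_forall fun β => ?_)
  rw [norm_mul, Complex.norm_real, Real.norm_of_nonneg (gaussWeight_pos β).le]
  exact mul_le_of_le_one_right (norm_nonneg _) (gaussWeight_le_one β)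

/-- Evaluate g × (a × g × b) × g in two ways: by minimality at once, or as (g × a × g) × (g × b × g)
using g × g = g. -/
theorem gaussFunctional_mul_gaussL1_mul (a b : L1C 2) :
    gaussFunctional (formJ.mulL1 a (formJ.mulL1 gaussL1 b)) =
      gaussFunctional a * gaussFunctional b := by
  have h := gaussL1_mul_mul (formJ.mulL1 a (formJ.mulL1 gaussL1 b))
  have h2 : formJ.mulL1 gaussL1 (formJ.mulL1 (formJ.mulL1 a (formJ.mulL1 gaussL1 b)) gaussL1) =
      (gaussFunctional a * gaussFunctional b) • gaussL1 := by
    rw [formJ.mulL1_assoc a, formJ.mulL1_assoc gaussL1, gaussL1_mul_mul, formJ.mulL1_smul,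
      formJ.mulL1_smul, gaussL1_mul_mul, smul_smul, mul_comm]
  rw [h2] at h
  have h' : (gaussFunctional a * gaussFunctional b -
      gaussFunctional (formJ.mulL1 a (formJ.mulL1 gaussL1 b))) • gaussL1 = 0 := by
    rw [sub_smul, h, sub_self]
  exact (sub_eq_zero.1 ((smul_eq_zero.1 h').resolve_right gaussL1_ne_zero)).symm

theorem memLp_conv_gaussJ (a : L1C 2) : MemLp (formJ.conv a gaussJ) 2 := by
  refine (memLp_two_iff_integrable_sq_norm (continuous_conv_gaussJ a).aestronglyMeasurable).2 ?_
  simp only [sq]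
  exact (formJ.integrable_conv (L1.integrable_coeFn a) integrable_gaussJ).norm.mul_bdd (c := ‖a‖)
    (continuous_conv_gaussJ a).norm.aestronglyMeasurable
    (Eventually.of_forall fun t => by rw [norm_norm]; exact norm_conv_gaussJ_le a t)

/-- Left multiplication in the algebra `L¹(ℝ²)` twisted by `J`. -/
def mulLeftJ (a : L1C 2) : L1C 2 →ₗ[ℂ] L1C 2 where
  toFun := formJ.mulL1 a
  map_add' := formJ.mulL1_add a
  map_smul' c := formJ.mulL1_smul c a

namespace IsGaussGNS

variable {K : Type*} [NormedAddCommGroup K] [InnerProductSpace ℂ K] {v : L1C 2 →ₗ[ℂ] K}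

theorem norm_le (hv : IsGaussGNS v) (x : L1C 2) : ‖v x‖ ≤ ‖x‖ := by
  have h1 : ‖v x‖ ^ 2 ≤ ‖x‖ ^ 2 := by
    calc ‖v x‖ ^ 2 = ‖inner ℂ (v x) (v x)‖ := by rw [inner_self_eq_norm_sq_to_K]; simp
      _ = ‖gaussFunctional (formJ.mulL1 (starL1 x) x)‖ := by rw [hv.inner_eq]
      _ ≤ ‖starL1 x‖ * ‖x‖ := (norm_gaussFunctional_le _).trans (formJ.norm_mulL1_le _ _)
      _ = ‖x‖ ^ 2 := by rw [norm_starL1, sq]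
  exact (sq_le_sq₀ (norm_nonneg _) (norm_nonneg _)).1 h1

theorem inner_mul (hv : IsGaussGNS v) (a x y : L1C 2) :
    inner ℂ (v (formJ.mulL1 a x)) (v y) = inner ℂ (v x) (v (formJ.mulL1 (starL1 a) y)) := by
  rw [hv.inner_eq, hv.inner_eq, starL1_mulL1, formJ.mulL1_assoc]

theorem norm_mul_sq_le (hv : IsGaussGNS v) (a x : L1C 2) :
    ‖v (formJ.mulL1 a x)‖ ^ 2 ≤ ‖v x‖ * ‖v (formJ.mulL1 (formJ.mulL1 (starL1 a) a) x)‖ := by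
  calc ‖v (formJ.mulL1 a x)‖ ^ 2
      = ‖inner ℂ (v (formJ.mulL1 a x)) (v (formJ.mulL1 a x))‖ := by
        rw [inner_self_eq_norm_sq_to_K]; simp
    _ = ‖inner ℂ (v x) (v (formJ.mulL1 (formJ.mulL1 (starL1 a) a) x))‖ := by
        rw [hv.inner_mul, formJ.mulL1_assoc]
    _ ≤ _ := norm_inner_le_norm _ _

/-- The sequence `a, a⋆a, (a⋆a)⋆(a⋆a), …`. -/
def starSquare (a : L1C 2) : ℕ → L1C 2
  | 0 => a
  | k + 1 => formJ.mulL1 (starL1 (starSquare a k)) (starSquare a k)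

theorem norm_starSquare_le (a : L1C 2) (k : ℕ) : ‖starSquare a k‖ ≤ ‖a‖ ^ 2 ^ k := by
  induction k with
  | zero => simp [starSquare]
  | succ k ih =>
    calc ‖starSquare a (k + 1)‖ ≤ ‖starL1 (starSquare a k)‖ * ‖starSquare a k‖ :=
          formJ.norm_mulL1_le _ _
      _ = ‖starSquare a k‖ ^ 2 := by rw [norm_starL1, sq]
      _ ≤ (‖a‖ ^ 2 ^ k) ^ 2 := pow_le_pow_left₀ (norm_nonneg _) ih 2
      _ = ‖a‖ ^ 2 ^ (k + 1) := by rw [← pow_mul, pow_succ]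

/-- Cauchy–Schwarz bounds ‖v(ax)‖² by ‖v(x)‖ ‖v(a⋆a x)‖. Iterating along `starSquare` gives
‖v(ax)‖^(2^k) ‖v(x)‖ ≤ (‖a‖ ‖v(x)‖)^(2^k) ‖x‖; the fixed factors do not survive as k grows. -/
theorem norm_mul_le (hv : IsGaussGNS v) (a x : L1C 2) :
    ‖v (formJ.mulL1 a x)‖ ≤ ‖a‖ * ‖v x‖ := by
  set s := ‖v x‖ with hs
  have key : ∀ k, ‖v (formJ.mulL1 a x)‖ ^ 2 ^ k * s ≤
      s ^ 2 ^ k * ‖v (formJ.mulL1 (starSquare a k) x)‖ := by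
    intro k
    induction k with
    | zero => simp [starSquare, mul_comm]
    | succ k ih =>
      rcases (norm_nonneg (v x)).eq_or_lt with h0 | h0
      · rw [hs, ← h0]; simp
      · have h1 := hv.norm_mul_sq_le (starSquare a k) x
        have h2 := pow_le_pow_left₀ (by positivity) ih 2
        have h3 : (‖v (formJ.mulL1 a x)‖ ^ 2 ^ (k + 1) * s) * s ≤
            (s ^ 2 ^ (k + 1) * ‖v (formJ.mulL1 (starSquare a (k + 1)) x)‖) * s := by
          calc (‖v (formJ.mulL1 a x)‖ ^ 2 ^ (k + 1) * s) * s
              = (‖v (formJ.mulL1 a x)‖ ^ 2 ^ k * s) ^ 2 := by rw [pow_succ 2 k, pow_mul]; ring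
            _ ≤ (s ^ 2 ^ k * ‖v (formJ.mulL1 (starSquare a k) x)‖) ^ 2 := h2
            _ = s ^ 2 ^ (k + 1) * ‖v (formJ.mulL1 (starSquare a k) x)‖ ^ 2 := by
                rw [pow_succ 2 k, pow_mul]; ring
            _ ≤ s ^ 2 ^ (k + 1) * (s * ‖v (formJ.mulL1 (starSquare a (k + 1)) x)‖) := by
                gcongr
                exact h1
            _ = _ := by ring
        exact le_of_mul_le_mul_right h3 h0
  -- The limiting argument needs v(x) ≠ 0; when v(x) = 0, a single Cauchy–Schwarz already gives
  -- v(ax) = 0.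
  rcases (norm_nonneg (v x)).eq_or_lt with h0 | h0
  · have h1 := hv.norm_mul_sq_le a x
    rw [← h0, zero_mul] at h1
    have h2 := norm_nonneg (v (formJ.mulL1 a x))
    rw [hs, ← h0, mul_zero]
    nlinarith
  -- If the bound failed, the ratio r would be less than one, and the positive number ‖v(x)‖ would
  -- lie below r^(2^k) ‖x‖ for all k.
  by_contra! hlt
  have hpos : 0 < ‖v (formJ.mulL1 a x)‖ := lt_of_le_of_lt (by positivity) hlt
  have hb : ∀ k : ℕ, ‖v (formJ.mulL1 a x)‖ ^ 2 ^ k * s ≤ (‖a‖ * s) ^ 2 ^ k * ‖x‖ := by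
    intro k
    refine (key k).trans ?_
    rw [mul_pow, mul_comm (‖a‖ ^ 2 ^ k), mul_assoc]
    refine mul_le_mul_of_nonneg_left ?_ (by positivity)
    exact (hv.norm_le _).trans ((formJ.norm_mulL1_le _ _).trans
      (mul_le_mul_of_nonneg_right (norm_starSquare_le a k) (norm_nonneg _)))
  set r := ‖a‖ * s / ‖v (formJ.mulL1 a x)‖ with hr
  have hr1 : r < 1 := (div_lt_one hpos).2 hlt
  have hr0 : 0 ≤ r := by positivity
  have hc : ∀ k : ℕ, s ≤ r ^ 2 ^ k * ‖x‖ := by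
    intro k
    rw [hr, div_pow, div_mul_eq_mul_div, le_div_iff₀ (by positivity), mul_comm]
    exact hb k
  have hlim : Tendsto (fun k : ℕ => r ^ 2 ^ k * ‖x‖) atTop (𝓝 0) := by
    have h1 : Tendsto (fun k : ℕ => 2 ^ k) atTop (atTop : Filter ℕ) :=
      tendsto_pow_atTop_atTop_of_one_lt one_lt_two
    simpa using ((tendsto_pow_atTop_nhds_zero_of_lt_one hr0 hr1).comp h1).mul_const ‖x‖
  exact absurd (ge_of_tendsto' hlim hc) (not_le.2 h0)

theorem ext_clm (hv : IsGaussGNS v) {S T : K →L[ℂ] K} (h : ∀ x, S (v x) = T (v x)) : S = T :=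
  ContinuousLinearMap.ext fun k => congrFun
    (hv.dense.equalizer S.continuous T.continuous (funext h)) k

/-- Against the dense vectors v(y) this is φ(y⋆ x g b) = φ(y⋆ x) φ(b). -/
theorem apply_mul_gaussL1_mul (hv : IsGaussGNS v) (x b : L1C 2) :
    v (formJ.mulL1 x (formJ.mulL1 gaussL1 b)) = gaussFunctional b • v x := by
  refine hv.dense.eq_of_inner_right ℂ fun y => ?_
  rw [inner_smul_right, hv.inner_eq, hv.inner_eq, ← formJ.mulL1_assoc,
    gaussFunctional_mul_gaussL1_mul, mul_comm]

variable [CompleteSpace K]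

/-- The operator `v(x) ↦ v(a × x)`. -/
def op (v : L1C 2 →ₗ[ℂ] K) (a : L1C 2) : K →L[ℂ] K := (v ∘ₗ mulLeftJ a).extendOfNorm v

theorem op_apply (hv : IsGaussGNS v) (a x : L1C 2) : op v a (v x) = v (formJ.mulL1 a x) :=
  LinearMap.extendOfNorm_eq hv.dense ⟨‖a‖, hv.norm_mul_le a⟩ x

theorem norm_op_le (hv : IsGaussGNS v) (a : L1C 2) : ‖op v a‖ ≤ ‖a‖ :=
  LinearMap.opNorm_extendOfNorm_le hv.dense (norm_nonneg a) (hv.norm_mul_le a)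

theorem op_add (hv : IsGaussGNS v) (a b : L1C 2) : op v (a + b) = op v a + op v b :=
  hv.ext_clm fun x => by
    rw [add_apply, hv.op_apply, hv.op_apply, hv.op_apply, formJ.add_mulL1,
      map_add]

theorem op_smul (hv : IsGaussGNS v) (c : ℂ) (a : L1C 2) : op v (c • a) = c • op v a :=
  hv.ext_clm fun x => by
    rw [smul_apply, hv.op_apply, hv.op_apply, formJ.smul_mulL1, map_smul]

theorem op_mul (hv : IsGaussGNS v) (a b : L1C 2) : op v (formJ.mulL1 a b) = op v a * op v b :=
  hv.ext_clm fun x => by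
    rw [mul_apply_eq_comp, hv.op_apply, hv.op_apply, hv.op_apply, formJ.mulL1_assoc]

theorem op_star (hv : IsGaussGNS v) (a : L1C 2) : op v (starL1 a) = star (op v a) :=
  hv.ext_clm fun x => by
    refine hv.dense.eq_of_inner_left ℂ fun y => ?_
    rw [ContinuousLinearMap.star_eq_adjoint, ContinuousLinearMap.adjoint_inner_left,
      hv.op_apply, hv.op_apply, hv.inner_mul, starL1_starL1]

/-- The representation as a continuous linear map. -/
def opCLM (hv : IsGaussGNS v) : L1C 2 →L[ℂ] K →L[ℂ] K :=
  LinearMap.mkContinuous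
    { toFun := op v, map_add' := hv.op_add, map_smul' := hv.op_smul } 1 fun a => by
    rw [one_mul]
    exact hv.norm_op_le a

theorem opCLM_apply (hv : IsGaussGNS v) (a : L1C 2) : hv.opCLM a = op v a := rfl

/-- On v(z) the left side gives v(x g (y⋆z)) = φ(y⋆z) v(x), and φ(y⋆z) = ⟨v(y), v(z)⟩. All rank-one
operators between vectors of the dense range thus come from the algebra. -/
theorem op_mul_gaussL1_mul_star (hv : IsGaussGNS v) (x y : L1C 2) :
    op v (formJ.mulL1 x (formJ.mulL1 gaussL1 (starL1 y))) =
      InnerProductSpace.rankOne ℂ (v x) (v y) :=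
  hv.ext_clm fun z => by
    rw [hv.op_apply, formJ.mulL1_assoc, formJ.mulL1_assoc, hv.apply_mul_gaussL1_mul,
      InnerProductSpace.rankOne_apply, hv.inner_eq]

/-- Compactness is a closed linear condition on a, and it holds for the total set of products
(xg)(xg)⋆ = x g x⋆, which act with rank at most one. -/
theorem isCompactOperator_op (hv : IsGaussGNS v) (a : L1C 2) : IsCompactOperator (op v a) := by
  let W : Submodule ℂ (L1C 2) :=
    { carrier := {a | IsCompactOperator (op v a)}
      add_mem' := fun {a b} ha hb => by
        change IsCompactOperator (op v (a + b))
        rw [hv.op_add]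
        exact ha.add hb
      zero_mem' := by
        change IsCompactOperator (op v 0)
        rw [← hv.opCLM_apply, map_zero]
        exact isCompactOperator_zero
      smul_mem' := fun c a ha => by
        change IsCompactOperator (op v (c • a))
        rw [hv.op_smul]
        exact IsCompactOperator.smul ha c }
  have hW : IsClosed (W : Set (L1C 2)) := (isClosed_compactOperators K).preimage hv.opCLM.continuous
  have h : W = ⊤ := by
    refine eq_top_of_mul_gaussL1_mul_star_mem hW fun x => ?_
    change IsCompactOperator (op v _)
    rw [starL1_mulL1, star_gaussL1, formJ.mulL1_assoc, ← formJ.mulL1_assoc gaussL1,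
      gaussL1_mul_self, hv.op_mul_gaussL1_mul_star]
    exact (isCompactOperator_of_locallyCompactSpace_rng
      (ContinuousLinearMap.toSpanSingleton ℂ (v x))).comp_clm (innerSL ℂ (v x))
  have h' : a ∈ W := h ▸ Submodule.mem_top
  exact h'

/-- If a acts by zero, then v(ax) = 0, so a × x × g has L² norm zero for every x, and this forces a
= 0. -/
theorem op_injective (hv : IsGaussGNS v) {a : L1C 2} (h : op v a = 0) : a = 0 := by
  refine eq_zero_of_forall_mul_gaussL1_eq_zero fun x => ?_
  set y := formJ.mulL1 a x with hy
  have h1 : v y = 0 := by rw [hy, ← hv.op_apply, h, zero_apply]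
  have h2 := gaussFunctional_star_mul y y
  rw [← hv.inner_eq, h1, inner_zero_left] at h2
  have hpi : (2 * Real.pi : ℂ) ≠ 0 := by
    exact_mod_cast (by positivity : (2 * Real.pi : ℝ) ≠ 0)
  have h3 := (mul_eq_zero.1 h2.symm).resolve_left hpi
  have h4 : ∀ t, (starRingEnd ℂ) (formJ.conv y gaussJ t) * formJ.conv y gaussJ t =
      ((‖formJ.conv y gaussJ t‖ ^ 2 : ℝ) : ℂ) := fun t => by
    rw [Complex.conj_mul']
    push_cast
    rfl
  simp only [h4] at h3
  rw [integral_complex_ofReal, Complex.ofReal_eq_zero] at h3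
  have h5 := (integral_eq_zero_iff_of_nonneg (fun t => sq_nonneg _)
    ((memLp_two_iff_integrable_sq_norm
      (continuous_conv_gaussJ y).aestronglyMeasurable).1 (memLp_conv_gaussJ y))).1 h3
  rw [← formJ.mulL1_assoc, ← hy]
  refine (Lp.eq_zero_iff_ae_eq_zero).2 ((coeFn_mulL1_gaussL1 y).trans ?_)
  filter_upwards [h5] with t ht
  simpa using ht

/-- Rank-one operators depend continuously on their two vectors, so those between vectors v(x), v(y)
suffice, and these are in the image of the algebra. -/
theorem compact_mem_closure (hv : IsGaussGNS v) {W : Submodule ℂ (K →L[ℂ] K)}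
    (hW : IsClosed (W : Set (K →L[ℂ] K))) (h : ∀ a, op v a ∈ W) {T : K →L[ℂ] K}
    (hT : IsCompactOperator T) : T ∈ W := by
  refine mem_of_isCompactOperator hW (fun x y => ?_) hT
  have hc : Continuous fun p : K × K => InnerProductSpace.rankOne ℂ p.1 p.2 := by
    simp only [InnerProductSpace.rankOne_def']
    exact ((ContinuousLinearMap.toSpanSingletonCLE (𝕜 := ℂ) (E := K)).continuous.comp
      continuous_fst).clm_comp ((innerSL ℂ).continuous.comp continuous_snd)
  refine (hv.dense.prodMap hv.dense).induction_on (p := fun p : K × K =>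
    InnerProductSpace.rankOne ℂ p.1 p.2 ∈ W) (x, y) (hW.preimage hc) ?_
  rintro ⟨x, y⟩
  change InnerProductSpace.rankOne ℂ (v x) (v y) ∈ W
  rw [← hv.op_mul_gaussL1_mul_star]
  exact h _

/-- g acts as the projection onto the unit vector v(g). This normalisation makes the bound on the
corner sharp. -/
theorem norm_op_gaussL1 (hv : IsGaussGNS v) : ‖op v gaussL1‖ = 1 := by
  have h := hv.op_mul_gaussL1_mul_star gaussL1 gaussL1
  rw [star_gaussL1, gaussL1_mul_self, gaussL1_mul_self] at h
  have h1 : ‖v gaussL1‖ ^ 2 = 1 := by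
    have h2 := hv.inner_eq gaussL1 gaussL1
    rw [star_gaussL1, gaussL1_mul_self, gaussFunctional_gaussL1, inner_self_eq_norm_sq_to_K] at h2
    have h3 : ((‖v gaussL1‖ ^ 2 : ℝ) : ℂ) = (1 : ℝ) := by push_cast; exact h2
    exact Complex.ofReal_injective h3
  rw [h, InnerProductSpace.norm_rankOne, ← sq, h1]

end IsGaussGNS

end

/-! ## Separable Hilbert spaces -/

section Separable

/-- Orthonormal vectors have mutual distance √2, so balls of radius 1/2 around them are disjoint
open sets. -/
theorem Orthonormal.countable_of_separableSpace {K : Type*} [NormedAddCommGroup K]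
    [InnerProductSpace ℂ K] [TopologicalSpace.SeparableSpace K] {ι : Type*} {b : ι → K}
    (hb : Orthonormal ℂ b) : Countable ι := by
  have hd : ∀ i j, i ≠ j → 1 ≤ dist (b i) (b j) := by
    intro i j hij
    have h1 : ‖b i - b j‖ ^ 2 = 2 := by
      rw [@norm_sub_sq ℂ, hb.2 hij, hb.1 i, hb.1 j]
      norm_num
    rw [dist_eq_norm]
    nlinarith [norm_nonneg (b i - b j)]
  have h := Set.PairwiseDisjoint.countable_of_isOpen (s := fun i => Metric.ball (b i) (1 / 2))
    (a := Set.univ) (fun i _ j _ hij => Metric.ball_disjoint_ball (by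
      have := hd i j hij
      linarith)) (fun i _ => Metric.isOpen_ball)
    (fun i _ => ⟨b i, Metric.mem_ball_self (by norm_num)⟩)
  exact Set.countable_univ_iff.1 h

theorem exists_hilbertBasis_nat (K : Type*) [NormedAddCommGroup K] [InnerProductSpace ℂ K]
    [CompleteSpace K] [TopologicalSpace.SeparableSpace K] (hK : ¬ FiniteDimensional ℂ K) :
    Nonempty (HilbertBasis ℕ ℂ K) := by
  obtain ⟨w, b, hb⟩ := exists_hilbertBasis ℂ K
  have hc : Countable w := b.orthonormal.countable_of_separableSpace
  have hi : Infinite w := by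
    by_contra hfin
    rw [not_infinite_iff_finite] at hfin
    have : Fintype w := Fintype.ofFinite w
    exact hK (Module.Basis.finiteDimensional_of_finite b.toOrthonormalBasis.toBasis)
  obtain ⟨e⟩ : Nonempty (ℕ ≃ w) := by
    have := Encodable.ofCountable w
    exact ⟨(Denumerable.ofEncodableOfInfinite w).eqv.symm⟩
  refine ⟨HilbertBasis.mk (v := b ∘ e) (b.orthonormal.comp e e.injective) ?_⟩
  rw [Set.range_comp, e.surjective.range_eq, Set.image_univ]
  exact b.dense_span.ge

/-- Infinite-dimensional separable Hilbert spaces are isomorphic. -/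
theorem exists_linearIsometryEquiv (K H : Type*) [NormedAddCommGroup K] [InnerProductSpace ℂ K]
    [CompleteSpace K] [TopologicalSpace.SeparableSpace K] (hK : ¬ FiniteDimensional ℂ K)
    [NormedAddCommGroup H] [InnerProductSpace ℂ H] [CompleteSpace H]
    [TopologicalSpace.SeparableSpace H] (hH : ¬ FiniteDimensional ℂ H) :
    Nonempty (K ≃ₗᵢ[ℂ] H) := by
  obtain ⟨b⟩ := exists_hilbertBasis_nat K hK
  obtain ⟨b'⟩ := exists_hilbertBasis_nat H hH
  exact ⟨b.repr.trans b'.repr.symm⟩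

end Separable

/-- Indicators of disjoint balls centred at integer points of a coordinate axis are independent.
Through faithfulness this forces the GNS space to be infinite-dimensional. -/
theorem not_finiteDimensional_L1C {n : ℕ} (hn : 0 < n) : ¬ FiniteDimensional ℂ (L1C n) := by
  intro hfin
  let c : ℕ → EuclideanSpace ℝ (Fin n) := fun k => EuclideanSpace.single ⟨0, hn⟩ (k : ℝ)
  let B : ℕ → Set (EuclideanSpace ℝ (Fin n)) := fun k => Metric.ball (c k) (1 / 2)
  have hd : ∀ i j, i ≠ j → Disjoint (B i) (B j) := by
    intro i j hij
    refine Metric.ball_disjoint_ball ?_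
    rw [PiLp.dist_single_same, Nat.dist_cast_real, Nat.dist_eq]
    have h : (1 : ℤ) ≤ |(i : ℤ) - j| := Int.one_le_abs (by omega)
    have h' : (1 : ℝ) ≤ |(i : ℝ) - j| := by exact_mod_cast h
    linarith
  have hB : ∀ k, volume (B k) ≠ ⊤ := fun k => Metric.isBounded_ball.measure_lt_top.ne
  let f : ℕ → L1C n := fun k => indicatorConstLp 1 Metric.isOpen_ball.measurableSet (hB k) (1 : ℂ)
  have hf : ∀ i j, L1C.setIntegralCLM (B j) (f i) = if i = j then (volume.real (B j) : ℂ) else 0 := by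
    intro i j
    rw [L1C.setIntegralCLM_apply, setIntegral_indicatorConstLp Metric.isOpen_ball.measurableSet]
    split_ifs with h
    · rw [h, Set.inter_self]; simp [B]
    · rw [(hd i j h).inter_eq]; simp
  have hli : LinearIndependent ℂ f := by
    rw [linearIndependent_iff']
    intro s g hg j hj
    have h := congrArg (L1C.setIntegralCLM (B j)) hg
    rw [map_sum, map_zero] at h
    simp only [map_smul, hf, smul_eq_mul, mul_ite, mul_zero, Finset.sum_ite_eq', hj, if_true] at h
    refine (mul_eq_zero.1 h).resolve_right ?_
    have h2 : 0 < volume.real (B j) :=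
      ENNReal.toReal_pos (Metric.measure_ball_pos volume (c j) (by norm_num)).ne' (hB j)
    exact_mod_cast h2.ne'
  exact absurd hli.finite (not_finite_iff_infinite.2 inferInstance)

/-- The vector `x × g` in `L²(ℝ²)`, suitably normalised. -/
def gaussVec : L1C 2 →ₗ[ℂ] Lp ℂ 2 (volume : Measure Plane) where
  toFun x := (Real.sqrt (2 * Real.pi) : ℂ) • (memLp_conv_gaussJ x).toLp _
  map_add' x y := by
    rw [← smul_add, ← MemLp.toLp_add]
    congr 1
    refine MemLp.toLp_congr _ _ ?_
    filter_upwards [coeFn_mulL1_gaussL1 (x + y), coeFn_mulL1_gaussL1 x, coeFn_mulL1_gaussL1 y,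
      Lp.coeFn_add (formJ.mulL1 x gaussL1) (formJ.mulL1 y gaussL1)] with t h1 h2 h3 h4
    rw [Pi.add_apply, ← h1, ← h2, ← h3, formJ.add_mulL1, h4, Pi.add_apply]
  map_smul' c x := by
    rw [RingHom.id_apply, smul_comm c]
    refine congrArg _ ((MemLp.toLp_congr _ ((memLp_conv_gaussJ x).const_smul c) ?_).trans
      (MemLp.toLp_const_smul c _))
    filter_upwards [coeFn_mulL1_gaussL1 (c • x), coeFn_mulL1_gaussL1 x,
      Lp.coeFn_smul c (formJ.mulL1 x gaussL1)] with t h1 h2 h4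
    rw [Pi.smul_apply, ← h1, ← h2, formJ.smul_mulL1, h4, Pi.smul_apply]

/-- The factor √(2π) in `gaussVec` absorbs the constant 2π relating φ(x⋆y) to the L² inner product.
-/
theorem inner_gaussVec (x y : L1C 2) :
    inner ℂ (gaussVec x) (gaussVec y) = gaussFunctional (formJ.mulL1 (starL1 x) y) := by
  have h : inner ℂ ((memLp_conv_gaussJ x).toLp _ : Lp ℂ 2 (volume : Measure Plane))
      ((memLp_conv_gaussJ y).toLp _) =
      ∫ t, (starRingEnd ℂ) (formJ.conv x gaussJ t) * formJ.conv y gaussJ t := by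
    rw [L2.inner_def]
    refine integral_congr_ae ?_
    filter_upwards [(memLp_conv_gaussJ x).coeFn_toLp, (memLp_conv_gaussJ y).coeFn_toLp]
      with t h1 h2
    rw [h1, h2, RCLike.inner_apply, mul_comm]
  have h2 : (Real.sqrt (2 * Real.pi) : ℂ) * (Real.sqrt (2 * Real.pi) : ℂ) = (2 * Real.pi : ℂ) := by
    rw [← Complex.ofReal_mul, Real.mul_self_sqrt (by positivity)]
    push_cast
    rfl
  change inner ℂ
    ((Real.sqrt (2 * Real.pi) : ℂ) • (memLp_conv_gaussJ x).toLp _ : Lp ℂ 2 (volume : Measure Plane))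
    ((Real.sqrt (2 * Real.pi) : ℂ) • (memLp_conv_gaussJ y).toLp _) = _
  rw [inner_smul_left, inner_smul_right, h, gaussFunctional_star_mul, Complex.conj_ofReal,
    ← mul_assoc, h2]

/-- Every infinite-dimensional separable Hilbert space carries the Gaussian GNS representation. -/
theorem exists_isGaussGNS {H : Type*} [NormedAddCommGroup H] [InnerProductSpace ℂ H]
    [CompleteSpace H] [TopologicalSpace.SeparableSpace H] (hH : ¬ FiniteDimensional ℂ H) :
    ∃ v : L1C 2 →ₗ[ℂ] H, IsGaussGNS v := by
  -- There is no need to know this closure exactly: it only has to be separable and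
  -- infinite-dimensional, so that it can be transported to H.
  let K : Submodule ℂ (Lp ℂ 2 (volume : Measure Plane)) :=
    (LinearMap.range gaussVec).topologicalClosure
  have hKc : CompleteSpace K := (Submodule.isClosed_topologicalClosure _).completeSpace_coe
  let v : L1C 2 →ₗ[ℂ] K := gaussVec.codRestrict K fun x =>
    Submodule.le_topologicalClosure _ (LinearMap.mem_range_self _ x)
  have hv : IsGaussGNS v := by
    refine ⟨?_, fun x y => inner_gaussVec x y⟩
    intro k
    rw [Topology.IsEmbedding.subtypeVal.closure_eq_preimage_closure_image]
    have h : Subtype.val '' Set.range v = (LinearMap.range gaussVec : Set _) := by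
      rw [← Set.range_comp]
      rfl
    rw [Set.mem_preimage, h]
    exact k.2
  have hvc : Continuous v :=
    (LinearMap.mkContinuous v 1 fun x => by rw [one_mul]; exact hv.norm_le x).continuous
  have : Fact ((1 : ENNReal) ≠ ⊤) := ⟨ENNReal.one_ne_top⟩
  have hs : TopologicalSpace.SeparableSpace K := hv.dense.separableSpace hvc
  have hK : ¬ FiniteDimensional ℂ K := by
    intro hfin
    -- A finite-dimensional K would have a finite-dimensional operator algebra, into which L¹(ℝ²)
    -- embeds.
    have hinj : Function.Injective hv.opCLM := by
      refine (injective_iff_map_eq_zero _).2 fun a ha => hv.op_injective ha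
    exact not_finiteDimensional_L1C (by norm_num)
      (FiniteDimensional.of_injective (hv.opCLM : L1C 2 →ₗ[ℂ] K →L[ℂ] K) hinj)
  obtain ⟨e⟩ := exists_linearIsometryEquiv K H hK hH
  refine ⟨e.toLinearEquiv.toLinearMap ∘ₗ v, ?_, fun x y => ?_⟩
  · exact e.surjective.denseRange.comp hv.dense e.continuous
  · rw [← hv.inner_eq]
    exact e.inner_map_map _ _

/-! ## C*-seminorms that are determined by a left ideal -/

namespace CStarSeminorm

section Basic

variable {A : Type*} [NonUnitalRing A] [StarRing A] [Module ℂ A]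

theorem nonneg (p : CStarSeminorm A) (a : A) : 0 ≤ p a := apply_nonneg p.toSeminorm a

/-- The maximum of two C*-seminorms. -/
def sup (p q : CStarSeminorm A) : CStarSeminorm A where
  toSeminorm := p.toSeminorm ⊔ q.toSeminorm
  mul_le' a b := by
    rw [Seminorm.sup_apply, Seminorm.sup_apply, Seminorm.sup_apply]
    exact max_le
      ((p.mul_le' a b).trans (mul_le_mul (le_max_left _ _) (le_max_left _ _) (p.nonneg b)
        ((p.nonneg a).trans (le_max_left _ _))))
      ((q.mul_le' a b).trans (mul_le_mul (le_max_right _ _) (le_max_right _ _) (q.nonneg b)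
        ((q.nonneg a).trans (le_max_right _ _))))
  star_mul_self' a := by
    rw [Seminorm.sup_apply, Seminorm.sup_apply, p.star_mul_self', q.star_mul_self']
    exact ((pow_left_monotoneOn (n := 2)).map_max (p.nonneg a) (q.nonneg a)).symm

theorem sup_apply (p q : CStarSeminorm A) (a : A) : p.sup q a = max (p a) (q a) :=
  Seminorm.sup_apply _ _ _

/-- The C*-seminorm pulled back from a C*-algebra along a *-homomorphism. -/
def ofHom {C : Type*} [NonUnitalCStarAlgebra C] (Φ : A →⋆ₙₐ[ℂ] C) : CStarSeminorm A where
  toFun a := ‖Φ a‖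
  map_zero' := by rw [map_zero, norm_zero]
  add_le' a b := by rw [map_add]; exact norm_add_le _ _
  neg' a := by rw [map_neg, norm_neg]
  smul' c a := by rw [map_smul, norm_smul]
  mul_le' a b := by
    change ‖Φ (a * b)‖ ≤ ‖Φ a‖ * ‖Φ b‖
    rw [map_mul]
    exact norm_mul_le _ _
  star_mul_self' a := by
    change ‖Φ (star a * a)‖ = ‖Φ a‖ ^ 2
    rw [map_mul, map_star, CStarRing.norm_star_mul_self, sq]

theorem ofHom_apply {C : Type*} [NonUnitalCStarAlgebra C] (Φ : A →⋆ₙₐ[ℂ] C) (a : A) :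
    ofHom Φ a = ‖Φ a‖ := rfl

/-- The pull-back of a C*-seminorm along a *-homomorphism. -/
def comp {B : Type*} [NonUnitalRing B] [StarRing B] [Module ℂ B] (p : CStarSeminorm B)
    (θ : A →⋆ₙₐ[ℂ] B) : CStarSeminorm A where
  toFun a := p (θ a)
  map_zero' := by rw [map_zero, map_zero]
  add_le' a b := by rw [map_add]; exact map_add_le_add _ _ _
  neg' a := by rw [map_neg, map_neg_eq_map]
  smul' c a := by rw [map_smul, map_smul_eq_mul]
  mul_le' a b := by
    change p (θ (a * b)) ≤ p (θ a) * p (θ b)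
    rw [map_mul]
    exact p.mul_le' _ _
  star_mul_self' a := by
    change p (θ (star a * a)) = p (θ a) ^ 2
    rw [map_mul, map_star, p.star_mul_self']

theorem comp_apply {B : Type*} [NonUnitalRing B] [StarRing B] [Module ℂ B] (p : CStarSeminorm B)
    (θ : A →⋆ₙₐ[ℂ] B) (a : A) : p.comp θ a = p (θ a) := rfl

end Basic

section LeftIdeal

variable {B : Type*} [NonUnitalCStarAlgebra B]

/-- Left multiplication on a subspace. -/
def leftMulOn (L : Submodule ℂ B) (b : B) : L →L[ℂ] B :=
  (ContinuousLinearMap.mul ℂ B b) ∘L L.subtypeL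

section

variable (L : Submodule ℂ B)

theorem norm_mul_le_leftMulOn (b : B) {l : B} (hl : l ∈ L) : ‖b * l‖ ≤ ‖leftMulOn L b‖ * ‖l‖ :=
  (leftMulOn L b).le_opNorm ⟨l, hl⟩

theorem leftMulOn_le (b : B) {M : ℝ} (hM : 0 ≤ M) (h : ∀ l ∈ L, ‖b * l‖ ≤ M * ‖l‖) :
    ‖leftMulOn L b‖ ≤ M :=
  (leftMulOn L b).opNorm_le_bound hM fun l => h l l.2

theorem leftMulOn_nonneg (b : B) : 0 ≤ ‖leftMulOn L b‖ :=
  ContinuousLinearMap.opNorm_nonneg (leftMulOn L b)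

theorem norm_leftMulOn_mul_le (hL : ∀ b : B, ∀ l ∈ L, b * l ∈ L) (a b : B) :
    ‖leftMulOn L (a * b)‖ ≤ ‖leftMulOn L a‖ * ‖leftMulOn L b‖ :=
  leftMulOn_le L _ (mul_nonneg (leftMulOn_nonneg L a) (leftMulOn_nonneg L b)) fun l hl => by
    rw [mul_assoc, mul_assoc]
    exact (norm_mul_le_leftMulOn L a (hL b l hl)).trans
      (mul_le_mul_of_nonneg_left (norm_mul_le_leftMulOn L b hl) (leftMulOn_nonneg L a))

/-- Expand ‖bl‖² = ‖l⋆ (b⋆b l)‖. Only the factor b⋆b l involves left multiplication on L, so l⋆ need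
not lie in L. -/
theorem norm_leftMulOn_sq_le (b : B) : ‖leftMulOn L b‖ ^ 2 ≤ ‖leftMulOn L (star b * b)‖ := by
  refine (Real.le_sqrt (leftMulOn_nonneg L b) (leftMulOn_nonneg L _)).1
    (leftMulOn_le L b (Real.sqrt_nonneg _) fun l hl => ?_)
  refine (sq_le_sq₀ (norm_nonneg _) (mul_nonneg (Real.sqrt_nonneg _) (norm_nonneg _))).1 ?_
  rw [mul_pow, Real.sq_sqrt (leftMulOn_nonneg L _)]
  calc ‖b * l‖ ^ 2 = ‖star (b * l) * (b * l)‖ := by rw [CStarRing.norm_star_mul_self, sq]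
    _ = ‖star l * ((star b * b) * l)‖ := by rw [star_mul, mul_assoc, mul_assoc]
    _ ≤ ‖star l‖ * ‖(star b * b) * l‖ := norm_mul_le _ _
    _ ≤ ‖l‖ * (‖leftMulOn L (star b * b)‖ * ‖l‖) := by
        rw [norm_star]
        exact mul_le_mul_of_nonneg_left (norm_mul_le_leftMulOn L _ hl) (norm_nonneg _)
    _ = _ := by ring

/-- The norm of left multiplication on a left ideal, as a C*-seminorm. -/
def leftIdeal (hL : ∀ b : B, ∀ l ∈ L, b * l ∈ L) : CStarSeminorm B where
  toFun b := ‖leftMulOn L b‖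
  map_zero' := le_antisymm (leftMulOn_le L _ le_rfl fun l _ => by simp) (leftMulOn_nonneg L _)
  add_le' a b := leftMulOn_le L _ (add_nonneg (leftMulOn_nonneg L a) (leftMulOn_nonneg L b))
    fun l hl => by
      rw [add_mul, add_mul]
      exact (norm_add_le _ _).trans
        (add_le_add (norm_mul_le_leftMulOn L a hl) (norm_mul_le_leftMulOn L b hl))
  neg' a := le_antisymm
    (leftMulOn_le L _ (leftMulOn_nonneg L a) fun l hl => by
      rw [neg_mul, norm_neg]; exact norm_mul_le_leftMulOn L a hl)
    (leftMulOn_le L _ (leftMulOn_nonneg L _) fun l hl => by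
      have h := norm_mul_le_leftMulOn L (-a) hl
      rwa [neg_mul, norm_neg] at h)
  smul' c a := by
    have h : ∀ (c : ℂ) (a : B), ‖leftMulOn L (c • a)‖ ≤ ‖c‖ * ‖leftMulOn L a‖ := fun c a =>
      leftMulOn_le L _ (mul_nonneg (norm_nonneg c) (leftMulOn_nonneg L a)) fun l hl => by
        rw [smul_mul_assoc, norm_smul, mul_assoc]
        exact mul_le_mul_of_nonneg_left (norm_mul_le_leftMulOn L a hl) (norm_nonneg c)
    refine le_antisymm (h c a) ?_
    rcases eq_or_ne c 0 with rfl | hc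
    · rw [norm_zero, zero_mul]
      exact leftMulOn_nonneg L _
    · have h1 := h c⁻¹ (c • a)
      rw [inv_smul_smul₀ hc, norm_inv] at h1
      have h2 := mul_le_mul_of_nonneg_left h1 (norm_nonneg c)
      rwa [mul_inv_cancel_left₀ (norm_ne_zero_iff.2 hc)] at h2
  mul_le' := norm_leftMulOn_mul_le L hL
  star_mul_self' b := by
    -- Combining ‖b‖² ≤ ‖b⋆b‖ with submultiplicativity makes the star isometric, which upgrades the
    -- inequality to the C*-identity.
    have hstar : ∀ b : B, ‖leftMulOn L b‖ ≤ ‖leftMulOn L (star b)‖ := fun b => by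
      have h := (norm_leftMulOn_sq_le L b).trans (norm_leftMulOn_mul_le L hL _ _)
      by_contra! hlt
      nlinarith [leftMulOn_nonneg L (star b), leftMulOn_nonneg L b]
    refine le_antisymm ((norm_leftMulOn_mul_le L hL _ _).trans ?_) (norm_leftMulOn_sq_le L b)
    have h := hstar (star b)
    rw [star_star] at h
    change _ ≤ ‖leftMulOn L b‖ ^ 2
    rw [sq]
    exact mul_le_mul_of_nonneg_right h (leftMulOn_nonneg L b)

end

theorem norm_mul_le_leftIdeal (L : Submodule ℂ B) (hL : ∀ b : B, ∀ l ∈ L, b * l ∈ L) (b : B)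
    {l : B} (hl : l ∈ L) : ‖b * l‖ ≤ leftIdeal L hL b * ‖l‖ :=
  norm_mul_le_leftMulOn L b hl

theorem leftIdeal_le (L : Submodule ℂ B) (hL : ∀ b : B, ∀ l ∈ L, b * l ∈ L) (b : B) {M : ℝ}
    (hM : 0 ≤ M) (h : ∀ l ∈ L, ‖b * l‖ ≤ M * ‖l‖) : leftIdeal L hL b ≤ M :=
  leftMulOn_le L b hM h

/-- A C*-norm on a C*-algebra is the norm. -/
theorem eq_norm_of_injective (q : CStarSeminorm B) (hq : ∀ b, q b = 0 → b = 0) (b : B) :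
    q b = ‖b‖ := by
  rw [← Completion.norm_of]
  -- An injective *-homomorphism between C*-algebras is isometric; here it is the map into the
  -- completion for q.
  refine NonUnitalStarAlgHom.norm_map (Completion.ofHom q)
    ((injective_iff_map_eq_zero (Completion.ofHom q)).2 fun a ha => hq a ?_) b
  rw [← Completion.norm_of]
  exact norm_eq_zero.2 ha

end LeftIdeal

section Banach

variable {A : Type*} [NonUnitalNormedRing A] [StarRing A] [NormedStarGroup A] [CompleteSpace A]
  [NormedSpace ℂ A] [IsScalarTower ℂ A A] [SMulCommClass ℂ A A] [StarModule ℂ A]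

theorem continuous_of (p : CStarSeminorm A) : Continuous (Completion.of p) :=
  AddMonoidHomClass.continuous_of_bound (Completion.ofHom p) 1 fun a => by
    rw [one_mul]
    exact (Completion.norm_of p a).le.trans (p.le_norm a)

/-- A C*-seminorm that dominates all C*-seminorms on a left ideal `S` such that `S S⋆` spans a dense
subspace dominates them everywhere. -/
theorem le_of_leftIdeal (P : CStarSeminorm A) (S : Submodule ℂ A)
    (hS : ∀ a : A, ∀ s ∈ S, a * s ∈ S)
    (hle : ∀ p : CStarSeminorm A, ∀ s ∈ S, p (star s * s) ≤ P (star s * s))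
    (hd : (Submodule.span ℂ {x | ∃ s ∈ S, ∃ t ∈ S, x = s * star t}).topologicalClosure = ⊤)
    (p : CStarSeminorm A) (a : A) : p a ≤ P a := by
  -- Passing to r = max(p, P) makes r dominate P everywhere while agreeing with P on S, since r(s)²
  -- = r(s⋆s) ≤ P(s⋆s) = P(s)².
  suffices h : p.sup P a ≤ P a by
    rw [sup_apply] at h
    exact (le_max_left _ _).trans h
  set r := p.sup P with hr
  have hPr : ∀ a, P a ≤ r a := fun a => by rw [hr, sup_apply]; exact le_max_right _ _
  have hrP : ∀ s ∈ S, r s ≤ P s := fun s hs => by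
    have h := hle r s hs
    rw [r.star_mul_self', P.star_mul_self'] at h
    exact (sq_le_sq₀ (r.nonneg s) (P.nonneg s)).1 h
  let ι : A →ₗ[ℂ] r.Completion :=
    { toFun := Completion.of r, map_add' := Completion.of_add r, map_smul' := Completion.of_smul r }
  let L : Submodule ℂ r.Completion := (S.map ι).topologicalClosure
  have hSL : ∀ s ∈ S, Completion.of r s ∈ L := fun s hs =>
    Submodule.le_topologicalClosure _ ⟨s, hs, rfl⟩
  have hLc : IsClosed (L : Set r.Completion) := Submodule.isClosed_topologicalClosure _
  have hLind : ∀ {C : r.Completion → Prop}, IsClosed {x | C x} →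
      (∀ s ∈ S, C (Completion.of r s)) → ∀ l ∈ L, C l := by
    intro C hC h l hl
    refine closure_minimal (t := {x | C x}) ?_ hC hl
    rintro _ ⟨s, hs, rfl⟩
    exact h s hs
  have hL : ∀ b : r.Completion, ∀ l ∈ L, b * l ∈ L := by
    intro b
    refine Completion.ind r (P := fun b => ∀ l ∈ L, b * l ∈ L) ?_ (fun a => ?_) b
    · simp only [Set.ofPred_forall]
      exact isClosed_iInter fun l => isClosed_iInter fun _ =>
        hLc.preimage (continuous_id.mul continuous_const)
    · refine hLind (hLc.preimage (continuous_const.mul continuous_id)) fun s hs => ?_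
      rw [← Completion.of_mul]
      exact hSL _ (hS a s hs)
  -- If b annihilates L, it annihilates all s t⋆ with s, t in S, hence everything by density,
  -- including b⋆; then b b⋆ = 0.
  have hinj : ∀ b, leftIdeal L hL b = 0 → b = 0 := by
    intro b hb
    have h1 : ∀ l ∈ L, b * l = 0 := fun l hl => by
      have h := norm_mul_le_leftIdeal L hL b hl
      rw [hb, zero_mul] at h
      exact norm_le_zero_iff.1 h
    let m : A →L[ℂ] r.Completion := (ContinuousLinearMap.mul ℂ r.Completion b) ∘L
      ⟨ι, continuous_of r⟩
    have h2 : ∀ x, m x = 0 := by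
      have h3 : (Submodule.span ℂ {x | ∃ s ∈ S, ∃ t ∈ S, x = s * star t}).topologicalClosure ≤
          LinearMap.ker (m : A →ₗ[ℂ] r.Completion) := by
        refine Submodule.topologicalClosure_minimal _ (Submodule.span_le.2 ?_)
          (isClosed_singleton.preimage m.continuous)
        rintro _ ⟨s, hs, t, ht, rfl⟩
        change b * Completion.of r (s * star t) = 0
        rw [Completion.of_mul, ← mul_assoc, h1 _ (hSL s hs), zero_mul]
      rw [hd] at h3
      exact fun x => h3 Submodule.mem_top
    have h4 : ∀ x : r.Completion, b * x = 0 :=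
      Completion.ind r (isClosed_eq (continuous_const.mul continuous_id) continuous_const) h2
    have h5 := h4 (star b)
    exact CStarRing.mul_star_self_eq_zero_iff b |>.1 h5
  -- Now r(a) is the norm of left multiplication by a on L, and on S one has r(as) ≤ P(as) ≤ P(a)
  -- P(s) ≤ P(a) r(s).
  have h1 := eq_norm_of_injective (leftIdeal L hL) hinj (Completion.of r a)
  rw [← Completion.norm_of, ← h1]
  refine leftIdeal_le L hL _ (P.nonneg a) (hLind (isClosed_le
    (continuous_const.mul continuous_id).norm (continuous_const.mul continuous_norm))
    fun s hs => ?_)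
  rw [← Completion.of_mul, Completion.norm_of, Completion.norm_of]
  exact (hrP _ (hS a s hs)).trans ((P.mul_le' a s).trans
    (mul_le_mul_of_nonneg_left (hPr s) (P.nonneg a)))

end Banach

end CStarSeminorm

/-! ### Universal maps out of the C*-completions -/

namespace CStarSeminorm

section Enveloping

variable {A : Type*} [NonUnitalRing A] [StarRing A] [Module ℂ A]
  {C : Type*} [NonUnitalCStarAlgebra C]

theorem isometry_of_norm_eq (p : CStarSeminorm A) (Φ : A →⋆ₙₐ[ℂ] C) (h : ∀ a, ‖Φ a‖ = p a) :
    Isometry (fun a : p.Pre => (Φ (show A from a) : C)) :=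
  Isometry.of_dist_eq fun a b => by
    rw [dist_eq_norm, dist_eq_norm, norm_pre, ← map_sub]
    exact h _

/-- A *-homomorphism into a C*-algebra that induces `p` extends to the completion for `p`. -/
def Completion.lift (p : CStarSeminorm A) (Φ : A →⋆ₙₐ[ℂ] C) (h : ∀ a, ‖Φ a‖ = p a) :
    p.Completion →⋆ₙₐ[ℂ] C :=
  let e : p.Completion → C :=
    UniformSpace.Completion.extension (α := p.Pre) fun a => Φ (show A from a)
  have he : ∀ a, e (of p a) = Φ a :=
    UniformSpace.Completion.extension_coe (α := p.Pre) (isometry_of_norm_eq p Φ h).uniformContinuous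
  have hc : Continuous e := UniformSpace.Completion.continuous_extension
  { toFun := e
    map_zero' := by rw [← of_zero p, he, map_zero]
    map_smul' := fun c => ind p (isClosed_eq (hc.comp (continuous_const_smul c))
      ((continuous_const_smul c).comp hc)) fun a => by
        rw [← of_smul, he, he, map_smul]; rfl
    map_add' := ind₂ p (isClosed_eq (hc.comp continuous_add)
      ((hc.comp continuous_fst).add (hc.comp continuous_snd))) fun a b => by
        rw [← of_add, he, he, he, map_add]
    map_mul' := ind₂ p (isClosed_eq (hc.comp continuous_mul)
      ((hc.comp continuous_fst).mul (hc.comp continuous_snd))) fun a b => by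
        rw [← of_mul, he, he, he, map_mul]
    map_star' := ind p (isClosed_eq (hc.comp continuous_star)
      (continuous_star.comp hc)) fun a => by
        rw [← of_star, he, he, map_star] }

theorem Completion.lift_of (p : CStarSeminorm A) (Φ : A →⋆ₙₐ[ℂ] C) (h : ∀ a, ‖Φ a‖ = p a) (a : A) :
    Completion.lift p Φ h (of p a) = Φ a :=
  UniformSpace.Completion.extension_coe (α := p.Pre)
    (isometry_of_norm_eq p Φ h).uniformContinuous a

theorem Completion.continuous_lift (p : CStarSeminorm A) (Φ : A →⋆ₙₐ[ℂ] C)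
    (h : ∀ a, ‖Φ a‖ = p a) : Continuous (Completion.lift p Φ h) :=
  UniformSpace.Completion.continuous_extension (α := p.Pre)

theorem Completion.norm_lift (p : CStarSeminorm A) (Φ : A →⋆ₙₐ[ℂ] C)
    (h : ∀ a, ‖Φ a‖ = p a) (x : p.Completion) : ‖Completion.lift p Φ h x‖ = ‖x‖ :=
  ind p (isClosed_eq (continuous_lift p Φ h).norm continuous_norm)
    (fun a => by rw [lift_of, h, norm_of]) x

/-- The extension is an isometry of a complete space, so its range is closed; it also contains the
dense range of Φ. -/
theorem Completion.bijective_lift (p : CStarSeminorm A) (Φ : A →⋆ₙₐ[ℂ] C)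
    (h : ∀ a, ‖Φ a‖ = p a) (hd : DenseRange Φ) : Function.Bijective (Completion.lift p Φ h) := by
  have hi : Isometry (Completion.lift p Φ h) :=
    AddMonoidHomClass.isometry_of_norm _ (norm_lift p Φ h)
  refine ⟨hi.injective, fun c => ?_⟩
  have h1 : IsClosed (Set.range (Completion.lift p Φ h)) := hi.isClosedEmbedding.isClosed_range
  refine closure_minimal (s := Set.range Φ) ?_ h1 (hd c)
  rintro _ ⟨a, rfl⟩
  exact ⟨of p a, lift_of p Φ h a⟩

end Enveloping

section Banach

variable {A : Type*} [NonUnitalNormedRing A] [StarRing A] [NormedStarGroup A] [CompleteSpace A]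
  [NormedSpace ℂ A] [IsScalarTower ℂ A A] [SMulCommClass ℂ A A] [StarModule ℂ A]
  {C : Type*} [NonUnitalCStarAlgebra C]

/-- A *-homomorphism with dense range into a C*-algebra whose norm dominates all C*-seminorms
identifies that C*-algebra with the enveloping C*-algebra. -/
theorem exists_equiv_of_forall_le (Φ : A →⋆ₙₐ[ℂ] C) (hd : DenseRange Φ)
    (h : ∀ (p : CStarSeminorm A) (a : A), p a ≤ ‖Φ a‖) :
    ∃ e : EnvelopingCStarAlgebra A ≃⋆ₐ[ℂ] C, ∀ a, e (EnvelopingCStarAlgebra.of A a) = Φ a := by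
  have hn : ∀ a, ‖Φ a‖ = maxCStarSeminorm A a := fun a =>
    le_antisymm (le_maxCStarSeminorm (ofHom Φ) a) (ciSup_le fun p => h p a)
  exact ⟨StarAlgEquiv.ofBijective (Completion.lift _ Φ hn) (Completion.bijective_lift _ Φ hn hd),
    Completion.lift_of _ Φ hn⟩

end Banach

/-! ### C*-seminorms on commutative *-algebras -/

section Commutative

variable {A : Type*} [NonUnitalRing A] [StarRing A] [Module ℂ A]

theorem Completion.mul_comm_of (q : CStarSeminorm A) (hcomm : ∀ a b : A, a * b = b * a)
    (x y : q.Completion) : x * y = y * x :=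
  ind₂ q (P := fun x y => x * y = y * x) (isClosed_eq (by fun_prop) (by fun_prop))
    (fun a b => by rw [← of_mul, ← of_mul, hcomm]) x y

variable [StarModule ℂ A] [IsScalarTower ℂ A A] [SMulCommClass ℂ A A]

/-- On a commutative *-algebra every C*-seminorm is attained by a *-character it dominates. -/
theorem exists_character (q : CStarSeminorm A) (hcomm : ∀ a b : A, a * b = b * a) (u : A) :
    ∃ χ : A →⋆ₙₐ[ℂ] ℂ, q u ≤ ‖χ u‖ ∧ ∀ a, ‖χ a‖ ≤ q a := by
  let _ : NonUnitalCommCStarAlgebra q.Completion :=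
    { (inferInstance : NonUnitalCStarAlgebra q.Completion) with
      mul_comm := Completion.mul_comm_of q hcomm }
  let ι : A →⋆ₙₐ[ℂ] Unitization ℂ q.Completion :=
    (Unitization.inrNonUnitalStarAlgHom ℂ q.Completion).comp (Completion.ofHom q)
  have hι : ∀ a, ‖ι a‖ = q a := fun a => by
    change ‖((Completion.of q a : q.Completion) : Unitization ℂ q.Completion)‖ = _
    rw [Unitization.norm_inr, Completion.norm_of]
  -- Gelfand theory in the unitised completion: the norm of a normal element is attained on its
  -- spectrum, and each spectral value is the value of a character.
  obtain ⟨z, hz, hzr⟩ := spectrum.exists_nnnorm_eq_spectralRadius (ι u)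
  have hn : IsStarNormal (ι u) := ⟨mul_comm _ _⟩
  rw [hn.spectralRadius_eq_nnnorm] at hzr
  obtain ⟨φ, hφ⟩ := WeakDual.CharacterSpace.mem_spectrum_iff_exists.1 hz
  let ψ : Unitization ℂ q.Completion →⋆ₙₐ[ℂ] ℂ :=
    { (φ : Unitization ℂ q.Completion →ₙₐ[ℂ] ℂ) with
      map_star' := fun a => map_star φ a }
  refine ⟨ψ.comp ι, ?_, fun a => ?_⟩
  · rw [← hι]
    have h1 : ‖z‖₊ = ‖ι u‖₊ := by exact_mod_cast hzr
    have h2 : ‖z‖ = ‖ι u‖ := congrArg NNReal.toReal h1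
    rw [← h2, ← hφ]
    rfl
  · rw [← hι]
    exact NonUnitalStarAlgHom.norm_apply_le ψ (ι a)

end Commutative

end CStarSeminorm

/-! ## Density in spaces of functions vanishing at infinity -/

namespace ZeroAtInftyContinuousMap

section

variable {X Y : Type*} [TopologicalSpace X] [TopologicalSpace Y]
  {V : Type*} [NormedAddCommGroup V]

theorem norm_apply_le (f : C₀(X, V)) (x : X) : ‖f x‖ ≤ ‖f‖ :=
  BoundedContinuousFunction.norm_coe_le_norm f.toBCF x

theorem norm_le_of_forall {f : C₀(X, V)} {C : ℝ} (hC : 0 ≤ C) (h : ∀ x, ‖f x‖ ≤ C) : ‖f‖ ≤ C :=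
  (BoundedContinuousFunction.norm_le (f := f.toBCF) hC).2 h

theorem isCompact_setOf_le_norm (f : C₀(X, V)) {ε : ℝ} (hε : 0 < ε) :
    IsCompact {x | ε ≤ ‖f x‖} := by
  have h := (zero_at_infty f).norm
  rw [norm_zero] at h
  obtain ⟨t, ht, hts⟩ := mem_cocompact.1 (h.eventually_lt_const hε)
  refine ht.of_isClosed_subset (isClosed_le continuous_const (map_continuous f).norm) fun x hx => ?_
  by_contra hxt
  exact absurd (show ‖f x‖ < ε from hts hxt) (not_lt.2 hx)

variable [NormedSpace ℂ V]

/-- Evaluation at a point. -/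
def evalCLM (x : X) : C₀(X, V) →L[ℂ] V :=
  LinearMap.mkContinuous
    { toFun := fun f => f x
      map_add' := fun _ _ => rfl
      map_smul' := fun _ _ => rfl } 1 fun f => by
      rw [one_mul]
      exact norm_apply_le f x

/-- The product of a bounded continuous function and a function vanishing at infinity. -/
def bsmul (k : BoundedContinuousFunction X ℂ) (f : C₀(X, V)) : C₀(X, V) where
  toFun x := k x • f x
  continuous_toFun := k.continuous.smul (map_continuous f)
  zero_at_infty' := by
    refine squeeze_zero_norm (a := fun x => ‖k‖ * ‖f x‖) (fun x => ?_) ?_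
    · rw [norm_smul]
      exact mul_le_mul_of_nonneg_right (k.norm_coe_le_norm x) (norm_nonneg _)
    · simpa using (zero_at_infty f).norm.const_mul ‖k‖

/-- The function `x ↦ k x • v`. -/
def smulConst (k : C₀(X, ℂ)) (v : V) : C₀(X, V) where
  toFun x := k x • v
  continuous_toFun := (map_continuous k).smul continuous_const
  zero_at_infty' := by simpa using (zero_at_infty k).smul_const v

/-- The map `k ↦ k • v`. -/
def smulConstCLM (v : V) : C₀(X, ℂ) →L[ℂ] C₀(X, V) :=
  LinearMap.mkContinuous
    { toFun := fun k => smulConst k v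
      map_add' := fun k l => ext fun x => add_smul (k x) (l x) v
      map_smul' := fun c k => ext fun x => smul_assoc c (k x) v } ‖v‖ fun k =>
    norm_le_of_forall (by positivity) fun x => by
      change ‖k x • v‖ ≤ _
      rw [norm_smul, mul_comm]
      exact mul_le_mul_of_nonneg_left (norm_apply_le k x) (norm_nonneg _)

/-- A continuous compactly supported function, as a function vanishing at infinity. -/
def ofCompactSupport (k : C(X, ℝ)) (hk : HasCompactSupport k) : C₀(X, ℂ) where
  toFun x := (k x : ℂ)
  continuous_toFun := Complex.continuous_ofReal.comp k.continuous
  zero_at_infty' := by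
    refine tendsto_const_nhds.congr' ?_
    filter_upwards [hk.isCompact.compl_mem_cocompact] with x hx
    rw [image_eq_zero_of_notMem_tsupport hx, Complex.ofReal_zero]

theorem ofCompactSupport_apply (k : C(X, ℝ)) (hk : HasCompactSupport k) (x : X) :
    ofCompactSupport k hk x = (k x : ℂ) := rfl

theorem exists_apply_eq_one [T2Space X] [LocallyCompactSpace X] (x : X) :
    ∃ k : C₀(X, ℂ), k x = 1 := by
  obtain ⟨f, hf, -, hc, -⟩ := exists_continuous_one_zero_of_isCompact (isCompact_singleton (x := x))
    isClosed_empty (Set.disjoint_empty _)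
  exact ⟨ofCompactSupport f hc, by rw [ofCompactSupport_apply, hf rfl]; simp⟩

/-- A closed space of functions on `X` vanishing at infinity, stable under multiplication by
functions on `Y`, contains every function that it approximates on the fibres of `X → Y`. -/
theorem mem_of_forall_fiber [T2Space Y] [LocallyCompactSpace Y] (π : C(X, Y))
    {W : Submodule ℂ C₀(X, V)} (hW : IsClosed (W : Set C₀(X, V)))
    (hs : ∀ k : C₀(Y, ℂ), ∀ w ∈ W, bsmul (k.toBCF.compContinuous π) w ∈ W) (f : C₀(X, V))
    (h : ∀ y, ∀ ε > 0, ∃ w ∈ W, ∀ x, π x = y → ‖w x - f x‖ < ε) : f ∈ W := by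
  refine hW.closure_subset (Metric.mem_closure_iff.2 fun δ hδ => ?_)
  obtain ⟨ε, hε, hεδ⟩ := exists_between hδ
  have hK : IsCompact (π '' {x | ε ≤ ‖f x‖}) := (isCompact_setOf_le_norm f hε).image π.continuous
  choose w hw hwf using fun y => h y ε hε
  -- Here w(y) is ε-close to f on entire fibres. The set is open because the excluded part is the
  -- image of a compact set, w(y) - f being small at infinity.
  let U : Y → Set Y := fun y => (π '' {x | ε ≤ ‖(w y - f) x‖})ᶜ
  have hU : ∀ y, IsOpen (U y) := fun y =>
    ((isCompact_setOf_le_norm (w y - f) hε).image π.continuous).isClosed.isOpen_compl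
  obtain ⟨t, ht⟩ := hK.elim_finite_subcover U hU fun y _ => Set.mem_iUnion.2 ⟨y, by
    rintro ⟨x, hx, hxy⟩
    exact absurd (hwf y x hxy) (not_lt.2 hx)⟩
  have ht' : π '' {x | ε ≤ ‖f x‖} ⊆ ⋃ i : t, U i := fun y hy => by
    obtain ⟨z, hz, hyz⟩ := Set.mem_iUnion₂.1 (ht hy)
    exact Set.mem_iUnion.2 ⟨⟨z, hz⟩, hyz⟩
  obtain ⟨ρ, hρs, hρc⟩ := PartitionOfUnity.exists_isSubordinate_of_locallyFinite_t2space hK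
    (fun i : t => U i) (fun i => hU i) (locallyFinite_of_finite _) ht'
  let k : t → C₀(Y, ℂ) := fun i => ofCompactSupport (ρ i) (hρc i)
  refine ⟨∑ i : t, bsmul ((k i).toBCF.compContinuous π) (w i),
    W.sum_mem fun i _ => hs _ _ (hw _), ?_⟩
  rw [dist_eq_norm]
  refine (norm_le_of_forall hε.le fun x => ?_).trans_lt hεδ
  have hsum : ∑ i : t, ρ i (π x) ≤ 1 := by
    have h := ρ.sum_le_one (π x)
    rwa [finsum_eq_sum_of_fintype] at h
  -- The error is a subconvex combination: the weight 1 - Σρ meets f only where ‖f‖ < ε, and each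
  -- ρ_i meets w_i - f only over U_i, where this difference is below ε.
  have h1 : (f - ∑ i : t, bsmul ((k i).toBCF.compContinuous π) (w i)) x =
      ((1 - ∑ i : t, ρ i (π x) : ℝ) : ℂ) • f x - ∑ i : t, ((ρ i (π x) : ℝ) : ℂ) • (w i - f) x := by
    have h2 : (∑ i : t, bsmul ((k i).toBCF.compContinuous π) (w i)) x =
        ∑ i : t, ((ρ i (π x) : ℝ) : ℂ) • w i x :=
      map_sum (evalCLM x) _ _
    rw [sub_apply, h2]
    simp only [sub_apply, smul_sub, Finset.sum_sub_distrib, ← Finset.sum_smul]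
    push_cast
    rw [sub_smul, one_smul]
    abel
  have h2 : ‖((1 - ∑ i : t, ρ i (π x) : ℝ) : ℂ) • f x‖ ≤ (1 - ∑ i : t, ρ i (π x)) * ε := by
    rw [norm_smul, Complex.norm_real, Real.norm_of_nonneg (by linarith)]
    rcases lt_or_ge ‖f x‖ ε with hx | hx
    · exact mul_le_mul_of_nonneg_left hx.le (by linarith)
    · have h := ρ.sum_eq_one (Set.mem_image_of_mem π (show x ∈ {x | ε ≤ ‖f x‖} from hx))
      rw [finsum_eq_sum_of_fintype] at h
      rw [h]
      simp
  have h3 : ‖∑ i : t, ((ρ i (π x) : ℝ) : ℂ) • (w i - f) x‖ ≤ (∑ i : t, ρ i (π x)) * ε := by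
    rw [Finset.sum_mul]
    refine norm_sum_le_of_le _ fun i _ => ?_
    rw [norm_smul, Complex.norm_real, Real.norm_of_nonneg (ρ.nonneg i _)]
    rcases eq_or_ne (ρ i (π x)) 0 with h0 | h0
    · rw [h0, zero_mul, zero_mul]
    · have hx : π x ∈ U i := hρs i (subset_tsupport _ h0)
      refine mul_le_mul_of_nonneg_left (le_of_lt ?_) (ρ.nonneg i _)
      by_contra! hlt
      exact hx ⟨x, hlt, rfl⟩
  rw [h1]
  exact (norm_sub_le _ _).trans ((add_le_add h2 h3).trans_eq (by ring))

/-- Multiplication by a bounded continuous function, as a continuous linear map. -/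
def bsmulCLM (k : BoundedContinuousFunction X ℂ) : C₀(X, V) →L[ℂ] C₀(X, V) :=
  LinearMap.mkContinuous
    { toFun := bsmul k
      map_add' := fun f g => ext fun x => smul_add (k x) (f x) (g x)
      map_smul' := fun c f => ext fun x => smul_comm (k x) c (f x) } ‖k‖ fun f =>
    norm_le_of_forall (by positivity) fun x => by
      change ‖k x • f x‖ ≤ _
      rw [norm_smul]
      exact mul_le_mul (k.norm_coe_le_norm x) (norm_apply_le f x) (norm_nonneg _) (norm_nonneg _)

/-- The closed span of a set that is stable under multiplication by `k` is stable as well. -/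
theorem bsmul_mem_closure_span {k : BoundedContinuousFunction X ℂ} {S : Set C₀(X, V)}
    (hS : ∀ s ∈ S, bsmul k s ∈ S) {w : C₀(X, V)}
    (hw : w ∈ (Submodule.span ℂ S).topologicalClosure) :
    bsmul k w ∈ (Submodule.span ℂ S).topologicalClosure := by
  have h : (Submodule.span ℂ S).topologicalClosure ≤
      (Submodule.span ℂ S).topologicalClosure.comap (bsmulCLM k).toLinearMap :=
    Submodule.topologicalClosure_minimal _ (Submodule.span_le.2 fun s hs =>
      Submodule.le_topologicalClosure _ (Submodule.subset_span (hS s hs)))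
      ((Submodule.isClosed_topologicalClosure _).preimage (bsmulCLM k).continuous)
  exact h hw

theorem exists_norm_sub_lt_of_closure_eq_top {E : Type*} [NormedAddCommGroup E] [NormedSpace ℂ E]
    {M : Submodule ℂ E} (h : M.topologicalClosure = ⊤) (v : E) {ε : ℝ} (hε : 0 < ε) :
    ∃ m ∈ M, ‖m - v‖ < ε := by
  have hv : v ∈ closure (M : Set E) := by
    rw [← Submodule.topologicalClosure_coe, h]
    trivial
  obtain ⟨m, hm, hmv⟩ := Metric.mem_closure_iff.1 hv ε hε
  exact ⟨m, hm, by rwa [dist_comm, dist_eq_norm] at hmv⟩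

/-- The fibrewise criterion for the identity map: a closed C₀(X)-submodule with dense evaluations is
everything. -/
theorem eq_top_of_forall_eval [T2Space X] [LocallyCompactSpace X]
    {W : Submodule ℂ C₀(X, V)} (hW : IsClosed (W : Set C₀(X, V)))
    (hs : ∀ k : C₀(X, ℂ), ∀ w ∈ W, bsmul k.toBCF w ∈ W)
    (h : ∀ x, (W.map (evalCLM (V := V) x).toLinearMap).topologicalClosure = ⊤) : W = ⊤ := by
  refine eq_top_iff.2 fun f _ => mem_of_forall_fiber (ContinuousMap.id X) hW hs f fun y ε hε => ?_
  obtain ⟨_, ⟨w, hw, rfl⟩, hwf⟩ := exists_norm_sub_lt_of_closure_eq_top (h y) (f y) hε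
  exact ⟨w, hw, fun x hx => by
    obtain rfl : x = y := hx
    exact hwf⟩

/-- The functions `k • v`, with `v` in a total set, are total in `C₀(X, V)`. -/
theorem eq_top_of_smulConst_mem [T2Space X] [LocallyCompactSpace X] {T : Set V}
    (hT : (Submodule.span ℂ T).topologicalClosure = ⊤)
    {W : Submodule ℂ C₀(X, V)} (hW : IsClosed (W : Set C₀(X, V)))
    (h : ∀ k : C₀(X, ℂ), ∀ v ∈ T, smulConst k v ∈ W) : W = ⊤ := by
  -- W is not assumed stable under multiplication by functions, but the closed span of these
  -- generators is, so the criterion is applied to that span inside W.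
  let S : Set C₀(X, V) := {f | ∃ k : C₀(X, ℂ), ∃ v ∈ T, f = smulConst k v}
  have hSW : (Submodule.span ℂ S).topologicalClosure ≤ W :=
    Submodule.topologicalClosure_minimal _ (Submodule.span_le.2 fun f hf => by
      obtain ⟨k, v, hv, rfl⟩ := hf
      exact h k v hv) hW
  rw [eq_top_iff]
  refine le_trans (le_of_eq ?_) hSW
  refine (eq_top_of_forall_eval (Submodule.isClosed_topologicalClosure _) (fun k w hw =>
    bsmul_mem_closure_span ?_ hw) fun x => ?_).symm
  · rintro _ ⟨l, v, hv, rfl⟩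
    refine ⟨k * l, v, hv, ext fun x => ?_⟩
    exact (mul_smul (k x) (l x) v).symm
  · obtain ⟨k, hk⟩ := exists_apply_eq_one x
    rw [eq_top_iff, ← hT]
    refine Submodule.topologicalClosure_mono (Submodule.span_le.2 fun v hv => ?_)
    refine ⟨smulConst k v, Submodule.le_topologicalClosure _ (Submodule.subset_span
      ⟨k, v, hv, rfl⟩), ?_⟩
    change k x • v = v
    rw [hk, one_smul]

/-! ### Functions on a product space -/

variable {Z : Type*} [TopologicalSpace Z]

/-- The inclusion of a fibre of a product. -/
def fiberInclusion [T1Space Y] (y : Y) : CocompactMap Z (Y × Z) where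
  toFun z := (y, z)
  continuous_toFun := by fun_prop
  cocompact_tendsto' := by
    refine Topology.IsClosedEmbedding.tendsto_cocompact ⟨⟨?_, fun a b h => (Prod.ext_iff.1 h).2⟩, ?_⟩
    · exact (Topology.IsInducing.of_comp (g := Prod.snd) (by fun_prop) continuous_snd
        Topology.IsInducing.id)
    · have : Set.range (fun z : Z => (y, z)) = Prod.fst ⁻¹' {y} := by
        ext p
        exact ⟨fun ⟨z, hz⟩ => hz ▸ rfl, fun hp => ⟨p.2, Prod.ext (Eq.symm hp) rfl⟩⟩
      rw [this]
      exact isClosed_singleton.preimage continuous_fst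

/-- Restriction to a fibre of a product. -/
def fiberCLM [T1Space Y] (y : Y) : C₀(Y × Z, V) →L[ℂ] C₀(Z, V) :=
  LinearMap.mkContinuous
    { toFun := fun f => f.comp (fiberInclusion y)
      map_add' := fun _ _ => rfl
      map_smul' := fun _ _ => rfl } 1 fun f => by
      rw [one_mul]
      exact norm_le_of_forall (norm_nonneg _) fun z => norm_apply_le f (y, z)

/-- The function `(y, z) ↦ k y • f z`. -/
def prodSMul (k : C₀(Y, ℂ)) (f : C₀(Z, V)) : C₀(Y × Z, V) where
  toFun x := k x.1 • f x.2
  continuous_toFun := by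
    have h1 := map_continuous k
    have h2 := map_continuous f
    fun_prop
  zero_at_infty' := by
    -- A point of the product leaves all compact sets when one coordinate does; each case uses decay
    -- of one factor and boundedness of the other.
    rw [← coprod_cocompact, Filter.coprod, tendsto_sup]
    constructor
    · refine squeeze_zero_norm (a := fun x : Y × Z => ‖k x.1‖ * ‖f‖) (fun x => ?_) ?_
      · rw [norm_smul]
        exact mul_le_mul_of_nonneg_left (norm_apply_le f _) (norm_nonneg _)
      · simpa using ((zero_at_infty k).comp (tendsto_comap (f := Prod.fst))).norm.mul_const ‖f‖
    · refine squeeze_zero_norm (a := fun x : Y × Z => ‖k‖ * ‖f x.2‖) (fun x => ?_) ?_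
      · rw [norm_smul]
        exact mul_le_mul_of_nonneg_right (norm_apply_le k _) (norm_nonneg _)
      · simpa using ((zero_at_infty f).comp (tendsto_comap (f := Prod.snd))).norm.const_mul ‖k‖

/-- The functions `(y, z) ↦ k y • f z`, with `f` in a total set, are total in `C₀(Y × Z, V)`. -/
theorem eq_top_of_prodSMul_mem [T2Space Y] [LocallyCompactSpace Y] {T : Set C₀(Z, V)}
    (hT : (Submodule.span ℂ T).topologicalClosure = ⊤)
    {W : Submodule ℂ C₀(Y × Z, V)} (hW : IsClosed (W : Set C₀(Y × Z, V)))
    (h : ∀ k : C₀(Y, ℂ), ∀ f ∈ T, prodSMul k f ∈ W) : W = ⊤ := by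
  let S : Set C₀(Y × Z, V) := {g | ∃ k : C₀(Y, ℂ), ∃ f ∈ T, g = prodSMul k f}
  have hSW : (Submodule.span ℂ S).topologicalClosure ≤ W :=
    Submodule.topologicalClosure_minimal _ (Submodule.span_le.2 fun f hf => by
      obtain ⟨k, v, hv, rfl⟩ := hf
      exact h k v hv) hW
  refine eq_top_iff.2 fun f _ => hSW (mem_of_forall_fiber ⟨Prod.fst, continuous_fst⟩
    (Submodule.isClosed_topologicalClosure _) (fun k w hw => bsmul_mem_closure_span ?_ hw) f
    fun y ε hε => ?_)
  · rintro _ ⟨l, v, hv, rfl⟩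
    refine ⟨k * l, v, hv, ext fun x => ?_⟩
    exact (mul_smul (k x.1) (l x.1) (v x.2)).symm
  · obtain ⟨k, hk⟩ := exists_apply_eq_one y
    obtain ⟨m, hm, hmf⟩ := exists_norm_sub_lt_of_closure_eq_top hT (fiberCLM y f) hε
    have h1 : Submodule.span ℂ T ≤ (Submodule.span ℂ S).map
        (fiberCLM (Z := Z) (V := V) y).toLinearMap := Submodule.span_le.2 fun t ht => by
      refine ⟨prodSMul k t, Submodule.subset_span ⟨k, t, ht, rfl⟩, ext fun z => ?_⟩
      change k y • t z = t z
      rw [hk, one_smul]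
    obtain ⟨w, hw, rfl⟩ := h1 hm
    refine ⟨w, Submodule.le_topologicalClosure _ hw, ?_⟩
    rintro ⟨x, z⟩ rfl
    exact (norm_apply_le (fiberCLM x w - fiberCLM x f) z).trans_lt hmf

/-- A bounded family of linear maps `E → V` that gives functions vanishing at
infinity on a total set does so everywhere. -/
theorem exists_of_total {E : Type*} [NormedAddCommGroup E] [NormedSpace ℂ E]
    (L : E →ₗ[ℂ] X → V) (hL : ∀ f x, ‖L f x‖ ≤ ‖f‖) {S : Set E}
    (hS : (Submodule.span ℂ S).topologicalClosure = ⊤)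
    (h : ∀ s ∈ S, ∃ g : C₀(X, V), ∀ x, g x = L s x) (f : E) : ∃ g : C₀(X, V), ∀ x, g x = L f x := by
  have h1 : ∀ s ∈ Submodule.span ℂ S, ∃ g : C₀(X, V), ∀ x, g x = L s x := fun s hs => by
    induction hs using Submodule.span_induction with
    | mem s hs => exact h s hs
    | zero => exact ⟨0, fun x => by rw [map_zero]; rfl⟩
    | add a b _ _ ha hb =>
      obtain ⟨g, hg⟩ := ha
      obtain ⟨g', hg'⟩ := hb
      exact ⟨g + g', fun x => by rw [map_add, add_apply, hg, hg']; rfl⟩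
    | smul c a _ ha =>
      obtain ⟨g, hg⟩ := ha
      exact ⟨c • g, fun x => by rw [map_smul, smul_apply, hg]; rfl⟩
  have h2 : ∀ ε > 0, ∃ g : C₀(X, V), ∀ x, ‖g x - L f x‖ < ε := fun ε hε => by
    obtain ⟨m, hm, hmf⟩ := exists_norm_sub_lt_of_closure_eq_top hS f hε
    obtain ⟨g, hg⟩ := h1 m hm
    refine ⟨g, fun x => ?_⟩
    rw [hg, ← Pi.sub_apply, ← map_sub]
    exact (hL _ _).trans_lt hmf
  -- Continuity and decay at infinity both survive the uniform approximations of `h2`.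
  refine ⟨⟨⟨L f, ?_⟩, ?_⟩, fun x => rfl⟩
  · refine continuous_of_uniform_approx_of_continuous fun u hu => ?_
    obtain ⟨ε, hε, hεu⟩ := Metric.mem_uniformity_dist.1 hu
    obtain ⟨g, hg⟩ := h2 ε hε
    exact ⟨g, map_continuous g, fun x => hεu (by
      rw [dist_comm, dist_eq_norm]
      exact hg x)⟩
  · refine Metric.tendsto_nhds.2 fun ε hε => ?_
    obtain ⟨g, hg⟩ := h2 (ε / 2) (half_pos hε)
    filter_upwards [Metric.tendsto_nhds.1 (zero_at_infty g) (ε / 2) (half_pos hε)] with x hx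
    rw [dist_zero_right] at hx ⊢
    change ‖L f x‖ < ε
    have := hg x
    have h3 : L f x = g x - (g x - L f x) := by abel
    rw [h3]
    exact (norm_sub_le _ _).trans_lt (by linarith)

end

end ZeroAtInftyContinuousMap

section

open scoped RealInnerProductSpace

/-! ## The decomposition `ℝ⁴ = ℝ² ⊕ ℝ²` -/

/-- The component `α_q` of `α = α_q ⊕ α_c`. -/
def qPart (α : EuclideanSpace ℝ (Fin 4)) : Plane := !₂[α 0, α 1]

/-- The component `α_c` of `α = α_q ⊕ α_c`. -/
def cPart (α : EuclideanSpace ℝ (Fin 4)) : Plane := !₂[α 2, α 3]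

theorem qPart_directSum (a b : Plane) : qPart (directSum a b) = a := by
  ext i; fin_cases i <;> rfl

theorem cPart_directSum (a b : Plane) : cPart (directSum a b) = b := by
  ext i; fin_cases i <;> rfl

theorem directSum_qPart_cPart (α : EuclideanSpace ℝ (Fin 4)) :
    directSum (qPart α) (cPart α) = α := by
  ext i; fin_cases i <;> rfl

theorem directSum_add (a b a' b' : Plane) :
    directSum (a + a') (b + b') = directSum a b + directSum a' b' := by
  ext i; fin_cases i <;> rfl

theorem directSum_sub (a b a' b' : Plane) :
    directSum a b - directSum a' b' = directSum (a - a') (b - b') := by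
  ext i; fin_cases i <;> rfl

theorem directSum_neg (a b : Plane) : -directSum a b = directSum (-a) (-b) := by
  ext i; fin_cases i <;> rfl

theorem norm_sq_directSum (a b : Plane) : ‖directSum a b‖ ^ 2 = ‖a‖ ^ 2 + ‖b‖ ^ 2 := by
  rw [norm_sq_plane, norm_sq_plane, EuclideanSpace.norm_sq_eq, Fin.sum_univ_four]
  simp only [Real.norm_eq_abs, sq_abs]
  simp [directSum]
  ring

theorem inner_directSum (a b : Plane) (x : EuclideanSpace ℝ (Fin 4)) :
    ⟪x, directSum a b⟫ = ⟪qPart x, a⟫ + ⟪cPart x, b⟫ := by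
  rw [inner_plane, inner_plane, PiLp.inner_apply, Fin.sum_univ_four]
  simp [directSum, qPart, cPart]
  ring

theorem formStd_phase (a b a' b' : Plane) :
    formStd.phase (directSum a b) (directSum a' b') = formJ.phase a a' := by
  rw [formJ_phase, SkewForm.phase]
  congr 3
  simp [SkewForm.pairing, formStd, Fin.sum_univ_four, directSum]
  ring

/-- The isometry `ℝ² ⊕ ℝ² ≃ ℝ⁴`. -/
def directSumIso : WithLp 2 (Plane × Plane) ≃ₗᵢ[ℝ] EuclideanSpace ℝ (Fin 4) where
  toFun p := directSum p.fst p.snd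
  invFun α := WithLp.toLp 2 (qPart α, cPart α)
  map_add' p q := directSum_add _ _ _ _
  map_smul' c p := by ext i; fin_cases i <;> rfl
  left_inv p := by
    apply (WithLp.equiv 2 (Plane × Plane)).injective
    exact Prod.ext (qPart_directSum _ _) (cPart_directSum _ _)
  right_inv α := directSum_qPart_cPart α
  norm_map' p := by
    refine (sq_eq_sq₀ (norm_nonneg _) (norm_nonneg _)).1 ?_
    rw [WithLp.prod_norm_sq_eq_of_L2]
    exact norm_sq_directSum _ _

/-- The measurable equivalence `ℝ² × ℝ² ≃ ℝ⁴`. -/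
def directSumEquiv : Plane × Plane ≃ᵐ EuclideanSpace ℝ (Fin 4) :=
  (MeasurableEquiv.toLp 2 (Plane × Plane)).trans directSumIso.toHomeomorph.toMeasurableEquiv

theorem measurePreserving_directSumEquiv :
    MeasurePreserving directSumEquiv (volume.prod volume) volume :=
  (WithLp.volume_preserving_toLp Plane Plane).trans directSumIso.measurePreserving

theorem integrable_directSum {f : EuclideanSpace ℝ (Fin 4) → ℂ} :
    Integrable (fun p : Plane × Plane => f (directSum p.1 p.2)) (volume.prod volume) ↔
      Integrable f :=
  measurePreserving_directSumEquiv.integrable_comp_emb directSumEquiv.measurableEmbedding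

theorem integral_directSum {E : Type*} [NormedAddCommGroup E] [NormedSpace ℝ E]
    (f : EuclideanSpace ℝ (Fin 4) → E) :
    ∫ p : Plane × Plane, f (directSum p.1 p.2) ∂(volume.prod volume) = ∫ α, f α :=
  measurePreserving_directSumEquiv.integral_comp directSumEquiv.measurableEmbedding f

theorem ae_directSum {P : EuclideanSpace ℝ (Fin 4) → Prop} (h : ∀ᵐ α, P α) :
    ∀ᵐ p : Plane × Plane ∂(volume.prod volume), P (directSum p.1 p.2) :=
  measurePreserving_directSumEquiv.quasiMeasurePreserving.ae h

theorem ae_of_ae_directSum {P : EuclideanSpace ℝ (Fin 4) → Prop}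
    (h : ∀ᵐ p : Plane × Plane ∂(volume.prod volume), P (directSum p.1 p.2)) : ∀ᵐ α, P α := by
  have h1 := (measurePreserving_directSumEquiv.symm).quasiMeasurePreserving.ae h
  filter_upwards [h1] with α hα
  have h2 : directSum (directSumEquiv.symm α).1 (directSumEquiv.symm α).2 = α :=
    directSumEquiv.apply_symm_apply α
  rwa [h2] at hα

theorem L1C.ext_directSum {f g : L1C 4}
    (h : ∀ᵐ p : Plane × Plane ∂(volume.prod volume),
      f (directSum p.1 p.2) = g (directSum p.1 p.2)) : f = g :=
  Lp.ext (ae_of_ae_directSum h)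

/-! ## Product functions in `L¹(ℝ⁴)` -/

theorem integrable_tensor {b a : Plane → ℂ} (hb : Integrable b) (ha : Integrable a) :
    Integrable fun α : EuclideanSpace ℝ (Fin 4) => b (qPart α) * a (cPart α) := by
  rw [← integrable_directSum]
  simp only [qPart_directSum, cPart_directSum]
  exact hb.mul_prod ha

/-- The function `b(α_q) a(α_c)`. -/
def tensor (b a : L1C 2) : L1C 4 :=
  (integrable_tensor (L1.integrable_coeFn b) (L1.integrable_coeFn a)).toL1 _

theorem coeFn_tensor (b a : L1C 2) :
    tensor b a =ᵐ[volume] fun α => b (qPart α) * a (cPart α) := Integrable.coeFn_toL1 _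

theorem ae_fst {P : Plane → Prop} (h : ∀ᵐ a, P a) :
    ∀ᵐ p : Plane × Plane ∂(volume.prod volume), P p.1 :=
  Measure.quasiMeasurePreserving_fst.ae h

theorem ae_snd {P : Plane → Prop} (h : ∀ᵐ a, P a) :
    ∀ᵐ p : Plane × Plane ∂(volume.prod volume), P p.2 :=
  Measure.quasiMeasurePreserving_snd.ae h

theorem coeFn_tensor_directSum (b a : L1C 2) :
    ∀ᵐ p : Plane × Plane ∂(volume.prod volume),
      tensor b a (directSum p.1 p.2) = b p.1 * a p.2 := by
  filter_upwards [ae_directSum (coeFn_tensor b a)] with p hp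
  rw [hp, qPart_directSum, cPart_directSum]

theorem add_tensor (b b' a : L1C 2) : tensor (b + b') a = tensor b a + tensor b' a := by
  refine L1C.ext_directSum ?_
  filter_upwards [coeFn_tensor_directSum (b + b') a, coeFn_tensor_directSum b a,
    coeFn_tensor_directSum b' a, ae_directSum (Lp.coeFn_add (tensor b a) (tensor b' a)),
    ae_fst (Lp.coeFn_add b b')] with p h1 h2 h3 h4 h5
  rw [h1, h4, Pi.add_apply, h2, h3, h5, Pi.add_apply, add_mul]

theorem tensor_add (b a a' : L1C 2) : tensor b (a + a') = tensor b a + tensor b a' := by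
  refine L1C.ext_directSum ?_
  filter_upwards [coeFn_tensor_directSum b (a + a'), coeFn_tensor_directSum b a,
    coeFn_tensor_directSum b a', ae_directSum (Lp.coeFn_add (tensor b a) (tensor b a')),
    ae_snd (Lp.coeFn_add a a')] with p h1 h2 h3 h4 h5
  rw [h1, h4, Pi.add_apply, h2, h3, h5, Pi.add_apply, mul_add]

theorem smul_tensor (c : ℂ) (b a : L1C 2) : tensor (c • b) a = c • tensor b a := by
  refine L1C.ext_directSum ?_
  filter_upwards [coeFn_tensor_directSum (c • b) a, coeFn_tensor_directSum b a,
    ae_directSum (Lp.coeFn_smul c (tensor b a)), ae_fst (Lp.coeFn_smul c b)] with p h1 h2 h4 h5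
  rw [h1, h4, Pi.smul_apply, h2, h5, Pi.smul_apply, smul_eq_mul, smul_eq_mul, mul_assoc]

theorem tensor_smul (c : ℂ) (b a : L1C 2) : tensor b (c • a) = c • tensor b a := by
  refine L1C.ext_directSum ?_
  filter_upwards [coeFn_tensor_directSum b (c • a), coeFn_tensor_directSum b a,
    ae_directSum (Lp.coeFn_smul c (tensor b a)), ae_snd (Lp.coeFn_smul c a)] with p h1 h2 h4 h5
  rw [h1, h4, Pi.smul_apply, h2, h5, Pi.smul_apply, smul_eq_mul, smul_eq_mul, mul_left_comm]

theorem norm_tensor (b a : L1C 2) : ‖tensor b a‖ = ‖b‖ * ‖a‖ := by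
  rw [L1.norm_eq_integral_norm, L1.norm_eq_integral_norm, L1.norm_eq_integral_norm,
    ← integral_directSum, ← integral_prod_mul]
  refine integral_congr_ae ?_
  filter_upwards [coeFn_tensor_directSum b a] with p hp
  rw [hp, norm_mul]

/-- The bilinear map `(b, a) ↦ b ⊗ a`. -/
def tensorCLM : L1C 2 →L[ℂ] L1C 2 →L[ℂ] L1C 4 :=
  LinearMap.mkContinuous₂ (LinearMap.mk₂ ℂ tensor add_tensor smul_tensor tensor_add tensor_smul) 1
    fun b a => by
      rw [one_mul]
      exact (norm_tensor b a).le

theorem tensorCLM_apply (b a : L1C 2) : tensorCLM b a = tensor b a := rfl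

theorem tensor_modGaussianL1 {t : ℝ} (ht : 0 < t) (x : EuclideanSpace ℝ (Fin 4)) :
    tensor (modGaussianL1 ht (qPart x)) (modGaussianL1 ht (cPart x)) = modGaussianL1 ht x := by
  refine L1C.ext_directSum ?_
  filter_upwards [coeFn_tensor_directSum (modGaussianL1 ht (qPart x)) (modGaussianL1 ht (cPart x)),
    ae_directSum (coeFn_modGaussianL1 ht x), ae_fst (coeFn_modGaussianL1 ht (qPart x)),
    ae_snd (coeFn_modGaussianL1 ht (cPart x))] with p h1 h2 h3 h4
  rw [h1, h2, h3, h4, modGaussian, modGaussian, modGaussian, norm_sq_directSum, inner_directSum,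
    mul_add, Real.exp_add, Complex.ofReal_add, mul_add, Complex.exp_add, Complex.ofReal_mul]
  ring

/-- The product functions are total in `L¹(ℝ⁴)`. -/
theorem eq_top_of_tensor_mem {W : Submodule ℂ (L1C 4)} (hW : IsClosed (W : Set (L1C 4)))
    (h : ∀ b a, tensor b a ∈ W) : W = ⊤ :=
  eq_top_of_modGaussian_mem hW one_pos fun x => by
    rw [← tensor_modGaussianL1]
    exact h _ _

theorem starL1_tensor (b a : L1C 2) : starL1 (tensor b a) = tensor (starL1 b) (starL1 a) := by
  refine L1C.ext_directSum ?_
  filter_upwards [ae_directSum (coeFn_starL1 (tensor b a)),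
    ae_directSum (ae_neg (coeFn_tensor b a)), coeFn_tensor_directSum (starL1 b) (starL1 a),
    ae_fst (coeFn_starL1 b), ae_snd (coeFn_starL1 a)] with p h1 h2 h3 h4 h5
  rw [h1, h2, h3, h4, h5, map_mul, directSum_neg, qPart_directSum, cPart_directSum]

/-- The zero form. -/
def zeroForm (n : ℕ) : SkewForm n := ⟨0, by simp⟩

theorem zeroForm_phase {n : ℕ} (α β : EuclideanSpace ℝ (Fin n)) : (zeroForm n).phase α β = 1 := by
  simp [SkewForm.phase, SkewForm.pairing, zeroForm]

/-- The phase of J ⊕ 0 sees only the q-components, so the convolution integral factors by Fubini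
into a twisted and an untwisted one. -/
theorem mulL1_tensor (b a b' a' : L1C 2) :
    formStd.mulL1 (tensor b a) (tensor b' a') =
      tensor (formJ.mulL1 b b') ((zeroForm 2).mulL1 a a') := by
  refine L1C.ext_directSum ?_
  filter_upwards [ae_directSum (formStd.coeFn_mulL1 (tensor b a) (tensor b' a')),
    coeFn_tensor_directSum (formJ.mulL1 b b') ((zeroForm 2).mulL1 a a'),
    ae_fst (formJ.coeFn_mulL1 b b'), ae_snd ((zeroForm 2).coeFn_mulL1 a a')] with p h1 h2 h3 h4
  rw [h1, h2, h3, h4, formStd.conv_congr (coeFn_tensor b a) (coeFn_tensor b' a'), SkewForm.conv,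
    SkewForm.conv, SkewForm.conv, ← integral_directSum, ← integral_prod_mul]
  refine integral_congr_ae (Eventually.of_forall fun q => ?_)
  simp only [directSum_sub, qPart_directSum, cPart_directSum, formStd_phase, zeroForm_phase]
  ring

end

section

open scoped FourierTransform SchwartzMap RealInnerProductSpace ContDiff

/-! ## The convolution algebra `L¹(ℝⁿ)` and its characters -/

section HatMul

variable {n : ℕ}

theorem fourierHat_conv {f g : EuclideanSpace ℝ (Fin n) → ℂ} (hf : Integrable f)
    (hg : Integrable g) (x : EuclideanSpace ℝ (Fin n)) :
    fourierHat ((zeroForm n).conv f g) x = fourierHat f x * fourierHat g x := by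
  have hi : Integrable (Function.uncurry fun α α' : EuclideanSpace ℝ (Fin n) =>
      f α' * g (α - α') * (zeroForm n).phase α α' * Complex.exp (Complex.I * (⟪x, α⟫ : ℂ)))
      (volume.prod volume) :=
    ((zeroForm n).integrable_integrand hf hg).mul_bdd (c := 1)
      (continuous_exp_I_inner continuous_const continuous_fst).aestronglyMeasurable
      (Eventually.of_forall fun p => (norm_exp_I_inner x p.1).le)
  simp only [fourierHat, SkewForm.conv, ← integral_mul_const]
  rw [integral_integral_swap hi]
  refine integral_congr_ae (Eventually.of_forall fun α' => ?_)
  have h : ∀ α, f α' * g (α - α') * (zeroForm n).phase α α' *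
      Complex.exp (Complex.I * (⟪x, α⟫ : ℂ)) = f α' * Complex.exp (Complex.I * (⟪x, α'⟫ : ℂ)) *
        (g (α - α') * Complex.exp (Complex.I * (⟪x, α - α'⟫ : ℂ))) := fun α => by
    rw [zeroForm_phase, mul_one]
    have : Complex.exp (Complex.I * (⟪x, α⟫ : ℂ)) = Complex.exp (Complex.I * (⟪x, α'⟫ : ℂ)) *
        Complex.exp (Complex.I * (⟪x, α - α'⟫ : ℂ)) := by
      rw [← Complex.exp_add, ← mul_add, inner_sub_right]
      push_cast
      congr 2
      ring
    rw [this]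
    ring
  simp only [h]
  rw [integral_const_mul, integral_sub_right_eq_self
    (fun α => g α * Complex.exp (Complex.I * (⟪x, α⟫ : ℂ))) α']

theorem hatCLM_mulL1 (x : EuclideanSpace ℝ (Fin n)) (f g : L1C n) :
    hatCLM x ((zeroForm n).mulL1 f g) = hatCLM x f * hatCLM x g := by
  rw [hatCLM_apply, fourierHat_congr ((zeroForm n).coeFn_mulL1 f g),
    fourierHat_conv (L1.integrable_coeFn f) (L1.integrable_coeFn g)]
  rfl

theorem hatCLM_starL1 (x : EuclideanSpace ℝ (Fin n)) (f : L1C n) :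
    hatCLM x (starL1 f) = (starRingEnd ℂ) (hatCLM x f) := by
  rw [hatCLM_apply, hatCLM_apply, fourierHat_congr (coeFn_starL1 f), fourierHat, fourierHat,
    ← integral_conj, ← integral_neg_eq_self]
  refine integral_congr_ae (Eventually.of_forall fun α => ?_)
  simp only [neg_neg, map_mul, ← Complex.exp_conj, Complex.conj_I, Complex.conj_ofReal,
    inner_neg_right, Complex.ofReal_neg, mul_neg, neg_mul]

/-- Injectivity of the Fourier transform reduces this to commutativity of complex numbers. -/
theorem zeroForm_mulL1_comm (f g : L1C n) :
    (zeroForm n).mulL1 f g = (zeroForm n).mulL1 g f :=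
  L1C.ext_hat fun x => by rw [hatCLM_mulL1, hatCLM_mulL1, mul_comm]

/-- Every Schwartz function is the Fourier transform of an integrable function. -/
theorem exists_hatCLM_eq_schwartz (d : 𝓢(EuclideanSpace ℝ (Fin n), ℂ)) :
    ∃ e : L1C n, ∀ x, hatCLM x e = d x := by
  let L : EuclideanSpace ℝ (Fin n) ≃L[ℝ] EuclideanSpace ℝ (Fin n) :=
    ContinuousLinearEquiv.smulLeft (Units.mk0 (-(2 * Real.pi)) (by
      have := Real.pi_pos
      exact (neg_lt_zero.2 (by positivity)).ne))
  let d' : 𝓢(EuclideanSpace ℝ (Fin n), ℂ) := SchwartzMap.compCLMOfContinuousLinearEquiv ℂ L d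
  refine ⟨(𝓕⁻ d' : 𝓢(_, ℂ)).toLp 1 volume, fun x => ?_⟩
  rw [hatCLM_apply, fourierHat_congr (SchwartzMap.coeFn_toLp _ 1 volume), fourierHat_eq_fourier,
    ← SchwartzMap.fourier_coe, FourierTransform.fourier_fourierInv_eq]
  change d (-(2 * Real.pi) • -((2 * Real.pi)⁻¹ • x)) = d x
  rw [smul_neg, neg_smul, neg_neg, smul_smul, mul_inv_cancel₀ (by positivity), one_smul]

/-- The Fourier transform of a Schwartz function is a Schwartz function. -/
theorem exists_schwartz_eq_hatCLM (s : 𝓢(EuclideanSpace ℝ (Fin n), ℂ)) :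
    ∃ c : 𝓢(EuclideanSpace ℝ (Fin n), ℂ), ∀ x, c x = hatCLM x (s.toLp 1 volume) := by
  let L : EuclideanSpace ℝ (Fin n) ≃L[ℝ] EuclideanSpace ℝ (Fin n) :=
    ContinuousLinearEquiv.smulLeft (Units.mk0 (-(2 * Real.pi)⁻¹) (by
      have := Real.pi_pos
      exact (neg_lt_zero.2 (by positivity)).ne))
  refine ⟨SchwartzMap.compCLMOfContinuousLinearEquiv ℂ L (𝓕 s), fun x => ?_⟩
  rw [hatCLM_apply, fourierHat_congr (SchwartzMap.coeFn_toLp _ 1 volume), fourierHat_eq_fourier,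
    ← SchwartzMap.fourier_coe]
  change (𝓕 s) (-(2 * Real.pi)⁻¹ • x) = _
  rw [neg_smul]

/-- A smooth function that agrees with `z ↦ (m - z)⁻¹` on a ball. -/
theorem exists_temperate_resolvent {m : ℂ} {t : ℝ} (ht0 : 0 ≤ t) (ht : t < ‖m‖) :
    ∃ G : ℂ → ℂ, G.HasTemperateGrowth ∧ ∀ z, ‖z‖ ≤ t → G z = (m - z)⁻¹ := by
  -- The two radii cut the interval from t to ‖m‖ into thirds: the bump is 1 on the ball of radius t
  -- and vanishes near the pole m.
  let φ : ContDiffBump (0 : ℂ) := ⟨(2 * t + ‖m‖) / 3, (t + 2 * ‖m‖) / 3, by linarith, by linarith⟩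
  refine ⟨fun z => (φ z : ℂ) * (m - z)⁻¹, HasCompactSupport.hasTemperateGrowth ?_ ?_, fun z hz => ?_⟩
  · exact (φ.hasCompactSupport.comp_left (g := fun t : ℝ => (t : ℂ)) rfl).mul_right
  · refine contDiff_iff_contDiffAt.2 fun z => ?_
    rcases eq_or_ne m z with rfl | hz
    · refine (contDiffAt_const (c := (0 : ℂ))).congr_of_eventuallyEq ?_
      have h : ∀ᶠ w in 𝓝 m, (t + 2 * ‖m‖) / 3 < ‖w‖ :=
        continuous_norm.continuousAt.eventually (lt_mem_nhds (by linarith))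
      filter_upwards [h] with w hw
      rw [φ.zero_of_le_dist (by rw [dist_zero_right]; exact hw.le), Complex.ofReal_zero, zero_mul]
    · have h1 : ContDiffAt ℝ ∞ (fun z => (φ z : ℂ)) z :=
        (Complex.ofRealCLM.contDiff.comp φ.contDiff).contDiffAt
      exact h1.mul ((contDiffAt_const.sub contDiffAt_id).inv (sub_ne_zero.2 hz))
  · have : φ z = 1 := φ.one_of_mem_closedBall (by
      rw [mem_closedBall_zero_iff]
      change ‖z‖ ≤ (2 * t + ‖m‖) / 3
      linarith)
    simp only [this, Complex.ofReal_one, one_mul]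

/-- If |μ(a)| exceeded sup |â|, then â/(μ(a) - â) would be a Schwartz function, so the Fourier
transform of some e in L¹. It satisfies μ(a) e = a + a ∗ e, and applying μ yields μ(a) = 0, a
contradiction. For general a the quotient need not be of this form, hence the restriction to
Schwartz functions. -/
theorem norm_character_schwartz_le (μ : L1C n →L[ℂ] ℂ)
    (hm : ∀ a b, μ ((zeroForm n).mulL1 a b) = μ a * μ b) (s : 𝓢(EuclideanSpace ℝ (Fin n), ℂ))
    {t : ℝ} (ht0 : 0 ≤ t) (ht : ∀ x, ‖hatCLM x (s.toLp 1 volume)‖ ≤ t) :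
    ‖μ (s.toLp 1 volume)‖ ≤ t := by
  by_contra! hlt
  set a : L1C n := s.toLp 1 volume with ha
  obtain ⟨c, hc⟩ := exists_schwartz_eq_hatCLM s
  obtain ⟨G, hG, hGz⟩ := exists_temperate_resolvent ht0 hlt
  have hGc : (G ∘ c).HasTemperateGrowth := hG.comp c.hasTemperateGrowth
  obtain ⟨e, he⟩ := exists_hatCLM_eq_schwartz (SchwartzMap.smulLeftCLM ℂ (G ∘ c) c)
  have hd : ∀ x, hatCLM x e = (μ a - c x)⁻¹ * c x := fun x => by
    rw [he, SchwartzMap.smulLeftCLM_apply_apply hGc, Function.comp_apply,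
      hGz _ (by rw [hc]; exact ht x), smul_eq_mul]
  have key : μ a • e = a + (zeroForm n).mulL1 a e := L1C.ext_hat fun x => by
    rw [map_smul, map_add, hatCLM_mulL1, hd, ← hc, smul_eq_mul]
    have h0 : μ a - c x ≠ 0 := by
      refine sub_ne_zero.2 fun h => ?_
      rw [h, hc] at hlt
      exact absurd (ht x) (not_le.2 hlt)
    field_simp
    ring
  have h1 := congrArg μ key
  rw [map_smul, map_add, hm, smul_eq_mul, right_eq_add] at h1
  rw [h1, norm_zero] at hlt
  exact absurd ht0 (not_le.2 hlt)

/-- A continuous character of `L¹(ℝⁿ)` is bounded by the supremum of the Fourier transform. -/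
theorem norm_character_le (μ : L1C n →L[ℂ] ℂ)
    (hm : ∀ a b, μ ((zeroForm n).mulL1 a b) = μ a * μ b) (a : L1C n)
    {t : ℝ} (ht : ∀ x, ‖hatCLM x a‖ ≤ t) : ‖μ a‖ ≤ t := by
  have ht0 : 0 ≤ t := (norm_nonneg _).trans (ht 0)
  refine le_of_forall_pos_le_add fun δ hδ => ?_
  -- With this tolerance ε, the errors in the Fourier transform and in μ add up to ε + ‖μ‖ ε = δ.
  have hε : 0 < δ / (1 + ‖μ‖) := by positivity
  obtain ⟨s, hs⟩ := (SchwartzMap.denseRange_toLpCLM (F := ℂ) (p := 1)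
    (μ := (volume : Measure (EuclideanSpace ℝ (Fin n)))) ENNReal.one_ne_top).exists_dist_lt a hε
  have hs' : ‖a - s.toLp 1 volume‖ < δ / (1 + ‖μ‖) := by rwa [dist_eq_norm] at hs
  have h1 : ‖μ (s.toLp 1 volume)‖ ≤ t + δ / (1 + ‖μ‖) :=
    norm_character_schwartz_le μ hm s (by positivity) fun x => by
      have h : hatCLM x (s.toLp 1 volume) = hatCLM x a - hatCLM x (a - s.toLp 1 volume) := by
        rw [map_sub, sub_sub_cancel]
      rw [h]
      exact (norm_sub_le _ _).trans (add_le_add (ht x) ((norm_hatCLM_apply_le x _).trans hs'.le))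
  have h2 : μ a = μ (s.toLp 1 volume) + μ (a - s.toLp 1 volume) := by rw [map_sub]; ring
  have h3 : ‖μ (a - s.toLp 1 volume)‖ ≤ ‖μ‖ * (δ / (1 + ‖μ‖)) :=
    (μ.le_opNorm _).trans (mul_le_mul_of_nonneg_left hs'.le (norm_nonneg _))
  have h4 : δ / (1 + ‖μ‖) + ‖μ‖ * (δ / (1 + ‖μ‖)) = δ := by field_simp
  rw [h2]
  refine (norm_add_le _ _).trans ((add_le_add h1 h3).trans (le_of_eq ?_))
  rw [add_assoc, h4]

/-- The Fourier transform, as a function vanishing at infinity. -/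
def hatC0 (f : L1C n) : C₀(EuclideanSpace ℝ (Fin n), ℂ) where
  toFun x := hatCLM x f
  continuous_toFun := continuous_hatCLM f
  zero_at_infty' := tendsto_hatCLM f

/-- The Fourier transforms of integrable functions are dense in `C₀(ℝⁿ)`. -/
theorem closure_span_range_hatC0 :
    (Submodule.span ℂ (Set.range (hatC0 (n := n)))).topologicalClosure = ⊤ := by
  refine eq_top_iff.2 fun f _ => Metric.mem_closure_iff.2 fun ε hε => ?_
  have hε2 : 0 < ε / 3 := by positivity
  obtain ⟨φ, hφ, -, hφc, hφ01⟩ := exists_continuous_one_zero_of_isCompact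
    (f.isCompact_setOf_le_norm hε2) isClosed_empty (Set.disjoint_empty _)
  -- Cut f off to compact support, then smooth the result without enlarging the support of u; what
  -- comes out is Schwartz, hence a Fourier transform. Each of the two steps costs ε/3.
  let u : EuclideanSpace ℝ (Fin n) → ℂ := fun x => (φ x : ℂ) * f x
  have hu : Continuous u := (Complex.continuous_ofReal.comp φ.continuous).mul (map_continuous f)
  have hfu : ∀ x, ‖f x - u x‖ ≤ ε / 3 := fun x => by
    rcases le_or_gt (ε / 3) ‖f x‖ with hx | hx
    · have h1 : φ x = 1 := hφ hx
      change ‖f x - (φ x : ℂ) * f x‖ ≤ _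
      rw [h1, Complex.ofReal_one, one_mul, sub_self, norm_zero]
      exact hε2.le
    · have h1 : f x - u x = ((1 - φ x : ℝ) : ℂ) * f x := by
        change f x - (φ x : ℂ) * f x = _
        push_cast
        ring
      obtain ⟨h2, h3⟩ := hφ01 x
      rw [h1, norm_mul, Complex.norm_real, Real.norm_of_nonneg (by linarith)]
      nlinarith [norm_nonneg (f x)]
  obtain ⟨g, hg, hgu, hgs⟩ := hu.exists_contDiff_approx ⊤ (continuous_const (y := ε / 3))
    fun _ => hε2
  have hgc : HasCompactSupport g := by
    refine hφc.mono (hgs.trans fun x hx h0 => hx ?_)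
    change (φ x : ℂ) * f x = 0
    rw [h0, Complex.ofReal_zero, zero_mul]
  obtain ⟨e, he⟩ := exists_hatCLM_eq_schwartz (hgc.toSchwartzMap hg)
  refine ⟨hatC0 e, Submodule.subset_span ⟨e, rfl⟩, ?_⟩
  rw [dist_eq_norm]
  refine (ZeroAtInftyContinuousMap.norm_le_of_forall (C := 2 * (ε / 3)) (by positivity)
    fun x => ?_).trans_lt (by linarith)
  have h1 : (f - hatC0 e) x = (f x - u x) - (g x - u x) := by
    change f x - hatCLM x e = _
    rw [he, sub_sub_sub_cancel_right]
    rfl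
  rw [h1]
  have h2 := hgu x
  rw [dist_eq_norm] at h2
  linarith [norm_sub_le (f x - u x) (g x - u x), hfu x]

end HatMul

end

section

open scoped RealInnerProductSpace

/-! ## The partial Fourier transform -/

/-- The partial Fourier transform `∫ f(α_q ⊕ α_c) exp (i⟨x, α_c⟩) dα_c`. -/
def partialHat (x : Plane) (f : EuclideanSpace ℝ (Fin 4) → ℂ) (αq : Plane) : ℂ :=
  ∫ αc : Plane, f (directSum αq αc) * Complex.exp (Complex.I * (inner ℝ x αc : ℂ))

theorem integrable_partialHat_integrand {f : EuclideanSpace ℝ (Fin 4) → ℂ} (hf : Integrable f)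
    (x : Plane) : Integrable (fun p : Plane × Plane =>
      f (directSum p.1 p.2) * Complex.exp (Complex.I * (inner ℝ x p.2 : ℂ)))
        (volume.prod volume) :=
  (integrable_directSum.2 hf).mul_bdd (c := 1)
    (continuous_exp_I_inner continuous_const continuous_snd).aestronglyMeasurable
    (Eventually.of_forall fun p => (norm_exp_I_inner x p.2).le)

theorem integrable_partialHat {f : EuclideanSpace ℝ (Fin 4) → ℂ} (hf : Integrable f) (x : Plane) :
    Integrable (partialHat x f) :=
  (integrable_partialHat_integrand hf x).integral_prod_left

theorem partialHat_congr {f g : EuclideanSpace ℝ (Fin 4) → ℂ} (h : f =ᵐ[volume] g) (x : Plane) :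
    partialHat x f =ᵐ[volume] partialHat x g := by
  filter_upwards [Measure.ae_ae_of_ae_prod (ae_directSum h)] with a ha
  refine integral_congr_ae ?_
  filter_upwards [ha] with b hb
  rw [hb]

theorem partialHat_add {f g : EuclideanSpace ℝ (Fin 4) → ℂ} (hf : Integrable f)
    (hg : Integrable g) (x : Plane) :
    partialHat x (f + g) =ᵐ[volume] partialHat x f + partialHat x g := by
  filter_upwards [(integrable_partialHat_integrand hf x).prod_right_ae,
    (integrable_partialHat_integrand hg x).prod_right_ae] with a h1 h2
  rw [Pi.add_apply, partialHat, partialHat, partialHat, ← integral_add h1 h2]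
  simp only [Pi.add_apply, add_mul]

theorem partialHat_smul (c : ℂ) (f : EuclideanSpace ℝ (Fin 4) → ℂ) (x : Plane) :
    partialHat x (c • f) = c • partialHat x f := by
  funext a
  rw [Pi.smul_apply, partialHat, partialHat, smul_eq_mul, ← integral_const_mul]
  simp only [Pi.smul_apply, smul_eq_mul, mul_assoc]

theorem norm_toL1_partialHat_le (x : Plane) (f : L1C 4)
    (hi : Integrable (partialHat x f)) : ‖hi.toL1 (partialHat x f)‖ ≤ ‖f‖ := by
  have hf := L1.integrable_coeFn f
  rw [L1.norm_eq_integral_norm f, L1.norm_eq_integral_norm, ← integral_directSum,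
    integral_prod _ (integrable_directSum.2 hf).norm]
  refine (integral_congr_ae ((Integrable.coeFn_toL1 hi).fun_comp norm)).trans_le ?_
  refine integral_mono hi.norm (integrable_directSum.2 hf).norm.integral_prod_left fun a => ?_
  refine (norm_integral_le_integral_norm _).trans (le_of_eq ?_)
  simp only [norm_mul, norm_exp_I_inner, mul_one]

/-- The partial Fourier transform at `x`, from `L¹(ℝ⁴)` to `L¹(ℝ²)`. -/
def partialHatCLM (x : Plane) : L1C 4 →L[ℂ] L1C 2 :=
  LinearMap.mkContinuous
    { toFun := fun f => (integrable_partialHat (L1.integrable_coeFn f) x).toL1 _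
      map_add' := fun f g => by
        rw [← Integrable.toL1_add, Integrable.toL1_eq_toL1_iff]
        exact (partialHat_congr (Lp.coeFn_add f g) x).trans
          (partialHat_add (L1.integrable_coeFn f) (L1.integrable_coeFn g) x)
      map_smul' := fun c f => by
        rw [RingHom.id_apply, ← Integrable.toL1_smul', Integrable.toL1_eq_toL1_iff,
          ← partialHat_smul]
        exact partialHat_congr (Lp.coeFn_smul c f) x } 1 fun f => by
    rw [one_mul]
    exact norm_toL1_partialHat_le x f (integrable_partialHat (L1.integrable_coeFn f) x)

theorem coeFn_partialHatCLM (x : Plane) (f : L1C 4) :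
    partialHatCLM x f =ᵐ[volume] partialHat x f :=
  Integrable.coeFn_toL1 (integrable_partialHat (L1.integrable_coeFn f) x)

theorem norm_partialHatCLM_apply_le (x : Plane) (f : L1C 4) : ‖partialHatCLM x f‖ ≤ ‖f‖ := by
  refine ((partialHatCLM x).le_of_opNorm_le (LinearMap.mkContinuous_norm_le _ zero_le_one _)
    f).trans_eq (one_mul _)

theorem partialHatCLM_tensor (x : Plane) (b a : L1C 2) :
    partialHatCLM x (tensor b a) = hatCLM x a • b := by
  refine Lp.ext ?_
  filter_upwards [coeFn_partialHatCLM x (tensor b a), Lp.coeFn_smul (hatCLM x a) b,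
    Measure.ae_ae_of_ae_prod (coeFn_tensor_directSum b a)] with α h1 h2 h3
  rw [h1, h2, Pi.smul_apply, hatCLM_apply, fourierHat, smul_eq_mul, mul_comm, ← integral_const_mul,
    partialHat]
  refine integral_congr_ae ?_
  filter_upwards [h3] with β hβ
  rw [hβ, mul_assoc]

/-- A closed linear condition on `L¹(ℝ⁴)` can be checked on product functions. -/
theorem L1C.tensor_induction {P : L1C 4 → Prop} (hc : IsClosed {f | P f})
    (hadd : ∀ f g, P f → P g → P (f + g)) (hsmul : ∀ (c : ℂ) f, P f → P (c • f))
    (h : ∀ b a, P (tensor b a)) (f : L1C 4) : P f := by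
  let W : Submodule ℂ (L1C 4) :=
    { carrier := {f | P f}
      add_mem' := fun {f g} hf hg => hadd f g hf hg
      zero_mem' := by
        have := hsmul 0 _ (h 0 0)
        rwa [zero_smul] at this
      smul_mem' := fun c f hf => hsmul c f hf }
  have hW : W = ⊤ := eq_top_of_tensor_mem (W := W) hc h
  have : f ∈ W := hW ▸ Submodule.mem_top
  exact this

theorem SkewForm.continuous_mulL1_right {n : ℕ} (σ : SkewForm n) (f : L1C n) :
    Continuous fun g => σ.mulL1 f g :=
  SkewForm.continuous_mulL1 continuous_const continuous_const continuous_id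

theorem SkewForm.continuous_mulL1_left' {n : ℕ} (σ : SkewForm n) (g : L1C n) :
    Continuous fun f => σ.mulL1 f g :=
  SkewForm.continuous_mulL1 continuous_const continuous_id continuous_const

/-- Both sides are continuous and linear in each argument, so product functions suffice; there the
claim is multiplicativity of the Fourier transform in the c-variables. -/
theorem partialHatCLM_mulL1 (x : Plane) (f g : L1C 4) :
    partialHatCLM x (formStd.mulL1 f g) = formJ.mulL1 (partialHatCLM x f) (partialHatCLM x g) := by
  have hT := (partialHatCLM x).continuous
  refine L1C.tensor_induction (P := fun f => partialHatCLM x (formStd.mulL1 f g) =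
    formJ.mulL1 (partialHatCLM x f) (partialHatCLM x g))
    (isClosed_eq (hT.comp (formStd.continuous_mulL1_left' g))
      ((formJ.continuous_mulL1_left' _).comp hT)) (fun f f' h h' => ?_) (fun c f h => ?_)
    (fun b a => ?_) f
  · rw [SkewForm.add_mulL1, map_add, map_add, SkewForm.add_mulL1, h, h']
  · rw [SkewForm.smul_mulL1, map_smul, map_smul, SkewForm.smul_mulL1, h]
  · refine L1C.tensor_induction (P := fun g => partialHatCLM x (formStd.mulL1 (tensor b a) g) =
      formJ.mulL1 (partialHatCLM x (tensor b a)) (partialHatCLM x g))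
      (isClosed_eq (hT.comp (formStd.continuous_mulL1_right _))
        ((formJ.continuous_mulL1_right _).comp hT)) (fun f f' h h' => ?_) (fun c f h => ?_)
      (fun b' a' => ?_) g
    · rw [SkewForm.mulL1_add, map_add, map_add, SkewForm.mulL1_add, h, h']
    · rw [SkewForm.mulL1_smul, map_smul, map_smul, SkewForm.mulL1_smul, h]
    · rw [mulL1_tensor, partialHatCLM_tensor, partialHatCLM_tensor, partialHatCLM_tensor,
        SkewForm.mulL1_smul, SkewForm.smul_mulL1, smul_smul, hatCLM_mulL1, mul_comm]

theorem partialHatCLM_starL1 (x : Plane) (f : L1C 4) :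
    partialHatCLM x (starL1 f) = starL1 (partialHatCLM x f) := by
  have hT := (partialHatCLM x).continuous
  refine L1C.tensor_induction (P := fun f => partialHatCLM x (starL1 f) =
    starL1 (partialHatCLM x f)) (isClosed_eq (hT.comp continuous_starL1)
      (continuous_starL1.comp hT)) (fun f f' h h' => ?_) (fun c f h => ?_) (fun b a => ?_) f
  · rw [starL1_add, map_add, map_add, starL1_add, h, h']
  · rw [starL1_smul, map_smul, map_smul, starL1_smul, h]
  · rw [starL1_tensor, partialHatCLM_tensor, partialHatCLM_tensor, starL1_smul, hatCLM_starL1]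
    rfl

/-- The full Fourier transform performed in two stages, the source of injectivity of the partial
one. -/
theorem hatCLM_partialHatCLM (y : EuclideanSpace ℝ (Fin 4)) (f : L1C 4) :
    hatCLM (qPart y) (partialHatCLM (cPart y) f) = hatCLM y f := by
  refine L1C.tensor_induction (P := fun f => hatCLM (qPart y) (partialHatCLM (cPart y) f) =
    hatCLM y f) (isClosed_eq ((hatCLM _).continuous.comp (partialHatCLM _).continuous)
      (hatCLM y).continuous) (fun f f' h h' => ?_) (fun c f h => ?_) (fun b a => ?_) f
  · rw [map_add, map_add, map_add, h, h']
  · rw [map_smul, map_smul, map_smul, h]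
  · rw [partialHatCLM_tensor, map_smul, smul_eq_mul, hatCLM_apply, hatCLM_apply, hatCLM_apply,
      fourierHat, fourierHat, fourierHat, ← integral_directSum, mul_comm, ← integral_prod_mul]
    refine integral_congr_ae ?_
    filter_upwards [coeFn_tensor_directSum b a] with p hp
    rw [hp, inner_directSum, Complex.ofReal_add, mul_add, Complex.exp_add]
    ring

/-! ### The partial Fourier transform on families -/

section Family

variable {Y : Type*} [TopologicalSpace Y] [T2Space Y] [LocallyCompactSpace Y]

/-- The product functions `k ⊗ b ⊗ a` are total in `C₀(Y, L¹(ℝ⁴))`. -/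
theorem closure_span_smulConst_tensor :
    (Submodule.span ℂ {f : C₀(Y, L1C 4) | ∃ (k : C₀(Y, ℂ)) (b a : L1C 2),
      f = ZeroAtInftyContinuousMap.smulConst k (tensor b a)}).topologicalClosure = ⊤ := by
  refine ZeroAtInftyContinuousMap.eq_top_of_smulConst_mem
    (T := Set.range fun p : L1C 2 × L1C 2 => tensor p.1 p.2)
    (eq_top_of_tensor_mem (Submodule.isClosed_topologicalClosure _) fun b a =>
      Submodule.le_topologicalClosure _ (Submodule.subset_span ⟨(b, a), rfl⟩))
    (Submodule.isClosed_topologicalClosure _) ?_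
  rintro k _ ⟨⟨b, a⟩, rfl⟩
  exact Submodule.le_topologicalClosure _ (Submodule.subset_span ⟨k, b, a, rfl⟩)

/-- Joint continuity and decay in (y, x) need checking only on k ⊗ b ⊗ a, where the transform is
k(y) â(x) b and Riemann–Lebesgue gives decay in x. Contractivity extends this to all f. -/
theorem exists_partialHat_zeroAtInfty (f : C₀(Y, L1C 4)) :
    ∃ g : C₀(Y × Plane, L1C 2), ∀ p, g p = partialHatCLM p.2 (f p.1) := by
  let L : C₀(Y, L1C 4) →ₗ[ℂ] Y × Plane → L1C 2 :=
    { toFun := fun f p => partialHatCLM p.2 (f p.1)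
      map_add' := fun f g => funext fun p => map_add (partialHatCLM p.2) (f p.1) (g p.1)
      map_smul' := fun c f => funext fun p => map_smul (partialHatCLM p.2) c (f p.1) }
  refine ZeroAtInftyContinuousMap.exists_of_total L (fun f p =>
    (norm_partialHatCLM_apply_le _ _).trans (ZeroAtInftyContinuousMap.norm_apply_le f p.1))
    closure_span_smulConst_tensor ?_ f
  rintro _ ⟨k, b, a, rfl⟩
  refine ⟨ZeroAtInftyContinuousMap.prodSMul k
    (ZeroAtInftyContinuousMap.smulConst (hatC0 a) b), fun p => ?_⟩
  change k p.1 • hatCLM p.2 a • b = partialHatCLM p.2 (k p.1 • tensor b a)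
  rw [map_smul, partialHatCLM_tensor]

variable (Y) in
/-- The partial Fourier transform `C₀(Y, L¹(ℝ⁴)) → C₀(Y × ℝ², L¹(ℝ²))`. -/
def partialFourier : TwistedAlgebra (ContinuousMap.const Y formStd) →⋆ₙₐ[ℂ]
    TwistedAlgebra (ContinuousMap.const (Y × Plane) formJ) :=
  have h := fun f : TwistedAlgebra (ContinuousMap.const Y formStd) =>
    (exists_partialHat_zeroAtInfty (show C₀(Y, L1C 4) from f)).choose_spec
  { toFun := fun f => (exists_partialHat_zeroAtInfty (show C₀(Y, L1C 4) from f)).choose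
    map_smul' := fun c f => TwistedAlgebra.ext fun p =>
      (h _ p).trans ((map_smul (partialHatCLM p.2) c (f p.1)).trans (congrArg (c • ·) (h f p).symm))
    map_zero' := TwistedAlgebra.ext fun p => (h _ p).trans (map_zero (partialHatCLM p.2))
    map_add' := fun f g => TwistedAlgebra.ext fun p =>
      (h _ p).trans ((map_add (partialHatCLM p.2) (f p.1) (g p.1)).trans
        (congrArg₂ (· + ·) (h f p).symm (h g p).symm))
    map_mul' := fun f g => TwistedAlgebra.ext fun p =>
      (h _ p).trans ((partialHatCLM_mulL1 p.2 (f p.1) (g p.1)).trans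
        (congrArg₂ formJ.mulL1 (h f p).symm (h g p).symm))
    map_star' := fun f => TwistedAlgebra.ext fun p =>
      (h _ p).trans ((partialHatCLM_starL1 p.2 (f p.1)).trans
        (congrArg starL1 (h f p).symm)) }

theorem partialFourier_apply (f : TwistedAlgebra (ContinuousMap.const Y formStd)) (y : Y)
    (x : Plane) : partialFourier Y f (y, x) = partialHatCLM x (f y) :=
  (exists_partialHat_zeroAtInfty (show C₀(Y, L1C 4) from f)).choose_spec (y, x)

theorem partialFourier_injective : Function.Injective (partialFourier Y) := by
  refine (injective_iff_map_eq_zero (partialFourier Y)).2 fun f hf => TwistedAlgebra.ext fun y => ?_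
  refine L1C.ext_hat fun x => ?_
  rw [← hatCLM_partialHatCLM, ← partialFourier_apply, hf, TwistedAlgebra.zero_apply,
    TwistedAlgebra.zero_apply, map_zero, map_zero]

/-- The functions `(y, x) ↦ k(y) â(x) b` are total. -/
theorem closure_span_smulConst_hatC0 :
    (Submodule.span ℂ {f : C₀(Plane, L1C 2) | ∃ b a : L1C 2,
      f = ZeroAtInftyContinuousMap.smulConst (hatC0 a) b}).topologicalClosure = ⊤ := by
  refine ZeroAtInftyContinuousMap.eq_top_of_smulConst_mem (T := Set.univ)
    (by
      rw [Submodule.span_univ]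
      exact top_le_iff.1 (Submodule.le_topologicalClosure _))
    (Submodule.isClosed_topologicalClosure _) fun k b _ => ?_
  set W := (Submodule.span ℂ {f : C₀(Plane, L1C 2) | ∃ b a : L1C 2,
      f = ZeroAtInftyContinuousMap.smulConst (hatC0 a) b}).topologicalClosure
  have h : (Submodule.span ℂ (Set.range (hatC0 (n := 2)))).topologicalClosure ≤
      W.comap (ZeroAtInftyContinuousMap.smulConstCLM b).toLinearMap :=
    Submodule.topologicalClosure_minimal _ (Submodule.span_le.2 (by
      rintro _ ⟨a, rfl⟩
      exact Submodule.le_topologicalClosure _ (Submodule.subset_span ⟨b, a, rfl⟩)))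
      ((Submodule.isClosed_topologicalClosure _).preimage
        (ZeroAtInftyContinuousMap.smulConstCLM b).continuous)
  rw [closure_span_range_hatC0] at h
  exact h Submodule.mem_top

/-- The range contains all k(y) â(x) b, and these are total because Fourier transforms are dense in
C₀(ℝ²). -/
theorem denseRange_partialFourier : DenseRange (partialFourier Y) := by
  let R : Submodule ℂ C₀(Y × Plane, L1C 2) :=
    LinearMap.range (show TwistedAlgebra (ContinuousMap.const Y formStd) →ₗ[ℂ]
        C₀(Y × Plane, L1C 2) from
      { toFun := fun f => partialFourier Y f
        map_add' := map_add (partialFourier Y)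
        map_smul' := map_smul (partialFourier Y) })
  have h : R.topologicalClosure = ⊤ := by
    refine ZeroAtInftyContinuousMap.eq_top_of_prodSMul_mem closure_span_smulConst_hatC0
      (Submodule.isClosed_topologicalClosure _) ?_
    rintro k _ ⟨b, a, rfl⟩
    refine Submodule.le_topologicalClosure _ ⟨(ZeroAtInftyContinuousMap.smulConst k (tensor b a) :
      C₀(Y, L1C 4)), DFunLike.ext _ _ fun p => ?_⟩
    refine (partialFourier_apply _ p.1 p.2).trans ?_
    change partialHatCLM p.2 (k p.1 • tensor b a) = k p.1 • hatCLM p.2 a • b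
    rw [map_smul, partialHatCLM_tensor]
  have hd : ∀ g : C₀(Y × Plane, L1C 2), g ∈ R.topologicalClosure := fun g => by
    rw [h]
    exact Submodule.mem_top
  exact hd

end Family

end

/-! ## C*-seminorms of `C₀(Y, L¹(ℝⁿ))` -/

/-- A continuous multiplicative functional on a normed algebra is contractive. -/
theorem norm_le_of_map_mul {B : Type*} [NonUnitalNormedRing B] [NormedSpace ℂ B]
    (φ : B →L[ℂ] ℂ) (h : ∀ a b, φ (a * b) = φ a * φ b) (b : B) : ‖φ b‖ ≤ ‖b‖ := by
  by_contra! hlt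
  have hb : 0 < ‖b‖ := by
    refine norm_pos_iff.2 fun h0 => ?_
    rw [h0, map_zero, norm_zero, norm_zero] at hlt
    exact lt_irrefl _ hlt
  -- The algebra has no unit, so powers start at exponent one and enter only through the existence
  -- of c. If |φ(b)| > ‖b‖, their growth contradicts boundedness of φ.
  have hpow : ∀ n : ℕ, ∃ c : B, φ c = φ b ^ (n + 1) ∧ ‖c‖ ≤ ‖b‖ ^ (n + 1) := fun n => by
    induction n with
    | zero => exact ⟨b, by simp, by simp⟩
    | succ n ih =>
      obtain ⟨c, hc, hcn⟩ := ih
      refine ⟨c * b, by rw [h, hc, pow_succ _ (n + 1)], ?_⟩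
      rw [pow_succ]
      exact (norm_mul_le _ _).trans (mul_le_mul_of_nonneg_right hcn hb.le)
  obtain ⟨n, hn⟩ := pow_unbounded_of_one_lt ‖φ‖ ((one_lt_div hb).2 hlt)
  obtain ⟨c, hc, hcn⟩ := hpow n
  have h1 : ‖φ b‖ ^ (n + 1) ≤ ‖φ‖ * ‖b‖ ^ (n + 1) := by
    rw [← norm_pow, ← hc]
    exact (φ.le_opNorm c).trans (mul_le_mul_of_nonneg_left hcn (norm_nonneg _))
  have h2 : (‖φ b‖ / ‖b‖) ^ n ≤ (‖φ b‖ / ‖b‖) ^ (n + 1) :=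
    pow_le_pow_right₀ ((one_lt_div hb).2 hlt).le n.le_succ
  have h3 : (‖φ b‖ / ‖b‖) ^ (n + 1) ≤ ‖φ‖ := by
    rw [div_pow]
    exact (div_le_iff₀ (by positivity)).2 h1
  linarith

/-- Twisted convolution by a fixed function. -/
def SkewForm.mulL1CLM {n : ℕ} (σ : SkewForm n) (f : L1C n) : L1C n →L[ℂ] L1C n :=
  LinearMap.mkContinuous
    { toFun := fun g => σ.mulL1 f g
      map_add' := σ.mulL1_add f
      map_smul' := fun c g => σ.mulL1_smul c f g } ‖f‖ fun g => σ.norm_mulL1_le f g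

/-! ### Linear maps on C₀(X, V) -/

namespace ZeroAtInftyContinuousMap

variable {X : Type*} [TopologicalSpace X] {V V' : Type*} [NormedAddCommGroup V] [NormedSpace ℂ V]
  [NormedAddCommGroup V'] [NormedSpace ℂ V']

/-- The map `v ↦ k • v`. -/
def constSMulCLM (k : C₀(X, ℂ)) : V →L[ℂ] C₀(X, V) :=
  LinearMap.mkContinuous
    { toFun := fun v => smulConst k v
      map_add' := fun v w => ext fun x => smul_add (k x) v w
      map_smul' := fun c v => ext fun x => smul_comm (k x) c v } ‖k‖ fun v =>
    norm_le_of_forall (by positivity) fun x => by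
      change ‖k x • v‖ ≤ _
      rw [norm_smul]
      exact mul_le_mul_of_nonneg_right (norm_apply_le k x) (norm_nonneg _)

/-- Composition with a continuous linear map. -/
def compCLM (μ : V →L[ℂ] V') : C₀(X, V) →L[ℂ] C₀(X, V') :=
  LinearMap.mkContinuous
    { toFun := fun f =>
        { toFun := fun x => μ (f x)
          continuous_toFun := μ.continuous.comp (map_continuous f)
          zero_at_infty' := by
            have h := (μ.continuous.tendsto 0).comp (zero_at_infty f)
            rwa [map_zero] at h }
      map_add' := fun f g => ext fun x => map_add μ (f x) (g x)
      map_smul' := fun c f => ext fun x => map_smul μ c (f x) } ‖μ‖ fun f =>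
    norm_le_of_forall (by positivity) fun x =>
      (μ.le_opNorm (f x)).trans (mul_le_mul_of_nonneg_left (norm_apply_le f x) (norm_nonneg _))

theorem clm_ext_smulConst [T2Space X] [LocallyCompactSpace X] {A B : C₀(X, V) →L[ℂ] V'}
    (h : ∀ (k : C₀(X, ℂ)) (v : V), A (smulConst k v) = B (smulConst k v)) : A = B := by
  have h1 : LinearMap.eqLocus A.toLinearMap B.toLinearMap = ⊤ :=
    eq_top_of_smulConst_mem (T := Set.univ) (by
      rw [Submodule.span_univ]
      exact top_le_iff.1 (Submodule.le_topologicalClosure _))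
      (isClosed_eq A.continuous B.continuous) fun k v _ => h k v
  ext1 f
  have h2 : f ∈ LinearMap.eqLocus A.toLinearMap B.toLinearMap := h1 ▸ Submodule.mem_top
  exact h2

end ZeroAtInftyContinuousMap

open ZeroAtInftyContinuousMap

section Commutative

variable {Y : Type*} [TopologicalSpace Y] {n : ℕ}

theorem TwistedAlgebra.zeroForm_mul_comm
    (f g : TwistedAlgebra (ContinuousMap.const Y (zeroForm n))) : f * g = g * f :=
  TwistedAlgebra.ext fun y => zeroForm_mulL1_comm (f y) (g y)

variable [T2Space Y] [LocallyCompactSpace Y]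

/-- A continuous functional on `C₀(Y, L¹(ℝⁿ))` that is multiplicative for the pointwise convolution
is bounded by the supremum of the fibrewise Fourier transform. -/
theorem norm_character_family_le (χ : C₀(Y, L1C n) →L[ℂ] ℂ)
    (hχ : ∀ (k l : C₀(Y, ℂ)) (a b : L1C n), χ (smulConst k a) * χ (smulConst l b) =
      χ (smulConst (k * l) ((zeroForm n).mulL1 a b))) (u : C₀(Y, L1C n)) {M : ℝ} (hM : 0 ≤ M)
    (h : ∀ y x, ‖hatCLM x (u y)‖ ≤ M) : ‖χ u‖ ≤ M := by
  by_cases h0 : ∀ (k : C₀(Y, ℂ)) (a : L1C n), χ (smulConst k a) = 0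
  · have : χ = 0 := clm_ext_smulConst fun k a => h0 k a
    rw [this, _root_.zero_apply, norm_zero]
    exact hM
  push Not at h0
  obtain ⟨k₀, a₀, hz⟩ := h0
  set z := χ (smulConst k₀ a₀) with hzdef
  -- Neither factor algebra embeds in the family algebra, so the two characters are obtained by
  -- multiplying with k₀ ⊗ a₀, on which χ does not vanish, and dividing by its value z.
  let lam : C₀(Y, ℂ) →L[ℂ] ℂ := z⁻¹ • (χ ∘L smulConstCLM a₀ ∘L bsmulCLM k₀.toBCF)
  let μ : L1C n →L[ℂ] ℂ := z⁻¹ • (χ ∘L constSMulCLM k₀ ∘L (zeroForm n).mulL1CLM a₀)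
  have hl : ∀ k, z * lam k = χ (smulConst (k₀ * k) a₀) := fun k => by
    change z * (z⁻¹ * χ (smulConst (k₀ * k) a₀)) = _
    rw [mul_inv_cancel_left₀ hz]
  have hm : ∀ a, z * μ a = χ (smulConst k₀ ((zeroForm n).mulL1 a₀ a)) := fun a => by
    change z * (z⁻¹ * χ (smulConst k₀ ((zeroForm n).mulL1 a₀ a))) = _
    rw [mul_inv_cancel_left₀ hz]
  have hlam : ∀ k l, lam (k * l) = lam k * lam l := fun k l => by
    have h1 : z * z * lam (k * l) = z * lam k * (z * lam l) := by
      rw [mul_assoc, hl, hl, hl, hzdef, hχ, hχ]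
      rw [mul_mul_mul_comm k₀ k k₀ l, mul_assoc k₀ k₀]
    have h2 : z * z ≠ 0 := mul_ne_zero hz hz
    refine mul_left_cancel₀ h2 (h1.trans ?_)
    ring
  have hmu : ∀ a b, μ ((zeroForm n).mulL1 a b) = μ a * μ b := fun a b => by
    have h1 : z * z * μ ((zeroForm n).mulL1 a b) = z * μ a * (z * μ b) := by
      rw [mul_assoc, hm, hm, hm, hzdef, hχ, hχ]
      congr 2
      refine L1C.ext_hat fun x => ?_
      simp only [hatCLM_mulL1]
      ring
    have h2 : z * z ≠ 0 := mul_ne_zero hz hz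
    refine mul_left_cancel₀ h2 (h1.trans ?_)
    ring
  have hfac : ∀ k a, χ (smulConst k a) = lam k * μ a := fun k a => by
    have h1 : z * z * χ (smulConst k a) = z * lam k * (z * μ a) := by
      rw [mul_assoc, hl, hm, hzdef, hχ, hχ, hχ]
      rw [mul_comm k₀ (k₀ * k)]
    have h2 : z * z ≠ 0 := mul_ne_zero hz hz
    refine mul_left_cancel₀ h2 (h1.trans ?_)
    ring
  -- χ first applies the character μ of L¹ in every fibre and then the character of C₀(Y). The
  -- latter is contractive, and the former is bounded by the Fourier transform.
  have hχ' : χ = lam ∘L compCLM μ := clm_ext_smulConst fun k a => by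
    have e : compCLM μ (smulConst k a) = μ a • k := ext fun y => by
      change μ (k y • a) = μ a * k y
      rw [map_smul, smul_eq_mul, mul_comm]
    rw [hfac, ContinuousLinearMap.comp_apply, e, map_smul, smul_eq_mul, mul_comm]
  rw [hχ', ContinuousLinearMap.comp_apply]
  refine (norm_le_of_map_mul lam hlam _).trans (norm_le_of_forall hM fun y => ?_)
  exact norm_character_le μ hmu (u y) fun x => h y x

/-- Every C*-seminorm of `C₀(Y, L¹(ℝⁿ))` with pointwise convolution is bounded by the supremum of
the fibrewise Fourier transform. -/
theorem CStarSeminorm.le_of_hatCLM_le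
    (q : CStarSeminorm (TwistedAlgebra (ContinuousMap.const Y (zeroForm n))))
    (u : TwistedAlgebra (ContinuousMap.const Y (zeroForm n))) {M : ℝ} (hM : 0 ≤ M)
    (h : ∀ y x, ‖hatCLM x (u y)‖ ≤ M) : q u ≤ M := by
  obtain ⟨χ, hχ, hχq⟩ := q.exists_character TwistedAlgebra.zeroForm_mul_comm u
  let χL : C₀(Y, L1C n) →L[ℂ] ℂ :=
    LinearMap.mkContinuous
      { toFun := fun f => χ f
        map_add' := map_add χ
        map_smul' := map_smul χ } 1 fun f => by
      rw [one_mul]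
      exact (hχq f).trans (q.le_norm f)
  exact hχ.trans (norm_character_family_le χL (fun k l a b => by
    refine (map_mul χ _ _).symm.trans (congrArg χ (TwistedAlgebra.ext fun y => ?_))
    change (zeroForm n).mulL1 (k y • a) (l y • b) = (k y * l y) • (zeroForm n).mulL1 a b
    rw [SkewForm.smul_mulL1, SkewForm.mulL1_smul, smul_smul]) u hM h)

end Commutative

section

open scoped RealInnerProductSpace

/-! ## The left ideal generated by the Gaussian projection -/

theorem Submodule.closure_span_induction {E : Type*} [NormedAddCommGroup E] [NormedSpace ℂ E]
    {S : Set E} {P : E → Prop} (hc : IsClosed {x | P x}) (h0 : P 0)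
    (hadd : ∀ x y, P x → P y → P (x + y)) (hsmul : ∀ (c : ℂ) x, P x → P (c • x))
    (hS : ∀ s ∈ S, P s) {x : E} (hx : x ∈ (Submodule.span ℂ S).topologicalClosure) : P x := by
  let W : Submodule ℂ E :=
    { carrier := {x | P x}
      add_mem' := fun {x y} hx hy => hadd x y hx hy
      zero_mem' := h0
      smul_mem' := fun c x hx => hsmul c x hx }
  exact Submodule.topologicalClosure_minimal _ (t := W) (Submodule.span_le.2 hS) hc hx

/-! ### Convolution squares of modulated Gaussians -/

section ModGaussian

variable {n : ℕ}

theorem hatCLM_modGaussianL1 {b : ℝ} (hb : 0 < b) (x y : EuclideanSpace ℝ (Fin n)) :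
    hatCLM y (modGaussianL1 hb x) =
      (Real.pi / b : ℂ) ^ (n / 2 : ℂ) * Complex.exp (-(‖x + y‖ : ℂ) ^ 2 / (4 * b)) := by
  rw [hatCLM_apply, fourierHat_congr (coeFn_modGaussianL1 hb x), fourierHat]
  have h := GaussianFourier.integral_cexp_neg_mul_sq_norm_add_of_euclideanSpace (ι := Fin n)
    (b := b) (by simpa using hb) Complex.I (x + y)
  rw [Complex.I_sq, Fintype.card_fin, neg_one_mul] at h
  rw [← h]
  refine integral_congr_ae (Eventually.of_forall fun α => ?_)
  simp only [modGaussian]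
  rw [inner_add_left, Complex.ofReal_exp, ← Complex.exp_add, ← Complex.exp_add]
  congr 1
  push_cast
  ring

theorem starL1_modGaussianL1 {b : ℝ} (hb : 0 < b) (x : EuclideanSpace ℝ (Fin n)) :
    starL1 (modGaussianL1 hb x) = modGaussianL1 hb x := by
  refine Lp.ext ?_
  filter_upwards [coeFn_starL1 (modGaussianL1 hb x), ae_neg (coeFn_modGaussianL1 hb x),
    coeFn_modGaussianL1 hb x] with α h1 h2 h3
  rw [h1, h2, h3, modGaussian, modGaussian, map_mul, Complex.conj_ofReal, ← Complex.exp_conj,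
    map_mul, Complex.conj_I, Complex.conj_ofReal, inner_neg_right, norm_neg, Complex.ofReal_neg,
    neg_mul_neg]

/-- On the Fourier side, squaring exp(-‖x + y‖²/(4b)) halves b. Since modulated Gaussians are
self-adjoint, all those of parameter b/2 are multiples of convolution squares a ∗ a⋆. -/
theorem exists_modGaussianL1_mulL1_self {b : ℝ} (hb : 0 < b) (x : EuclideanSpace ℝ (Fin n)) :
    ∃ c : ℂ, modGaussianL1 (half_pos hb) x =
      c • (zeroForm n).mulL1 (modGaussianL1 hb x) (modGaussianL1 hb x) := by
  refine ⟨(Real.pi / (b / 2 : ℝ) : ℂ) ^ (n / 2 : ℂ) *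
    ((Real.pi / b : ℂ) ^ (n / 2 : ℂ) * (Real.pi / b : ℂ) ^ (n / 2 : ℂ))⁻¹, L1C.ext_hat fun y => ?_⟩
  have h0 : (Real.pi / b : ℂ) ^ (n / 2 : ℂ) ≠ 0 := by
    have : (Real.pi / b : ℂ) ≠ 0 := by
      rw [← Complex.ofReal_div]
      exact Complex.ofReal_ne_zero.2 (by have := Real.pi_pos; positivity)
    rw [Ne, Complex.cpow_eq_zero_iff]
    tauto
  rw [map_smul, hatCLM_mulL1, hatCLM_modGaussianL1, hatCLM_modGaussianL1, smul_eq_mul]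
  have h1 : Complex.exp (-(‖x + y‖ : ℂ) ^ 2 / (4 * (b / 2 : ℝ))) =
      Complex.exp (-(‖x + y‖ : ℂ) ^ 2 / (4 * b)) * Complex.exp (-(‖x + y‖ : ℂ) ^ 2 / (4 * b)) := by
    rw [← Complex.exp_add]
    congr 1
    have : (b : ℂ) ≠ 0 := Complex.ofReal_ne_zero.2 hb.ne'
    push_cast
    field_simp
    ring
  rw [h1]
  field_simp

/-- Convolution squares `a ∗ a⋆` are total in `L¹(ℝⁿ)`. -/
theorem eq_top_of_mul_star_mem {W : Submodule ℂ (L1C n)} (hW : IsClosed (W : Set (L1C n)))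
    (h : ∀ a, (zeroForm n).mulL1 a (starL1 a) ∈ W) : W = ⊤ := by
  refine eq_top_of_modGaussian_mem hW (half_pos one_pos) fun x => ?_
  obtain ⟨c, hc⟩ := exists_modGaussianL1_mulL1_self (n := n) one_pos x
  rw [hc]
  have := h (modGaussianL1 one_pos x)
  rw [starL1_modGaussianL1] at this
  exact W.smul_mem c this

end ModGaussian

/-- The closed left ideal of `L¹(ℝ⁴)` spanned by the functions `(b × g) ⊗ a`. -/
def gaussIdeal : Submodule ℂ (L1C 4) :=
  (Submodule.span ℂ {f | ∃ b a : L1C 2, f = tensor (formJ.mulL1 b gaussL1) a}).topologicalClosure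

theorem tensor_mem_gaussIdeal (b a : L1C 2) : tensor (formJ.mulL1 b gaussL1) a ∈ gaussIdeal :=
  Submodule.le_topologicalClosure _ (Submodule.subset_span ⟨b, a, rfl⟩)

theorem isClosed_gaussIdeal : IsClosed (gaussIdeal : Set (L1C 4)) :=
  Submodule.isClosed_topologicalClosure _

theorem mulL1_mem_gaussIdeal (f : L1C 4) {l : L1C 4} (hl : l ∈ gaussIdeal) :
    formStd.mulL1 f l ∈ gaussIdeal := by
  refine Submodule.closure_span_induction (P := fun l => formStd.mulL1 f l ∈ gaussIdeal)
    (isClosed_gaussIdeal.preimage (formStd.continuous_mulL1_right f)) ?_ (fun x y hx hy => ?_)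
    (fun c x hx => ?_) ?_ hl
  · rw [SkewForm.mulL1_zero]
    exact Submodule.zero_mem _
  · rw [SkewForm.mulL1_add]
    exact Submodule.add_mem _ hx hy
  · rw [SkewForm.mulL1_smul]
    exact Submodule.smul_mem _ c hx
  · rintro _ ⟨b, a, rfl⟩
    refine L1C.tensor_induction (P := fun f =>
      formStd.mulL1 f (tensor (formJ.mulL1 b gaussL1) a) ∈ gaussIdeal)
      (isClosed_gaussIdeal.preimage (formStd.continuous_mulL1_left' _)) (fun x y hx hy => ?_)
      (fun c x hx => ?_) (fun b' a' => ?_) f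
    · rw [SkewForm.add_mulL1]
      exact Submodule.add_mem _ hx hy
    · rw [SkewForm.smul_mulL1]
      exact Submodule.smul_mem _ c hx
    · rw [mulL1_tensor, ← formJ.mulL1_assoc]
      exact tensor_mem_gaussIdeal _ _

theorem gaussL1_norm_pos : 0 < ‖gaussL1‖ := norm_pos_iff.2 gaussL1_ne_zero

/-- The map a ↦ g ⊗ a scales norms by ‖g‖, so it is bounded below. Its closed range makes membership
in the corner a closed condition. -/
theorem isClosedEmbedding_tensor_gaussL1 :
    Topology.IsClosedEmbedding (tensorCLM gaussL1) := by
  have h : AntilipschitzWith ⟨‖gaussL1‖⁻¹, by positivity⟩ (tensorCLM gaussL1) :=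
    AddMonoidHomClass.antilipschitz_of_bound _ fun a => by
      rw [tensorCLM_apply, norm_tensor]
      exact (inv_mul_cancel_left₀ gaussL1_norm_pos.ne' _).ge
  exact h.isClosedEmbedding (tensorCLM gaussL1).uniformContinuous

/-- On generators, (bg ⊗ a)⋆ (b'g ⊗ a') = g b⋆b' g ⊗ a⋆a' = φ(b⋆b') g ⊗ a⋆a'. Closedness of the
corner carries this to the closed left ideal. -/
theorem star_mulL1_mem_range {l l' : L1C 4} (hl : l ∈ gaussIdeal) (hl' : l' ∈ gaussIdeal) :
    formStd.mulL1 (starL1 l) l' ∈ LinearMap.range (tensorCLM gaussL1).toLinearMap := by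
  set R := LinearMap.range (tensorCLM gaussL1).toLinearMap with hR
  have hRc : IsClosed (R : Set (L1C 4)) := isClosedEmbedding_tensor_gaussL1.isClosed_range
  refine Submodule.closure_span_induction (P := fun l' => formStd.mulL1 (starL1 l) l' ∈ R)
    (hRc.preimage (formStd.continuous_mulL1_right _)) ?_ (fun x y hx hy => ?_)
    (fun c x hx => ?_) ?_ hl'
  · rw [SkewForm.mulL1_zero]
    exact Submodule.zero_mem _
  · rw [SkewForm.mulL1_add]
    exact Submodule.add_mem _ hx hy
  · rw [SkewForm.mulL1_smul]
    exact Submodule.smul_mem _ c hx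
  rintro _ ⟨b', a', rfl⟩
  refine Submodule.closure_span_induction (P := fun l => formStd.mulL1 (starL1 l)
    (tensor (formJ.mulL1 b' gaussL1) a') ∈ R)
    (hRc.preimage ((formStd.continuous_mulL1_left' _).comp continuous_starL1)) ?_
    (fun x y hx hy => ?_) (fun c x hx => ?_) ?_ hl
  · rw [show (0 : L1C 4) = (0 : ℂ) • 0 by simp, starL1_smul, SkewForm.smul_mulL1, star_zero,
      zero_smul]
    exact Submodule.zero_mem _
  · rw [starL1_add, SkewForm.add_mulL1]
    exact Submodule.add_mem _ hx hy
  · rw [starL1_smul, SkewForm.smul_mulL1]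
    exact Submodule.smul_mem _ _ hx
  · rintro _ ⟨b, a, rfl⟩
    rw [starL1_tensor, mulL1_tensor, starL1_mulL1, star_gaussL1, formJ.mulL1_assoc,
      ← formJ.mulL1_assoc (starL1 b), gaussL1_mul_mul, smul_tensor]
    exact Submodule.smul_mem _ _ ⟨_, rfl⟩

/-- The products `l × l'⋆` of elements of the left ideal are total. -/
theorem eq_top_of_gaussIdeal_mul_star_mem {W : Submodule ℂ (L1C 4)}
    (hW : IsClosed (W : Set (L1C 4)))
    (h : ∀ l ∈ gaussIdeal, ∀ l' ∈ gaussIdeal, formStd.mulL1 l (starL1 l') ∈ W) : W = ⊤ := by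
  refine eq_top_of_tensor_mem hW fun b a => ?_
  -- Reduce one tensor factor at a time: first b to a product (xg)(xg)⋆, then a to a convolution
  -- square.
  have h1 : W.comap ((tensorCLM.flip a).toLinearMap) = ⊤ := by
    refine eq_top_of_mul_gaussL1_mul_star_mem (hW.preimage (tensorCLM.flip a).continuous)
      fun x => ?_
    have h2 : W.comap ((tensorCLM (formJ.mulL1 (formJ.mulL1 x gaussL1)
        (starL1 (formJ.mulL1 x gaussL1)))).toLinearMap) = ⊤ := by
      refine eq_top_of_mul_star_mem (hW.preimage (ContinuousLinearMap.continuous _)) fun a => ?_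
      have h3 := h _ (tensor_mem_gaussIdeal x a) _ (tensor_mem_gaussIdeal x a)
      rw [starL1_tensor, mulL1_tensor] at h3
      exact h3
    have h4 : a ∈ W.comap ((tensorCLM (formJ.mulL1 (formJ.mulL1 x gaussL1)
        (starL1 (formJ.mulL1 x gaussL1)))).toLinearMap) := h2 ▸ Submodule.mem_top
    exact h4
  have h5 : b ∈ W.comap ((tensorCLM.flip a).toLinearMap) := h1 ▸ Submodule.mem_top
  exact h5

end

open ZeroAtInftyContinuousMap

/-! ## The representation by compact operators -/

namespace IsGaussGNS

variable {K : Type*} [NormedAddCommGroup K] [InnerProductSpace ℂ K] [CompleteSpace K]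
  {v : L1C 2 →ₗ[ℂ] K}

/-- The representation of `L¹(ℝ²)`, twisted by `J`, by compact operators. -/
def compactOp (hv : IsGaussGNS v) : L1C 2 →L[ℂ] compactOperators K :=
  LinearMap.mkContinuous
    { toFun := fun a => ⟨op v a, hv.isCompactOperator_op a⟩
      map_add' := fun a b => Subtype.ext (hv.op_add a b)
      map_smul' := fun c a => Subtype.ext (hv.op_smul c a) } 1 fun a => by
    rw [one_mul]
    exact hv.norm_op_le a

theorem coe_compactOp (hv : IsGaussGNS v) (a : L1C 2) : (hv.compactOp a : K →L[ℂ] K) = op v a := rfl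

theorem norm_compactOp (hv : IsGaussGNS v) (a : L1C 2) : ‖hv.compactOp a‖ = ‖op v a‖ := rfl

theorem denseRange_compactOp (hv : IsGaussGNS v) :
    (LinearMap.range hv.compactOp.toLinearMap).topologicalClosure = ⊤ := by
  refine eq_top_iff.2 fun T _ => ?_
  let W : Submodule ℂ (K →L[ℂ] K) := (LinearMap.range hv.opCLM.toLinearMap).topologicalClosure
  have hT : (T : K →L[ℂ] K) ∈ W := hv.compact_mem_closure
    (Submodule.isClosed_topologicalClosure _)
    (fun a => Submodule.le_topologicalClosure (LinearMap.range hv.opCLM.toLinearMap) ⟨a, rfl⟩) T.2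
  refine Metric.mem_closure_iff.2 fun ε hε => ?_
  obtain ⟨_, ⟨a, rfl⟩, ha⟩ := Metric.mem_closure_iff.1 hT ε hε
  exact ⟨hv.compactOp a, ⟨a, rfl⟩, ha⟩

variable {X : Type*} [TopologicalSpace X]

variable (X) in
/-- The representation of `C₀(X, L¹(ℝ²))`, twisted by `J`, in `C₀(X, 𝒦)`. -/
def compactRep (hv : IsGaussGNS v) :
    TwistedAlgebra (ContinuousMap.const X formJ) →⋆ₙₐ[ℂ] C₀(X, compactOperators K) where
  toFun f := compCLM hv.compactOp (show C₀(X, L1C 2) from f)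
  map_smul' c f := map_smul (compCLM hv.compactOp) c (show C₀(X, L1C 2) from f)
  map_zero' := map_zero (compCLM hv.compactOp)
  map_add' f g :=
    map_add (compCLM hv.compactOp) (show C₀(X, L1C 2) from f) (show C₀(X, L1C 2) from g)
  map_mul' f g := ZeroAtInftyContinuousMap.ext fun x => Subtype.ext (hv.op_mul (f x) (g x))
  map_star' f := ZeroAtInftyContinuousMap.ext fun x => Subtype.ext (hv.op_star (f x))

theorem compactRep_apply (hv : IsGaussGNS v) (f : TwistedAlgebra (ContinuousMap.const X formJ))
    (x : X) : hv.compactRep X f x = hv.compactOp (f x) := rfl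

theorem compactRep_injective (hv : IsGaussGNS v) : Function.Injective (hv.compactRep X) := by
  refine (injective_iff_map_eq_zero (hv.compactRep X)).2 fun f hf => TwistedAlgebra.ext fun x => ?_
  refine hv.op_injective ?_
  rw [← hv.coe_compactOp, ← hv.compactRep_apply, hf]
  rfl

theorem norm_compactRep_le (hv : IsGaussGNS v)
    (f : TwistedAlgebra (ContinuousMap.const X formJ)) : ‖hv.compactRep X f‖ ≤ ‖f‖ :=
  norm_le_of_forall (norm_nonneg _) fun x => (hv.norm_op_le _).trans (f.norm_apply_le x)

theorem denseRange_compactRep [T2Space X] [LocallyCompactSpace X] (hv : IsGaussGNS v) :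
    DenseRange (hv.compactRep X) := by
  let R : Submodule ℂ C₀(X, compactOperators K) :=
    LinearMap.range (compCLM (X := X) hv.compactOp).toLinearMap
  have h : R.topologicalClosure = ⊤ := by
    refine eq_top_of_smulConst_mem
      (T := (LinearMap.range hv.compactOp.toLinearMap : Set (compactOperators K))) (by
        rw [Submodule.span_eq]
        exact hv.denseRange_compactOp) (Submodule.isClosed_topologicalClosure _) ?_
    rintro k _ ⟨a, rfl⟩
    refine Submodule.le_topologicalClosure _ ⟨smulConst k a, ZeroAtInftyContinuousMap.ext fun x => ?_⟩
    exact map_smul hv.compactOp (k x) a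
  have hd : ∀ g : C₀(X, compactOperators K), g ∈ R.topologicalClosure := fun g => by
    rw [h]
    exact Submodule.mem_top
  exact hd

end IsGaussGNS

/-! ## The norm of `C₀(Y × ℝ², 𝒦)` dominates all C*-seminorms -/

section Domination

variable {Y : Type*} [TopologicalSpace Y]

variable (Y) in
/-- The corner embedding `u ↦ g ⊗ u`. -/
def cornerHom : TwistedAlgebra (ContinuousMap.const Y (zeroForm 2)) →⋆ₙₐ[ℂ]
    TwistedAlgebra (ContinuousMap.const Y formStd) where
  toFun u := compCLM (tensorCLM gaussL1) (show C₀(Y, L1C 2) from u)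
  map_smul' c f := map_smul (compCLM (tensorCLM gaussL1)) c (show C₀(Y, L1C 2) from f)
  map_zero' := map_zero (compCLM (tensorCLM gaussL1))
  map_add' f g :=
    map_add (compCLM (tensorCLM gaussL1)) (show C₀(Y, L1C 2) from f) (show C₀(Y, L1C 2) from g)
  map_mul' f g := TwistedAlgebra.ext fun y => by
    refine Eq.trans ?_ (mulL1_tensor gaussL1 (f y) gaussL1 (g y)).symm
    rw [gaussL1_mul_self]
    rfl
  map_star' f := TwistedAlgebra.ext fun y => by
    refine Eq.trans ?_ (starL1_tensor gaussL1 (f y)).symm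
    rw [star_gaussL1]
    rfl

theorem cornerHom_apply (u : TwistedAlgebra (ContinuousMap.const Y (zeroForm 2))) (y : Y) :
    cornerHom Y u y = tensor gaussL1 (u y) := rfl

variable (Y) in
/-- The left ideal of functions with values in the left ideal generated by the Gaussian. -/
def gaussIdealFamily : Submodule ℂ (TwistedAlgebra (ContinuousMap.const Y formStd)) where
  carrier := {s | ∀ y, s y ∈ gaussIdeal}
  add_mem' hs ht y := Submodule.add_mem _ (hs y) (ht y)
  zero_mem' _ := Submodule.zero_mem _
  smul_mem' c _ hs y := Submodule.smul_mem _ c (hs y)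

/-- Each fibre of s⋆s has the form g ⊗ u(y). Continuity and decay of u are inherited since tensoring
with g is a closed embedding. -/
theorem exists_cornerHom_eq {s : TwistedAlgebra (ContinuousMap.const Y formStd)}
    (hs : s ∈ gaussIdealFamily Y) : ∃ u, star s * s = cornerHom Y u := by
  have h : ∀ y, ∃ a, tensorCLM gaussL1 a = (star s * s) y := fun y =>
    star_mulL1_mem_range (hs y) (hs y)
  choose u hu using h
  have hu' : (fun y => tensorCLM gaussL1 (u y)) = (star s * s : TwistedAlgebra _) := funext hu
  have hc : Continuous u := by
    rw [isClosedEmbedding_tensor_gaussL1.isInducing.continuous_iff]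
    change Continuous fun y => tensorCLM gaussL1 (u y)
    rw [hu']
    exact (star s * s).continuous
  have ht : Tendsto u (cocompact Y) (𝓝 0) := by
    rw [isClosedEmbedding_tensor_gaussL1.isInducing.tendsto_nhds_iff, map_zero]
    change Tendsto (fun y => tensorCLM gaussL1 (u y)) _ _
    rw [hu']
    exact (star s * s).tendsto
  exact ⟨(⟨⟨u, hc⟩, ht⟩ : C₀(Y, L1C 2)), TwistedAlgebra.ext fun y => (hu y).symm⟩

variable [T2Space Y] [LocallyCompactSpace Y]

/-- The span is a C₀(Y)-module up to closure, so it suffices to look at single fibres, where the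
products l × l'⋆ are total. -/
theorem closure_span_gaussIdealFamily_mul_star :
    (Submodule.span ℂ {x | ∃ s ∈ gaussIdealFamily Y, ∃ t ∈ gaussIdealFamily Y,
      x = s * star t}).topologicalClosure = ⊤ := by
  let S : Set C₀(Y, L1C 4) := {x | ∃ s ∈ gaussIdealFamily Y, ∃ t ∈ gaussIdealFamily Y,
      x = s * star t}
  change (Submodule.span ℂ S).topologicalClosure = ⊤
  refine eq_top_of_forall_eval (Submodule.isClosed_topologicalClosure _)
    (fun k w hw => bsmul_mem_closure_span ?_ hw) fun y => ?_
  · rintro _ ⟨s, hs, t, ht, rfl⟩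
    refine ⟨bsmul k.toBCF (show C₀(Y, L1C 4) from s), fun y => Submodule.smul_mem _ _ (hs y), t, ht,
      ZeroAtInftyContinuousMap.ext fun y => ?_⟩
    exact (formStd.smul_mulL1 (k y) (s y) (starL1 (t y))).symm
  · obtain ⟨k, hk⟩ := exists_apply_eq_one y
    refine eq_top_of_gaussIdeal_mul_star_mem (Submodule.isClosed_topologicalClosure _)
      fun l hl l' hl' => Submodule.le_topologicalClosure _ ?_
    have hm : ∀ l ∈ gaussIdeal, (smulConst k l : TwistedAlgebra (ContinuousMap.const Y formStd)) ∈
      gaussIdealFamily Y := fun l hl z => Submodule.smul_mem _ (k z) hl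
    refine ⟨_, Submodule.le_topologicalClosure _ (Submodule.subset_span
      ⟨_, hm l hl, _, hm l' hl', rfl⟩), ?_⟩
    change formStd.mulL1 (k y • l) (starL1 (k y • l')) = _
    rw [hk, one_smul, one_smul]

variable {K : Type*} [NormedAddCommGroup K] [InnerProductSpace ℂ K] [CompleteSpace K]
  {v : L1C 2 →ₗ[ℂ] K}

/-- Every C*-seminorm of `C₀(Y, L¹(ℝ⁴))`, twisted by `J ⊕ 0`, is dominated by the norm of
`C₀(Y × ℝ², 𝒦)`. -/
theorem CStarSeminorm.le_norm_compactRep (hv : IsGaussGNS v)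
    (p : CStarSeminorm (TwistedAlgebra (ContinuousMap.const Y formStd)))
    (f : TwistedAlgebra (ContinuousMap.const Y formStd)) :
    p f ≤ ‖hv.compactRep (Y × Plane) (partialFourier Y f)‖ := by
  refine CStarSeminorm.le_of_leftIdeal
    (ofHom ((hv.compactRep (Y × Plane)).comp (partialFourier Y))) (gaussIdealFamily Y)
    (fun a s hs y => mulL1_mem_gaussIdeal (a y) (hs y)) (fun p s hs => ?_)
    closure_span_gaussIdealFamily_mul_star p f
  -- On the corner p restricts to a C*-seminorm of a commutative algebra, bounded by sup |û(y)(x)|.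
  -- At (y, x) the representation sends g ⊗ u to û(y)(x) times an operator of norm one, so this
  -- bound is attained by the target norm.
  obtain ⟨u, hu⟩ := exists_cornerHom_eq hs
  rw [hu, ofHom_apply, ← comp_apply]
  refine (p.comp (cornerHom Y)).le_of_hatCLM_le u (norm_nonneg _) fun y x => ?_
  have h1 := norm_apply_le (hv.compactRep (Y × Plane) (partialFourier Y (cornerHom Y u))) (y, x)
  rw [hv.compactRep_apply, partialFourier_apply, cornerHom_apply, partialHatCLM_tensor, map_smul,
    norm_smul, hv.norm_compactOp, hv.norm_op_gaussL1, mul_one] at h1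
  exact h1

/-- The inequality is a closed condition because both sides are continuous, and on the dense range
of the partial Fourier transform it is the preceding estimate for the pulled-back seminorm. -/
theorem CStarSeminorm.le_norm_compactRep' (hv : IsGaussGNS v)
    (p : CStarSeminorm (TwistedAlgebra (ContinuousMap.const (Y × Plane) formJ)))
    (f : TwistedAlgebra (ContinuousMap.const (Y × Plane) formJ)) :
    p f ≤ ‖hv.compactRep (Y × Plane) f‖ := by
  have hp : Continuous fun f => p f := by
    have h := p.continuous_of.norm
    simpa only [Completion.norm_of] using h
  have hr : Continuous fun f => ‖hv.compactRep (Y × Plane) f‖ :=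
    (AddMonoidHomClass.continuous_of_bound (hv.compactRep (Y × Plane)) 1 fun f => by
      rw [one_mul]
      exact hv.norm_compactRep_le f).norm
  refine denseRange_partialFourier.induction_on (p := fun f =>
    p f ≤ ‖hv.compactRep (Y × Plane) f‖) f (isClosed_le hp hr) fun g => ?_
  exact (p.comp (partialFourier Y)).le_norm_compactRep hv g

end Domination

/-! ## Change of symplectic coordinates -/

namespace L1C

variable {n : ℕ}

/-- The continuous map of `ℝⁿ` given by a matrix. -/
def matrixMap (A : Matrix (Fin n) (Fin n) ℝ) :
    C(EuclideanSpace ℝ (Fin n), EuclideanSpace ℝ (Fin n)) where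
  toFun := A.toEuclideanLin
  continuous_toFun := A.toEuclideanLin.continuous_of_finiteDimensional

theorem matrixMap_apply (A : Matrix (Fin n) (Fin n) ℝ) (α : EuclideanSpace ℝ (Fin n)) :
    matrixMap A α = A.toEuclideanLin α := rfl

theorem matrixMap_sub (A : Matrix (Fin n) (Fin n) ℝ) (α β : EuclideanSpace ℝ (Fin n)) :
    matrixMap A (α - β) = matrixMap A α - matrixMap A β := A.toEuclideanLin.map_sub _ _

theorem matrixMap_neg (A : Matrix (Fin n) (Fin n) ℝ) (α : EuclideanSpace ℝ (Fin n)) :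
    matrixMap A (-α) = -matrixMap A α := A.toEuclideanLin.map_neg _

theorem matrixMap_one : ⇑(matrixMap (1 : Matrix (Fin n) (Fin n) ℝ)) = id := by
  funext α
  rw [matrixMap_apply, Matrix.toLpLin_one]
  rfl

theorem matrixMap_comp (A B : Matrix (Fin n) (Fin n) ℝ) :
    matrixMap A ∘ matrixMap B = matrixMap (A * B) := by
  funext α
  ext i
  simp [matrixMap_apply, Matrix.toLpLin_apply, Matrix.mulVec_mulVec]

theorem continuous_matrixMap : Continuous (matrixMap (n := n)) := by
  refine ContinuousMap.continuous_of_continuous_uncurry _ ?_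
  refine (PiLp.continuous_toLp 2 _).comp ?_
  exact continuous_fst.matrix_mulVec ((PiLp.continuous_ofLp 2 _).comp continuous_snd)

theorem measurePreserving_matrixMap {A : Matrix (Fin n) (Fin n) ℝ} (hA : A.det = 1) :
    MeasurePreserving (matrixMap A) := by
  have hdet : LinearMap.det A.toEuclideanLin = 1 := by
    rw [Matrix.toEuclideanLin, Matrix.toLpLin_eq_toLin, LinearMap.det_toLin, hA]
  refine ⟨(matrixMap A).continuous.measurable, ?_⟩
  have h := Measure.map_linearMap_addHaar_eq_smul_addHaar
    (volume : Measure (EuclideanSpace ℝ (Fin n))) (f := A.toEuclideanLin) (by simp [hdet])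
  rw [hdet, inv_one, abs_one, ENNReal.ofReal_one, one_smul] at h
  exact h

theorem measurableEmbedding_matrixMap {A : Matrix (Fin n) (Fin n) ℝ} (hA : A.det = 1) :
    MeasurableEmbedding (matrixMap A) := by
  refine (matrixMap A).continuous.measurableEmbedding (Function.LeftInverse.injective
    (g := matrixMap A.adjugate) fun α => ?_)
  change (matrixMap A.adjugate ∘ matrixMap A) α = α
  rw [matrixMap_comp, Matrix.adjugate_mul, hA, one_smul, matrixMap_one, id]

/-- Composition of integrable functions with a unimodular matrix. -/
def compMatrix (A : Matrix (Fin n) (Fin n) ℝ) (hA : A.det = 1) : L1C n →ₗᵢ[ℂ] L1C n :=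
  Lp.compMeasurePreservingₗᵢ ℂ (matrixMap A) (measurePreserving_matrixMap hA)

theorem coeFn_compMatrix {A : Matrix (Fin n) (Fin n) ℝ} (hA : A.det = 1) (f : L1C n) :
    compMatrix A hA f =ᵐ[volume] f ∘ matrixMap A :=
  Lp.coeFn_compMeasurePreserving f (measurePreserving_matrixMap hA)

theorem compMatrix_compMatrix_of_mul_eq_one {A B : Matrix (Fin n) (Fin n) ℝ} (hA : A.det = 1)
    (hB : B.det = 1) (h : B * A = 1) (f : L1C n) : compMatrix A hA (compMatrix B hB f) = f := by
  apply Lp.ext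
  filter_upwards [coeFn_compMatrix hA (compMatrix B hB f),
    (measurePreserving_matrixMap hA).quasiMeasurePreserving.ae_eq_comp (coeFn_compMatrix hB f)]
    with α h1 h2
  rw [h1, h2, Function.comp_assoc, matrixMap_comp, h, matrixMap_one, Function.comp_id]

theorem compMatrix_starL1 {A : Matrix (Fin n) (Fin n) ℝ} (hA : A.det = 1) (f : L1C n) :
    compMatrix A hA (starL1 f) = starL1 (compMatrix A hA f) := by
  apply Lp.ext
  filter_upwards [coeFn_compMatrix hA (starL1 f), coeFn_starL1 (compMatrix A hA f),
    (measurePreserving_matrixMap hA).quasiMeasurePreserving.ae_eq_comp (coeFn_starL1 f),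
    ae_neg (coeFn_compMatrix hA f)] with α h1 h2 h3 h4
  rw [h1, h2, h3, h4]
  simp only [Function.comp_apply, matrixMap_neg]

/-- Substitute α' ↦ Aα' in the convolution: determinant one preserves the measure, and A carries s
to t, hence phase to phase. -/
theorem compMatrix_mulL1 {A : Matrix (Fin n) (Fin n) ℝ} (hA : A.det = 1) {s t : SkewForm n}
    (h : ∀ α β, t.pairing (matrixMap A α) (matrixMap A β) = s.pairing α β) (f g : L1C n) :
    compMatrix A hA (t.mulL1 f g) = s.mulL1 (compMatrix A hA f) (compMatrix A hA g) := by
  apply Lp.ext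
  filter_upwards [coeFn_compMatrix hA (t.mulL1 f g),
    s.coeFn_mulL1 (compMatrix A hA f) (compMatrix A hA g),
    (measurePreserving_matrixMap hA).quasiMeasurePreserving.ae_eq_comp (t.coeFn_mulL1 f g)]
    with α h1 h2 h3
  rw [h1, h2, h3, s.conv_congr (coeFn_compMatrix hA f) (coeFn_compMatrix hA g),
    Function.comp_apply, SkewForm.conv, SkewForm.conv,
    ← (measurePreserving_matrixMap hA).integral_comp (measurableEmbedding_matrixMap hA)]
  simp only [Function.comp_apply, matrixMap_sub, SkewForm.phase, h]

end L1C

namespace TwistedAlgebra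

variable {Y : Type*} [TopologicalSpace Y] {n : ℕ} {s t : C(Y, SkewForm n)}

/-- A continuous family of unimodular matrices acts on `C₀(Y, L¹(ℝⁿ))`. -/
def compMatrixFun (A : Y → Matrix (Fin n) (Fin n) ℝ) (hA : Continuous A) (hd : ∀ y, (A y).det = 1)
    (f : TwistedAlgebra t) : TwistedAlgebra s :=
  show C₀(Y, L1C n) from
  { toFun := fun y => L1C.compMatrix (A y) (hd y) (f y)
    continuous_toFun := f.continuous.compMeasurePreservingLp (L1C.continuous_matrixMap.comp hA)
      (fun y => L1C.measurePreserving_matrixMap (hd y)) ENNReal.one_ne_top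
    zero_at_infty' := squeeze_zero_norm (fun y => (LinearIsometry.norm_map _ _).le)
      (by simpa using f.tendsto.norm) }

/-- A continuous family of unimodular matrices carrying the forms `s` to the forms `t` induces an
isomorphism of the twisted algebras. -/
def compMatrixEquiv (A : Y → Matrix (Fin n) (Fin n) ℝ) (hA : Continuous A)
    (hd : ∀ y, (A y).det = 1)
    (h : ∀ y α β, (t y).pairing (L1C.matrixMap (A y) α) (L1C.matrixMap (A y) β) =
      (s y).pairing α β) : TwistedAlgebra t ≃⋆ₐ[ℂ] TwistedAlgebra s where
  toFun := compMatrixFun A hA hd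
  invFun := compMatrixFun (fun y => (A y).adjugate) hA.matrix_adjugate
    (fun y => by rw [Matrix.det_adjugate, hd, one_pow])
  left_inv f := ext fun y => L1C.compMatrix_compMatrix_of_mul_eq_one
    (by rw [Matrix.det_adjugate, hd, one_pow]) (hd y)
    (by rw [Matrix.mul_adjugate, hd, one_smul]) (f y)
  right_inv f := ext fun y => L1C.compMatrix_compMatrix_of_mul_eq_one (hd y)
    (by rw [Matrix.det_adjugate, hd, one_pow])
    (by rw [Matrix.adjugate_mul, hd, one_smul]) (f y)
  map_add' f g := ext fun y => map_add (L1C.compMatrix (A y) (hd y)) (f y) (g y)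
  map_mul' f g := ext fun y => L1C.compMatrix_mulL1 (hd y) (h y) (f y) (g y)
  map_star' f := ext fun y => L1C.compMatrix_starL1 (hd y) (f y)
  map_smul' c f := ext fun y => map_smul (L1C.compMatrix (A y) (hd y)) c (f y)

end TwistedAlgebra

/-! ## The joint spectrum -/

namespace JointSpectrum

/-- The electric part. -/
def electric (σ : Matrix (Fin 4) (Fin 4) ℝ) : Fin 3 → ℝ := ![σ 0 1, σ 0 2, σ 0 3]

/-- The magnetic part. -/
def magnetic (σ : Matrix (Fin 4) (Fin 4) ℝ) : Fin 3 → ℝ := ![σ 2 3, -σ 1 3, σ 1 2]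

theorem electric_emTensor (e m : Fin 3 → ℝ) : electric (emTensor e m) = e := by
  ext i; fin_cases i <;> simp [electric, emTensor]

theorem magnetic_emTensor (e m : Fin 3 → ℝ) : magnetic (emTensor e m) = m := by
  ext i; fin_cases i <;> simp [magnetic, emTensor]

theorem continuous_electric : Continuous electric := by
  unfold electric
  fun_prop

theorem continuous_magnetic : Continuous magnetic := by
  unfold magnetic
  fun_prop

theorem continuous_emTensor : Continuous fun p : (Fin 3 → ℝ) × (Fin 3 → ℝ) => emTensor p.1 p.2 := by
  refine continuous_matrix fun i j => ?_
  fin_cases i <;> fin_cases j <;> simp [emTensor] <;> fun_prop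

/-- Since e and m can be read off from the entries of σ, the existential condition becomes a system
of closed equations, intersected with the open set σ ≠ 0. This yields local compactness of Σ₀. -/
theorem isLocallyClosed : IsLocallyClosed {σ : SkewForm 4 | σ.1 ≠ 0 ∧ ∃ e m : Fin 3 → ℝ,
    σ.1 = emTensor e m ∧ m ⬝ᵥ m - e ⬝ᵥ e = 0 ∧ e ⬝ᵥ m = 0} := by
  have he : Continuous fun σ : SkewForm 4 => electric σ.1 :=
    continuous_electric.comp continuous_subtype_val
  have hm : Continuous fun σ : SkewForm 4 => magnetic σ.1 :=
    continuous_magnetic.comp continuous_subtype_val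
  refine ⟨{σ | σ.1 ≠ 0}, {σ | σ.1 = emTensor (electric σ.1) (magnetic σ.1) ∧
    magnetic σ.1 ⬝ᵥ magnetic σ.1 - electric σ.1 ⬝ᵥ electric σ.1 = 0 ∧
    electric σ.1 ⬝ᵥ magnetic σ.1 = 0}, ?_, ?_, ?_⟩
  · exact isOpen_ne_fun continuous_subtype_val continuous_const
  · exact (isClosed_eq continuous_subtype_val (continuous_emTensor.comp (he.prodMk hm))).inter
      ((isClosed_eq ((hm.dotProduct hm).sub (he.dotProduct he)) continuous_const).inter
        (isClosed_eq (he.dotProduct hm) continuous_const))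
  · ext σ
    refine and_congr_right fun _ => ⟨?_, fun h => ⟨_, _, h⟩⟩
    rintro ⟨e, m, h, h1, h2⟩
    rw [Set.mem_ofPred_eq, h, electric_emTensor, magnetic_emTensor]
    exact ⟨rfl, h1, h2⟩

instance : LocallyCompactSpace JointSpectrum := by
  have h1 : LocallyCompactSpace (Matrix (Fin 4) (Fin 4) ℝ) :=
    inferInstanceAs (LocallyCompactSpace (Fin 4 → Fin 4 → ℝ))
  have h2 : IsClosed {σ : Matrix (Fin 4) (Fin 4) ℝ | σ.transpose = -σ} :=
    isClosed_eq continuous_id.matrix_transpose continuous_neg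
  have h3 : LocallyCompactSpace (SkewForm 4) := h2.locallyCompactSpace
  exact isLocallyClosed.locallyCompactSpace

/-- A symplectic frame for the tensor with electric part `e` and magnetic part `m`. -/
def frame (e m : Fin 3 → ℝ) : Matrix (Fin 4) (Fin 4) ℝ :=
  !![0, e 0, e 1, e 2;
     1, (e 1 * m 2 - e 2 * m 1) / (e ⬝ᵥ e), (e 2 * m 0 - e 0 * m 2) / (e ⬝ᵥ e),
       (e 0 * m 1 - e 1 * m 0) / (e ⬝ᵥ e);
     0, m 0 / (2 * (e ⬝ᵥ e)), m 1 / (2 * (e ⬝ᵥ e)), m 2 / (2 * (e ⬝ᵥ e));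
     1, -((e 1 * m 2 - e 2 * m 1) / (e ⬝ᵥ e)), -((e 2 * m 0 - e 0 * m 2) / (e ⬝ᵥ e)),
       -((e 0 * m 1 - e 1 * m 0) / (e ⬝ᵥ e))]

/-- With r = e·e and n = (e × m)/r, the rows are (0, e), (1, n), (0, m/(2r)) and (1, -n). Only the
first two enter J ⊕ 0; the others complete them to a basis, and the factor 2r makes the determinant
exactly one. -/
theorem det_frame {e m : Fin 3 → ℝ} (h0 : e ⬝ᵥ e ≠ 0) (h1 : m ⬝ᵥ m = e ⬝ᵥ e) (h2 : e ⬝ᵥ m = 0) :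
    (frame e m).det = 1 := by
  -- Lagrange's identity: ‖e × m‖² = (e·e)(m·m) - (e·m)² = r².
  have key : (e 1 * m 2 - e 2 * m 1) ^ 2 + (e 2 * m 0 - e 0 * m 2) ^ 2 +
      (e 0 * m 1 - e 1 * m 0) ^ 2 = (e ⬝ᵥ e) ^ 2 := by
    have h3 : (e ⬝ᵥ e) * (m ⬝ᵥ m) - (e ⬝ᵥ m) ^ 2 = (e ⬝ᵥ e) ^ 2 := by rw [h1, h2]; ring
    rw [← h3]
    simp only [dotProduct, Fin.sum_univ_three]
    ring
  unfold frame
  generalize e ⬝ᵥ e = r at *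
  simp [Matrix.det_succ_row_zero, Fin.sum_univ_succ, Fin.succAbove, Matrix.submatrix]
  field_simp
  linear_combination 2 * key

theorem formStd_pairing (α β : EuclideanSpace ℝ (Fin 4)) :
    formStd.pairing α β = α 1 * β 0 - α 0 * β 1 := by
  simp [SkewForm.pairing, formStd, Fin.sum_univ_four]
  ring

/-- The condition e·m = 0 makes σ decomposable: it is the exterior product of the covectors (1, n)
and (0, e), whose electric part is e and whose magnetic part is n × e = m. -/
theorem pairing_frame {e m : Fin 3 → ℝ} (h0 : e ⬝ᵥ e ≠ 0) (h2 : e ⬝ᵥ m = 0) {σ : SkewForm 4}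
    (hσ : σ.1 = emTensor e m) (α β : EuclideanSpace ℝ (Fin 4)) :
    formStd.pairing (L1C.matrixMap (frame e m) α) (L1C.matrixMap (frame e m) β) =
      σ.pairing α β := by
  have h3 : e 0 * m 0 + e 1 * m 1 + e 2 * m 2 = 0 := by
    rw [← h2, dotProduct, Fin.sum_univ_three]
  have h4 : e 0 * e 0 + e 1 * e 1 + e 2 * e 2 = e ⬝ᵥ e := by rw [dotProduct, Fin.sum_univ_three]
  rw [formStd_pairing, SkewForm.pairing, hσ]
  unfold frame
  generalize e ⬝ᵥ e = r at *
  simp [L1C.matrixMap_apply, Matrix.toLpLin_apply, dotProduct, Fin.sum_univ_four,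
    emTensor]
  -- The three components of ((e × m)/r) × e = m, by the triple product formula and e·m = 0.
  have c0 : (e 2 * m 0 - e 0 * m 2) / r * e 2 - (e 0 * m 1 - e 1 * m 0) / r * e 1 = m 0 := by
    field_simp
    linear_combination m 0 * h4 - e 0 * h3
  have c1 : (e 0 * m 1 - e 1 * m 0) / r * e 0 - (e 1 * m 2 - e 2 * m 1) / r * e 2 = m 1 := by
    field_simp
    linear_combination m 1 * h4 - e 1 * h3
  have c2 : (e 1 * m 2 - e 2 * m 1) / r * e 1 - (e 2 * m 0 - e 0 * m 2) / r * e 0 = m 2 := by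
    field_simp
    linear_combination m 2 * h4 - e 2 * h3
  linear_combination (α 2 * β 3 - α 3 * β 2) * c0 + (α 3 * β 1 - α 1 * β 3) * c1 +
    (α 1 * β 2 - α 2 * β 1) * c2

/-- If e were zero, equality of norms would give m = 0 and σ = 0. So one may divide by e·e on all of
Σ₀, and a single formula gives a global continuous frame. -/
theorem apply_electric (σ : JointSpectrum) :
    σ.1.1 = emTensor (electric σ.1.1) (magnetic σ.1.1) ∧
      magnetic σ.1.1 ⬝ᵥ magnetic σ.1.1 = electric σ.1.1 ⬝ᵥ electric σ.1.1 ∧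
      electric σ.1.1 ⬝ᵥ magnetic σ.1.1 = 0 ∧ electric σ.1.1 ⬝ᵥ electric σ.1.1 ≠ 0 := by
  obtain ⟨hne, e, m, h, h1, h2⟩ := σ.2
  rw [h, electric_emTensor, magnetic_emTensor]
  refine ⟨rfl, sub_eq_zero.1 h1, h2, fun h0 => hne ?_⟩
  have hm := dotProduct_self_eq_zero.1 ((sub_eq_zero.1 h1).trans h0)
  rw [h, dotProduct_self_eq_zero.1 h0, hm]
  ext i j
  fin_cases i <;> fin_cases j <;> simp [emTensor]

theorem continuous_frame :
    Continuous fun σ : JointSpectrum => frame (electric σ.1.1) (magnetic σ.1.1) := by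
  have he : Continuous fun σ : JointSpectrum => electric σ.1.1 :=
    continuous_electric.comp (continuous_subtype_val.comp continuous_subtype_val)
  have hm : Continuous fun σ : JointSpectrum => magnetic σ.1.1 :=
    continuous_magnetic.comp (continuous_subtype_val.comp continuous_subtype_val)
  have hee := he.dotProduct he
  have h0 : ∀ σ : JointSpectrum, electric σ.1.1 ⬝ᵥ electric σ.1.1 ≠ 0 :=
    fun σ => (apply_electric σ).2.2.2
  have h0' : ∀ σ : JointSpectrum, 2 * (electric σ.1.1 ⬝ᵥ electric σ.1.1) ≠ 0 :=
    fun σ => mul_ne_zero two_ne_zero (h0 σ)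
  have hei : ∀ i, Continuous fun σ : JointSpectrum => electric σ.1.1 i :=
    fun i => (continuous_apply i).comp he
  have hmi : ∀ i, Continuous fun σ : JointSpectrum => magnetic σ.1.1 i :=
    fun i => (continuous_apply i).comp hm
  have hx : ∀ i j k l, Continuous fun σ : JointSpectrum =>
      (electric σ.1.1 i * magnetic σ.1.1 j - electric σ.1.1 k * magnetic σ.1.1 l) /
        (electric σ.1.1 ⬝ᵥ electric σ.1.1) := fun i j k l =>
    (((hei i).mul (hmi j)).sub ((hei k).mul (hmi l))).div hee h0
  have hy : ∀ i, Continuous fun σ : JointSpectrum =>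
      magnetic σ.1.1 i / (2 * (electric σ.1.1 ⬝ᵥ electric σ.1.1)) := fun i =>
    (hmi i).div (continuous_const.mul hee) h0'
  refine continuous_matrix fun i j => ?_
  fin_cases i <;> fin_cases j
  all_goals first
    | exact continuous_const
    | exact hei 0
    | exact hei 1
    | exact hei 2
    | exact hy 0
    | exact hy 1
    | exact hy 2
    | exact hx 1 2 2 1
    | exact hx 2 0 0 2
    | exact hx 0 1 1 0
    | exact (hx 1 2 2 1).neg
    | exact (hx 2 0 0 2).neg
    | exact (hx 0 1 1 0).neg

end JointSpectrum

/-- The algebra of the scale-covariant model is isomorphic to the one twisted by the standard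
form. -/
def standardEquiv : EStd ≃⋆ₐ[ℂ] E0 :=
  TwistedAlgebra.compMatrixEquiv _ JointSpectrum.continuous_frame
    (fun σ => JointSpectrum.det_frame (JointSpectrum.apply_electric σ).2.2.2
      (JointSpectrum.apply_electric σ).2.1 (JointSpectrum.apply_electric σ).2.2.1)
    fun σ => JointSpectrum.pairing_frame (JointSpectrum.apply_electric σ).2.2.2
      (JointSpectrum.apply_electric σ).2.2.1 (JointSpectrum.apply_electric σ).1

/-! ## Maximal C*-norms and enveloping algebras -/

theorem CStarSeminorm.eq_of_apply {A : Type*} [NonUnitalRing A] [StarRing A] [Module ℂ A]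
    {p q : CStarSeminorm A} (h : ∀ a, p a = q a) : p = q := by
  obtain ⟨p, _, _⟩ := p
  obtain ⟨q, _, _⟩ := q
  obtain rfl : p = q := Seminorm.ext h
  rfl

theorem CStarSeminorm.IsMaximalNorm.eq {A : Type*} [NonUnitalRing A] [StarRing A] [Module ℂ A]
    {p q : CStarSeminorm A} (hp : p.IsMaximalNorm) (hq : q.IsMaximalNorm) : p = q :=
  eq_of_apply fun a => le_antisymm (hq.2 p a) (hp.2 q a)

/-- If a homomorphism with dense range dominates all C*-seminorms, it identifies the enveloping
C*-algebra of every algebra isomorphic to its domain. -/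
theorem CStarSeminorm.nonempty_equiv_of_starAlgEquiv {A B C : Type*} [NonUnitalNormedRing A]
    [StarRing A] [NormedStarGroup A] [CompleteSpace A] [NormedSpace ℂ A] [IsScalarTower ℂ A A]
    [SMulCommClass ℂ A A] [StarModule ℂ A] [NonUnitalRing B] [StarRing B] [Module ℂ B]
    [NonUnitalCStarAlgebra C] (θ : B ≃⋆ₐ[ℂ] A) (Φ : B →⋆ₙₐ[ℂ] C) (hd : DenseRange Φ)
    (h : ∀ (p : CStarSeminorm B) b, p b ≤ ‖Φ b‖) : Nonempty (EnvelopingCStarAlgebra A ≃⋆ₐ[ℂ] C) := by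
  obtain ⟨e, -⟩ := exists_equiv_of_forall_le (Φ.comp (θ.symm : A →⋆ₙₐ[ℂ] B)) (by
    rw [DenseRange, show Set.range (Φ.comp (θ.symm : A →⋆ₙₐ[ℂ] B)) = Set.range Φ from
      θ.symm.surjective.range_comp Φ]
    exact hd) fun p a => by
      have h1 : p (θ (θ.symm a)) ≤ ‖Φ (θ.symm a)‖ := h (p.comp (θ : B →⋆ₙₐ[ℂ] A)) (θ.symm a)
      rwa [StarAlgEquiv.apply_symm_apply] at h1
  exact ⟨e⟩

/-- Both enveloping algebras are identified with the same C, by Φ ∘ F and by Φ; composing one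
identification with the inverse of the other gives the induced isomorphism. -/
theorem CStarSeminorm.exists_equiv_of_comp {A B C : Type*} [NonUnitalNormedRing A]
    [StarRing A] [NormedStarGroup A] [CompleteSpace A] [NormedSpace ℂ A] [IsScalarTower ℂ A A]
    [SMulCommClass ℂ A A] [StarModule ℂ A] [NonUnitalNormedRing B] [StarRing B]
    [NormedStarGroup B] [CompleteSpace B] [NormedSpace ℂ B] [IsScalarTower ℂ B B]
    [SMulCommClass ℂ B B] [StarModule ℂ B] [NonUnitalCStarAlgebra C] (F : A →⋆ₙₐ[ℂ] B)
    (Φ : B →⋆ₙₐ[ℂ] C) (hA : DenseRange (Φ.comp F)) (hB : DenseRange Φ)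
    (h : ∀ (p : CStarSeminorm A) a, p a ≤ ‖Φ (F a)‖)
    (h' : ∀ (p : CStarSeminorm B) b, p b ≤ ‖Φ b‖) :
    ∃ Ψ : EnvelopingCStarAlgebra A ≃⋆ₐ[ℂ] EnvelopingCStarAlgebra B,
      ∀ a, Ψ (EnvelopingCStarAlgebra.of A a) = EnvelopingCStarAlgebra.of B (F a) := by
  obtain ⟨e₁, he₁⟩ := exists_equiv_of_forall_le (Φ.comp F) hA h
  obtain ⟨e₂, he₂⟩ := exists_equiv_of_forall_le Φ hB h'
  refine ⟨e₁.trans e₂.symm, fun a => ?_⟩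
  rw [StarAlgEquiv.trans_apply, he₁, StarAlgEquiv.symm_apply_eq, he₂]
  rfl

namespace IsGaussGNS

variable {K : Type*} [NormedAddCommGroup K] [InnerProductSpace ℂ K] [CompleteSpace K]
  {v : L1C 2 →ₗ[ℂ] K}

theorem isMaximalNorm_ofHom_compactRep {Y : Type*} [TopologicalSpace Y] [T2Space Y]
    [LocallyCompactSpace Y] (hv : IsGaussGNS v) :
    (CStarSeminorm.ofHom (hv.compactRep (Y × Plane))).IsMaximalNorm := by
  refine ⟨fun a ha => hv.compactRep_injective ?_, fun q a => ?_⟩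
  · rw [CStarSeminorm.ofHom_apply] at ha
    rw [norm_eq_zero.1 ha, map_zero]
  · exact q.le_norm_compactRep' hv a

theorem denseRange_compactRep_comp_partialFourier {Y : Type*} [TopologicalSpace Y] [T2Space Y]
    [LocallyCompactSpace Y] (hv : IsGaussGNS v) :
    DenseRange ((hv.compactRep (Y × Plane)).comp (partialFourier Y)) :=
  hv.denseRange_compactRep.comp denseRange_partialFourier
    (AddMonoidHomClass.continuous_of_bound (hv.compactRep (Y × Plane)) 1 fun f => by
      rw [one_mul]
      exact hv.norm_compactRep_le f)

end IsGaussGNS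

theorem coeFn_partialFourier {Y : Type*} [TopologicalSpace Y] [T2Space Y] [LocallyCompactSpace Y]
    (f : TwistedAlgebra (ContinuousMap.const Y formStd)) (y : Y) (x : Plane) :
    partialFourier Y f (y, x) =ᵐ[volume] fun αq : Plane =>
      ∫ αc : Plane, f y (directSum αq αc) * Complex.exp (Complex.I * (inner ℝ x αc : ℂ)) := by
  rw [partialFourier_apply]
  exact coeFn_partialHatCLM x (f y)

end

/-! ### Assembly of the four assertions -/

theorem mainTheorem2 {H : Type*} [NormedAddCommGroup H] [InnerProductSpace ℂ H] [CompleteSpace H]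
    [TopologicalSpace.SeparableSpace H] (hH : ¬ FiniteDimensional ℂ H) :
    -- the Banach *-algebra `EStd2` has a unique maximal C*-norm
    (∃! p : CStarSeminorm EStd2, p.IsMaximalNorm) ∧
    -- its enveloping C*-algebra is `C₀(Σ₀ × ℝ², K(H))`
    Nonempty (EnvelopingCStarAlgebra EStd2 ≃⋆ₐ[ℂ] C₀(JointSpectrum × Plane, compactOperators H)) ∧
    -- the partial Fourier transform is an injective *-homomorphism `EStd → EStd2` and induces an
    -- isomorphism of the enveloping C*-algebras
    (∃ F : EStd →⋆ₙₐ[ℂ] EStd2,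
      (∀ (f : EStd) (σ : JointSpectrum) (x : Plane),
        F f (σ, x) =ᵐ[volume] fun αq : Plane =>
          ∫ αc : Plane, f σ (directSum αq αc) * Complex.exp (Complex.I * (inner ℝ x αc : ℂ))) ∧
      Function.Injective F ∧
      ∃ Ψ : EnvelopingCStarAlgebra EStd ≃⋆ₐ[ℂ] EnvelopingCStarAlgebra EStd2,
        ∀ f : EStd, Ψ (EnvelopingCStarAlgebra.of EStd f) =
          EnvelopingCStarAlgebra.of EStd2 (F f)) ∧
    -- the algebra `E0` of the scale-covariant model is isomorphic to `EStd`, and its enveloping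
    -- C*-algebra is `C₀(Σ₀ × ℝ², K(H))` as well
    Nonempty (E0 ≃⋆ₐ[ℂ] EStd) ∧
    Nonempty (EnvelopingCStarAlgebra E0 ≃⋆ₐ[ℂ] C₀(JointSpectrum × Plane, compactOperators H)) :=  by
  obtain ⟨v, hv⟩ := exists_isGaussGNS hH
  refine ⟨⟨_, hv.isMaximalNorm_ofHom_compactRep, fun q hq =>
      hq.eq hv.isMaximalNorm_ofHom_compactRep⟩, ?_, ?_, ?_, ?_⟩
  · obtain ⟨e, -⟩ := CStarSeminorm.exists_equiv_of_forall_le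
      (hv.compactRep (JointSpectrum × Plane)) hv.denseRange_compactRep
      fun p a => p.le_norm_compactRep' hv a
    exact ⟨e⟩
  · exact ⟨partialFourier JointSpectrum, coeFn_partialFourier, partialFourier_injective,
      CStarSeminorm.exists_equiv_of_comp (partialFourier JointSpectrum)
        (hv.compactRep (JointSpectrum × Plane)) hv.denseRange_compactRep_comp_partialFourier
        hv.denseRange_compactRep (fun p a => p.le_norm_compactRep hv a)
        fun p a => p.le_norm_compactRep' hv a⟩
  · exact ⟨standardEquiv.symm⟩
  · exact CStarSeminorm.nonempty_equiv_of_starAlgEquiv standardEquiv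
      ((hv.compactRep (JointSpectrum × Plane)).comp (partialFourier JointSpectrum))
      hv.denseRange_compactRep_comp_partialFourier fun p a => p.le_norm_compactRep hv a
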